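/- \textbf{Setting.} All algebras are over $\mathbb C$; for an algebra $A$ and $X=\sum a\otimes b\in A\otimes A$ put $X'=\sum b\otimes a$, and for a $*$-algebra use on $A\otimes A$ the conjugation $(a\otimes b)^*=b^*\otimes a^*$. A \emph{ribbon Hopf-$*$-algebra} is a Hopf $*$-algebra $(A,\Delta,\epsilon,S)$ with $\epsilon(\xi^*)=\overline{\epsilon(\xi)}$, $\Delta(\xi^*)=\Delta(\xi)^*$, $S(\xi^*)=S(\xi)^*$, an invertible $R\in A\otimes A$ with $R\Delta(\xi)=\Delta'(\xi)R$, $(\Delta\otimes\mathrm{id})R=R_{13}R_{23}$, $(\mathrm{id}\otimes\Delta)R=R_{13}R_{12}$, $R^*=R^{-1}$, and a central $v\in A$ with $v^2=uS(u)$, $S(v)=v$, $\epsilon(v)=1$, $v^*=v^{-1}$, $\Delta(v)=(R'R)^{-1}(v\otimes v)$, where $u=\sum S(r^2)r^1$ for $R=\sum r^1\otimes r^2$. Let $G$ be a finite simple graph with vertex set $S$ (for instance the graph of a triangulation of an oriented surface), $L$ its set of oriented links, $-i$ the link $i$ with opposite orientation, and let a ciliation be given, i.e. for each vertex a linear order $<$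 on the set of links pointing towards it. Let $\mathcal G_*$ be a finite-dimensional semisimple ribbon Hopf-$*$-algebra, and for every $x\in S$ let $\mathcal G_x$ be a ribbon Hopf-$*$-algebra twist equivalent to $\mathcal G_*$: there are a $*$-isomorphism $\iota_x:\mathcal G_x\to\mathcal G_*$ compatible with co-units and antipodes, and $F_x\in\mathcal G_*\otimes\mathcal G_*$ with $F_x^*=F_x^{-1}$, such that $(\iota_x\otimes\iota_x)\Delta_x(\xi)=F_x^{-1}\Delta_*(\iota_x(\xi))F_x$, $(\iota_x\otimes\iota_x)(R_x)=F_x'^{-1}R_*F_x$, $\iota_x(v_x)=v_*$. Let $\mathcal G=\bigotimes_{x\in S}\mathcal G_x$, with the induced co-product $\Delta$, conjugation $*$, $R$-matrix $R$ and ribbon element $v=\bigotimes_x v_x$. Let $(\tau_*^I)_I$ be unitary matrix representations of $\mathcal G_*$, one from each class of irreducible representations, with $\tau^I_*(v_*)=v^I\cdot 1$. Let $C^a_*[IJ|K]$, $a=1,\dots,N^{IJ}_K$, be bases of the spaces of intertwiners $V^I\otimes V^J\to V^K$ (that is, $C(\tau^I_*\otimes\tau^J_*)(\Delta_*(\xi))=\tau^K_*(\xi)C$),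 and let $\kappa_I\in\mathbb C$ satisfy $\kappa_I^2=v^I$ and $$C^a_*[IJ|K]\,(\tau^I_*\otimes\tau^J_*)(R'_*)\,C^b_*[IJ|L]^*=\delta_{a,b}\,\delta_{K,L}\,\frac{\kappa_I\kappa_J}{\kappa_K}.$$ Put $\tau^I_x=\tau^I_*\circ\iota_x$ and $C^a_x[IJ|K]=C^a_*[IJ|K]\,(\tau^I_*\otimes\tau^J_*)(F_x)$. For a link $i$ from $x$ to $y$ let $\tau^{I,i}$ be the representation of $\mathcal G$ on index pairs $\alpha=(a_1,a_2)$ which is $\tau^I_y$ on the index $a_2$ for $\xi\in\mathcal G_y$, ${}^t\tau^I_x(S_x(\xi))$ on the index $a_1$ for $\xi\in\mathcal G_x$, and $\epsilon_z(\xi)\cdot 1$ for $\xi\in\mathcal G_z$, $z\ne x,y$. The \emph{lattice algebra} $\mathcal B$ is the unital associative algebra generated by the unital algebra $\mathcal G$ and elements $U^I_\alpha(i)=U^I_{a_1a_2}(i)$, $i\in L$, subject to the following relations (summation over repeated indices, $i$ pointing from $x$ to $y$ in 2, 4): \begin{enumerate} \item $\xi\,U^I_\alpha(i)=U^I_\beta(i)\,(\tau^{I,i}_{\beta\alpha}\otimes\mathrm{id})(\Delta(\xi))$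 for all $\xi\in\mathcal G$; \item $U^I_{ab}(i)\,U^J_{a'b'}(i)=\sum_{K,m}\overline{C^m_x[IJ|K]_{c,aa'}}\;U^K_{cd}(i)\;C^m_y[IJ|K]_{d,bb'}$ and $U^I_{ab}(i)\,U^I_{bc}(-i)=\delta_{a,c}$; \item $U^I_\alpha(i)\,U^J_\beta(j)=U^J_\gamma(j)\,U^I_\delta(i)\,(\tau^{I,i}_{\delta\alpha}\otimes\tau^{J,j}_{\gamma\beta})(R)$ if $i<j$ (in particular $i$ and $j$ are different links with a common target) or if $i,j$ have no common endpoints; \item $U^I_{ab}(i)\,U^J_{cd}(i)=(\tau^I_x\otimes\tau^J_x)(R_x)_{ac,a'c'}\;U^J_{c'd'}(i)\,U^I_{a'b'}(i)\;(\tau^I_y\otimes\tau^J_y)((R_y')^{-1})_{b'd',bd}$. \end{enumerate} \textbf{Theorem.} There is a unique central $\kappa_*\in\mathcal G_*$ with $\tau^I_*(\kappa_*)=\kappa_I\cdot 1$ for all $I$. The element $\kappa=\bigotimes_x\iota_x^{-1}(\kappa_*)\in\mathcal G$ is central in $\mathcal G$ and invertible, $\kappa^2=v$ and $\kappa^*=\kappa^{-1}$.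 There is a unique conjugate-linear unital anti-homomorphism $\theta:\mathcal B\to\mathcal B$ with $\theta(\xi)=\xi^*$ for $\xi\in\mathcal G$ and, for every link $i$ from $x$ to $y$, $$\theta(U^I_\alpha(i))=\sum_{\gamma,\beta}U^I_\gamma(-i)\,(\tau^{I,-i}_{\gamma\beta}\otimes\mathrm{id})(R^{-1})\,\eta^{I,i}_{\beta\alpha},\qquad \eta^{I,i}_{(b_1,b_2),(a_1,a_2)}=\delta_{b_2,a_1}\,\tau^I_y(S_y(u_y))_{a_2b_1}.$$ It satisfies $\theta(\theta(B))=vBv^{-1}$ for all $B\in\mathcal B$. With $\sigma_\kappa(B)=\kappa^{-1}B\kappa$, one has $(\sigma_\kappa\circ\theta)^2=\mathrm{id}$, and $B^*:=\sigma_\kappa(\theta(B))$ is a $*$-operation on $\mathcal B$ (a conjugate-linear involutive anti-automorphism) which extends the $*$-operation of $\mathcal G$. -/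

import Mathlib

open scoped TensorProduct Kronecker

noncomputable section

namespace LatticeGauge

/-! ### Ribbon Hopf-*-algebras -/

section Ribbon

variable (A : Type*) [Ring A] [HopfAlgebra ℂ A]

/-- `X ↦ X'`, the exchange of the two tensor factors. -/
def swap : A ⊗[ℂ] A →ₐ[ℂ] A ⊗[ℂ] A :=
  (Algebra.TensorProduct.comm ℂ A A).toAlgHom

/-- The exchange of tensor factors on invertible elements. -/
def swapUnit : (A ⊗[ℂ] A)ˣ →* (A ⊗[ℂ] A)ˣ :=
  Units.map (swap A : A ⊗[ℂ] A →* A ⊗[ℂ] A)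

/-- The conjugation on `A ⊗ A` with `(a ⊗ b)^* = b^* ⊗ a^*`
(Mathlib's `star` on a tensor product is `(a ⊗ b)^* = a^* ⊗ b^*`). -/
def flipStar {A : Type*} [Ring A] [HopfAlgebra ℂ A] [StarRing A] [StarModule ℂ A]
    (X : A ⊗[ℂ] A) : A ⊗[ℂ] A :=
  swap A (star X)

/-- `a ⊗ b ↦ a ⊗ b ⊗ 1`. -/
def leg12 : A ⊗[ℂ] A →ₐ[ℂ] A ⊗[ℂ] (A ⊗[ℂ] A) :=
  Algebra.TensorProduct.map (AlgHom.id ℂ A) Algebra.TensorProduct.includeLeft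

/-- `a ⊗ b ↦ a ⊗ 1 ⊗ b`. -/
def leg13 : A ⊗[ℂ] A →ₐ[ℂ] A ⊗[ℂ] (A ⊗[ℂ] A) :=
  Algebra.TensorProduct.map (AlgHom.id ℂ A) Algebra.TensorProduct.includeRight

/-- `a ⊗ b ↦ 1 ⊗ a ⊗ b`. -/
def leg23 : A ⊗[ℂ] A →ₐ[ℂ] A ⊗[ℂ] (A ⊗[ℂ] A) :=
  Algebra.TensorProduct.includeRight

/-- `id ⊗ Δ`. -/
def idComul : A ⊗[ℂ] A →ₐ[ℂ] A ⊗[ℂ] (A ⊗[ℂ] A) :=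
  Algebra.TensorProduct.map (AlgHom.id ℂ A) (Bialgebra.comulAlgHom ℂ A)

/-- `Δ ⊗ id`. -/
def comulId : A ⊗[ℂ] A →ₐ[ℂ] A ⊗[ℂ] (A ⊗[ℂ] A) :=
  (Algebra.TensorProduct.assoc ℂ ℂ ℂ A A A).toAlgHom.comp
    (Algebra.TensorProduct.map (Bialgebra.comulAlgHom ℂ A) (AlgHom.id ℂ A))

/-- The element `u = ∑ S(r²) r¹` built from `R = ∑ r¹ ⊗ r²`. -/
def drinfeldElt {A : Type*} [Ring A] [HopfAlgebra ℂ A] (R : A ⊗[ℂ] A) : A :=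
  LinearMap.mul' ℂ A ((HopfAlgebra.antipode ℂ (A := A)).rTensor A (swap A R))

/-- A ribbon Hopf-*-algebra over `ℂ`, for the conjugation `(a ⊗ b)^* = b^* ⊗ a^*` on `A ⊗ A`. -/
class RibbonHopfStarAlgebra [StarRing A] [StarModule ℂ A] where
  counit_star : ∀ a : A,
    Coalgebra.counit (R := ℂ) (star a) = star (Coalgebra.counit (R := ℂ) a)
  comul_star : ∀ a : A,
    Coalgebra.comul (R := ℂ) (star a) = flipStar (Coalgebra.comul (R := ℂ) a)
  antipode_star : ∀ a : A,
    HopfAlgebra.antipode ℂ (star a) = star (HopfAlgebra.antipode ℂ a)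
  /-- the `R`-matrix -/
  R : (A ⊗[ℂ] A)ˣ
  R_comul : ∀ a : A,
    (R : A ⊗[ℂ] A) * Coalgebra.comul (R := ℂ) a = swap A (Coalgebra.comul (R := ℂ) a) * R
  comulId_R : comulId A R = leg13 A R * leg23 A R
  idComul_R : idComul A R = leg13 A R * leg12 A R
  R_star : flipStar (R : A ⊗[ℂ] A) = ((R⁻¹ : (A ⊗[ℂ] A)ˣ) : A ⊗[ℂ] A)
  /-- the ribbon element -/
  v : A
  v_central : ∀ a : A, v * a = a * v
  v_sq : v ^ 2 = drinfeldElt (R : A ⊗[ℂ] A) *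
    HopfAlgebra.antipode ℂ (drinfeldElt (R : A ⊗[ℂ] A))
  antipode_v : HopfAlgebra.antipode ℂ v = v
  counit_v : Coalgebra.counit (R := ℂ) v = 1
  star_v_mul : star v * v = 1
  comul_v : Coalgebra.comul (R := ℂ) v =
    (((swapUnit A R * R)⁻¹ : (A ⊗[ℂ] A)ˣ) : A ⊗[ℂ] A) * (v ⊗ₜ[ℂ] v)

end Ribbon

/-- Twist equivalence of the ribbon Hopf-*-algebra `A` to the ribbon Hopf-*-algebra `H`. -/
structure TwistEquiv (A H : Type*)
    [Ring A] [HopfAlgebra ℂ A] [StarRing A] [StarModule ℂ A] [RibbonHopfStarAlgebra A]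
    [Ring H] [HopfAlgebra ℂ H] [StarRing H] [StarModule ℂ H] [RibbonHopfStarAlgebra H] where
  /-- the underlying `*`-isomorphism -/
  iso : A ≃ₐ[ℂ] H
  iso_star : ∀ a, iso (star a) = star (iso a)
  /-- the twist -/
  F : (H ⊗[ℂ] H)ˣ
  F_star : flipStar (F : H ⊗[ℂ] H) = ((F⁻¹ : (H ⊗[ℂ] H)ˣ) : H ⊗[ℂ] H)
  counit_iso : ∀ a, Coalgebra.counit (R := ℂ) (iso a) = Coalgebra.counit (R := ℂ) a
  iso_antipode : ∀ a, iso (HopfAlgebra.antipode ℂ a) = HopfAlgebra.antipode ℂ (iso a)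
  iso_comul : ∀ a, Algebra.TensorProduct.map (iso : A →ₐ[ℂ] H) (iso : A →ₐ[ℂ] H)
      (Coalgebra.comul (R := ℂ) a) =
    ((F⁻¹ : (H ⊗[ℂ] H)ˣ) : H ⊗[ℂ] H) * Coalgebra.comul (R := ℂ) (iso a) * F
  iso_R : Algebra.TensorProduct.map (iso : A →ₐ[ℂ] H) (iso : A →ₐ[ℂ] H)
      (RibbonHopfStarAlgebra.R : (A ⊗[ℂ] A)ˣ) =
    (((swapUnit H F)⁻¹ : (H ⊗[ℂ] H)ˣ) : H ⊗[ℂ] H) *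
      (RibbonHopfStarAlgebra.R : (H ⊗[ℂ] H)ˣ) * F
  iso_v : iso RibbonHopfStarAlgebra.v = RibbonHopfStarAlgebra.v

/-! ### Matrix representations -/

section Rep

variable {A B : Type*} [Ring A] [Algebra ℂ A] [Ring B] [Algebra ℂ B]
variable {m n : Type*} [Fintype m] [DecidableEq m] [Fintype n] [DecidableEq n]

/-- `ρ ⊗ σ` on `A ⊗ B`, with values in the matrices indexed by pairs:
its entry at `((p, q), (p', q'))` is `ρ_{p p'} ⊗ σ_{q q'}`. -/
def tensorMat (ρ : A →ₐ[ℂ] Matrix m m ℂ) (σ : B →ₐ[ℂ] Matrix n n ℂ) :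
    A ⊗[ℂ] B →ₐ[ℂ] Matrix (m × n) (m × n) ℂ :=
  (Matrix.kroneckerAlgEquiv m n ℂ).toAlgHom.comp (Algebra.TensorProduct.map ρ σ)

/-- `ρ_{p q} ⊗ id : A ⊗ B → B`. -/
def slice (ρ : A →ₐ[ℂ] Matrix m m ℂ) (p q : m) : A ⊗[ℂ] B →ₗ[ℂ] B :=
  TensorProduct.lid ℂ B ∘ₗ
    LinearMap.rTensor B (Matrix.entryLinearMap ℂ ℂ p q ∘ₗ ρ.toLinearMap)

/-- Irreducibility of a matrix representation of an algebra. -/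
def IsIrred (ρ : A →ₐ[ℂ] Matrix m m ℂ) : Prop :=
  Nonempty m ∧ ∀ W : Submodule ℂ (m → ℂ),
    (∀ a, ∀ w ∈ W, (ρ a).mulVec w ∈ W) → W = ⊥ ∨ W = ⊤

/-- Equivalence of two matrix representations of an algebra. -/
def IsEquivRep (ρ : A →ₐ[ℂ] Matrix m m ℂ) (σ : A →ₐ[ℂ] Matrix n n ℂ) : Prop :=
  ∃ (T : Matrix n m ℂ) (T' : Matrix m n ℂ), T * T' = 1 ∧ T' * T = 1 ∧ ∀ a, T * ρ a = σ a * T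

end Rep

/-- Representation-theoretic data for the ribbon Hopf-*-algebra `H`: a unitary representative of
every class of irreducible representations (labelled by `ι`), Clebsch-Gordan maps, and square roots
`κ_I` of the values `v^I` of the ribbon element, with respect to which the Clebsch-Gordan maps are
normalized. -/
structure RepData (H : Type*) [Ring H] [HopfAlgebra ℂ H] [StarRing H] [StarModule ℂ H]
    [RibbonHopfStarAlgebra H] (ι : Type*) where
  dim : ι → ℕ
  τ : ∀ I, H →ₐ[ℂ] Matrix (Fin (dim I)) (Fin (dim I)) ℂ
  unitary : ∀ I a, τ I (star a) = (τ I a).conjTranspose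
  irred : ∀ I, IsIrred (τ I)
  complete : ∀ (n : ℕ) (ρ : H →ₐ[ℂ] Matrix (Fin n) (Fin n) ℂ), IsIrred ρ →
    ∃! I, IsEquivRep ρ (τ I)
  /-- the multiplicities `N^{IJ}_K` -/
  mult : ι → ι → ι → ℕ
  /-- the Clebsch-Gordan maps `C^a[IJ|K] : V^I ⊗ V^J → V^K` -/
  C : ∀ I J K, Fin (mult I J K) → Matrix (Fin (dim K)) (Fin (dim I) × Fin (dim J)) ℂ
  C_intertwines : ∀ I J K a (ξ : H),
    C I J K a * tensorMat (τ I) (τ J) (Coalgebra.comul (R := ℂ) ξ) = τ K ξ * C I J K a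
  C_independent : ∀ I J K, LinearIndependent ℂ (C I J K)
  C_span : ∀ I J K (T : Matrix (Fin (dim K)) (Fin (dim I) × Fin (dim J)) ℂ),
    (∀ ξ : H, T * tensorMat (τ I) (τ J) (Coalgebra.comul (R := ℂ) ξ) = τ K ξ * T) →
      T ∈ Submodule.span ℂ (Set.range (C I J K))
  κ : ι → ℂ
  κ_sq : ∀ I, τ I RibbonHopfStarAlgebra.v = (κ I ^ 2) • 1
  C_norm : ∀ I J K a b,
    C I J K a * tensorMat (τ I) (τ J) (swap H (RibbonHopfStarAlgebra.R : (H ⊗[ℂ] H)ˣ)) *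
      (C I J K b).conjTranspose = if a = b then (κ I * κ J / κ K) • 1 else 0
  C_orth : ∀ I J K L a b, K ≠ L →
    C I J K a * tensorMat (τ I) (τ J) (swap H (RibbonHopfStarAlgebra.R : (H ⊗[ℂ] H)ˣ)) *
      (C I J L b).conjTranspose = 0

/-- The characterization of `κ_∗ ∈ H`: it is central and acts as `κ_I` in `τ^I`. -/
def RepData.IsKappa {H : Type*} [Ring H] [HopfAlgebra ℂ H] [StarRing H] [StarModule ℂ H]
    [RibbonHopfStarAlgebra H] {ι : Type*} (D : RepData H ι) (k : H) : Prop :=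
  (∀ a, k * a = a * k) ∧ ∀ I, D.τ I k = D.κ I • 1

/-! ### Homomorphisms out of a tensor product of algebras -/

section PiLift

variable {S : Type*} [Fintype S] [DecidableEq S] {A : S → Type*} [∀ x, Ring (A x)]
  [∀ x, Algebra ℂ (A x)] {B : Type*} [Ring B] [Algebra ℂ B]

/-- `(a_x)_x ↦ ∏_x f_x(a_x)` for commuting homomorphisms `f_x`. -/
def piProd (f : ∀ x, A x →ₐ[ℂ] B)
    (hf : Pairwise fun x y => ∀ a b, Commute (f x a) (f y b)) : (∀ x, A x) →* B :=
  MonoidHom.noncommPiCoprod (fun x => (f x).toRingHom.toMonoidHom) fun _ _ h a b => hf h a b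

theorem piProd_mulSingle (f : ∀ x, A x →ₐ[ℂ] B)
    (hf : Pairwise fun x y => ∀ a b, Commute (f x a) (f y b)) (x : S) (a : A x) :
    piProd f hf (Pi.mulSingle x a) = f x a :=
  MonoidHom.noncommPiCoprod_mulSingle (fun x => (f x).toRingHom.toMonoidHom) x a

theorem piProd_update (f : ∀ x, A x →ₐ[ℂ] B)
    (hf : Pairwise fun x y => ∀ a b, Commute (f x a) (f y b)) (m : ∀ x, A x) (x : S) (a : A x) :
    piProd f hf (Function.update m x a) = piProd f hf (Function.update m x 1) * f x a := by
  have h : Function.update m x a = Function.update m x 1 * Pi.mulSingle x a := by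
    funext y
    by_cases hy : y = x
    · subst hy; simp
    · simp [hy]
  rw [h, map_mul, piProd_mulSingle]

/-- `piProd` as a multilinear map. -/
def piLiftMultilinear (f : ∀ x, A x →ₐ[ℂ] B)
    (hf : Pairwise fun x y => ∀ a b, Commute (f x a) (f y b)) : MultilinearMap ℂ A B where
  toFun := piProd f hf
  map_update_add' {inst} m x a b := by
    rw [Subsingleton.elim inst ‹DecidableEq S›, piProd_update f hf m x (a + b),
      piProd_update f hf m x a, piProd_update f hf m x b, map_add, mul_add]
  map_update_smul' {inst} m x c a := by
    rw [Subsingleton.elim inst ‹DecidableEq S›, piProd_update f hf m x (c • a),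
      piProd_update f hf m x a, map_smul, mul_smul_comm]

/-- The homomorphism `⨂_x A_x → B` determined by commuting homomorphisms `f_x : A_x → B`. -/
def piLift (f : ∀ x, A x →ₐ[ℂ] B)
    (hf : Pairwise fun x y => ∀ a b, Commute (f x a) (f y b)) : (⨂[ℂ] x, A x) →ₐ[ℂ] B :=
  PiTensorProduct.liftAlgHom (piLiftMultilinear f hf)
    (map_one (piProd f hf)) (map_mul (piProd f hf))

theorem piLift_single (f : ∀ x, A x →ₐ[ℂ] B)
    (hf : Pairwise fun x y => ∀ a b, Commute (f x a) (f y b)) (x : S) (a : A x) :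
    piLift f hf (PiTensorProduct.singleAlgHom x a) = f x a := by
  have h : piLift f hf (PiTensorProduct.singleAlgHom x a) =
      piProd f hf (Pi.mulSingle x a) := by
    simp [piLift, piLiftMultilinear]
  rw [h, piProd_mulSingle]

theorem single_commute {x y : S} (h : x ≠ y) (a : A x) (b : A y) :
    Commute (PiTensorProduct.singleAlgHom (R := ℂ) (A := A) x a)
      (PiTensorProduct.singleAlgHom y b) := by
  simp only [PiTensorProduct.singleAlgHom_apply]
  exact Commute.tprod (Pi.mulSingle_commute h a b)

/-- `A_x ⊗ A_x → (⨂ A) ⊗ (⨂ A)`, induced by the embedding of `A_x` into `⨂ A`. -/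
def singleTensor (x : S) :
    A x ⊗[ℂ] A x →ₐ[ℂ] (⨂[ℂ] x, A x) ⊗[ℂ] (⨂[ℂ] x, A x) :=
  Algebra.TensorProduct.map (PiTensorProduct.singleAlgHom x) (PiTensorProduct.singleAlgHom x)

theorem singleTensor_commute {x y : S} (h : x ≠ y) (X : A x ⊗[ℂ] A x) (Y : A y ⊗[ℂ] A y) :
    Commute (singleTensor (A := A) x X) (singleTensor y Y) := by
  induction X with
  | zero => simp
  | add X₁ X₂ h₁ h₂ => rw [map_add]; exact h₁.add_left h₂
  | tmul a b =>
    induction Y with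
    | zero => simp
    | add Y₁ Y₂ h₁ h₂ => rw [map_add]; exact h₁.add_right h₂
    | tmul c d =>
      simp only [singleTensor, Algebra.TensorProduct.map_tmul, Commute, SemiconjBy,
        Algebra.TensorProduct.tmul_mul_tmul]
      rw [(single_commute h a c).eq, (single_commute h b d).eq]

end PiLift

/-! ### The algebra of gauge transformations -/

section Gauge

variable {S : Type*} [Fintype S] [DecidableEq S] (𝒢 : S → Type*)
  [∀ x, Ring (𝒢 x)] [∀ x, HopfAlgebra ℂ (𝒢 x)] [∀ x, StarRing (𝒢 x)]
  [∀ x, StarModule ℂ (𝒢 x)] [∀ x, RibbonHopfStarAlgebra (𝒢 x)]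

/-- The full gauge algebra `⨂_x 𝒢_x`. -/
abbrev GaugeAlg := ⨂[ℂ] x, 𝒢 x

/-- The map `⨂_x (𝒢_x ⊗ 𝒢_x) → 𝒢 ⊗ 𝒢` that reorders the tensor factors. -/
def shuffle : (⨂[ℂ] x, 𝒢 x ⊗[ℂ] 𝒢 x) →ₐ[ℂ] GaugeAlg 𝒢 ⊗[ℂ] GaugeAlg 𝒢 :=
  piLift (fun x => singleTensor x) fun _ _ h X Y => singleTensor_commute h X Y

/-- The co-product of `𝒢`. -/
def gaugeComul : GaugeAlg 𝒢 →ₐ[ℂ] GaugeAlg 𝒢 ⊗[ℂ] GaugeAlg 𝒢 :=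
  piLift (fun x => (singleTensor x).comp (Bialgebra.comulAlgHom ℂ (𝒢 x)))
    fun _ _ h a b => singleTensor_commute h (Bialgebra.comulAlgHom ℂ _ a)
      (Bialgebra.comulAlgHom ℂ _ b)

/-- The `R`-matrix of `𝒢`. -/
def gaugeR : (GaugeAlg 𝒢 ⊗[ℂ] GaugeAlg 𝒢)ˣ :=
  Units.map ((shuffle 𝒢 : _ →* GaugeAlg 𝒢 ⊗[ℂ] GaugeAlg 𝒢).comp
      (PiTensorProduct.tprodMonoidHom ℂ))
    (MulEquiv.piUnits.symm fun x => (RibbonHopfStarAlgebra.R : (𝒢 x ⊗[ℂ] 𝒢 x)ˣ))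

/-- The ribbon element of `𝒢`. -/
def gaugeV : GaugeAlg 𝒢 :=
  PiTensorProduct.tprod ℂ fun _ => RibbonHopfStarAlgebra.v

/-- The `*`-operation of `𝒢` as an additive map, `⊗_x ξ_x ↦ ⊗_x ξ_x^*`. -/
def gaugeStarAux : GaugeAlg 𝒢 →+ GaugeAlg 𝒢 :=
  PiTensorProduct.liftAddHom
    (fun p => star p.1 • PiTensorProduct.tprod ℂ fun x => star (p.2 x))
    (by
      intro r f i hf
      have h : PiTensorProduct.tprod ℂ (fun x => star (f x)) = 0 :=
        MultilinearMap.map_coord_zero _ i (by simp [hf])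
      simp [h])
    (by intro f; simp)
    (by
      intro inst r f i a b
      have h : ∀ c : 𝒢 i, (fun x => star (Function.update f i c x)) =
          Function.update (fun x => star (f x)) i (star c) := by
        intro c; funext y
        by_cases hy : y = i
        · subst hy; simp
        · simp [hy]
      simp only [h, star_add, MultilinearMap.map_update_add, smul_add])
    (by intro r r' f; simp [add_smul])
    (by
      intro inst r f i r'
      have h : ∀ c : 𝒢 i, (fun x => star (Function.update f i c x)) =
          Function.update (fun x => star (f x)) i (star c) := by
        intro c; funext y
        by_cases hy : y = i
        · subst hy; simp
        · simp [hy]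
      simp only [h, star_smul, MultilinearMap.map_update_smul, Function.update_eq_self,
        smul_smul, star_mul])

theorem gaugeStarAux_smul_tprod (c : ℂ) (f : ∀ x, 𝒢 x) :
    gaugeStarAux 𝒢 (c • PiTensorProduct.tprod ℂ f) =
      star c • PiTensorProduct.tprod ℂ fun x => star (f x) := by
  rw [← PiTensorProduct.tprodCoeff_eq_smul_tprod]
  rfl

/-- The `*`-operation of `𝒢`, the conjugate-linear map with `⊗_x ξ_x ↦ ⊗_x ξ_x^*`. -/
def gaugeStar : GaugeAlg 𝒢 →ₗ⋆[ℂ] GaugeAlg 𝒢 where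
  toFun := gaugeStarAux 𝒢
  map_add' := map_add _
  map_smul' := by
    intro c X
    induction X using PiTensorProduct.induction_on with
    | smul_tprod r f =>
      rw [smul_smul, gaugeStarAux_smul_tprod, gaugeStarAux_smul_tprod, smul_smul]
      simp
    | add X Y hX hY => rw [smul_add, map_add, hX, hY, map_add, smul_add]

theorem gaugeStar_tprod (f : ∀ x, 𝒢 x) :
    gaugeStar 𝒢 (PiTensorProduct.tprod ℂ f) = PiTensorProduct.tprod ℂ fun x => star (f x) := by
  have h := gaugeStarAux_smul_tprod 𝒢 1 f
  rw [one_smul, star_one, one_smul] at h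
  exact h

end Gauge

/-! ### Representations on the links -/

section Link

variable {S : Type*} [Fintype S] [DecidableEq S] {G : SimpleGraph S} {𝒢 : S → Type*}
  [∀ x, Ring (𝒢 x)] [∀ x, HopfAlgebra ℂ (𝒢 x)] [∀ x, StarRing (𝒢 x)]
  [∀ x, StarModule ℂ (𝒢 x)] [∀ x, RibbonHopfStarAlgebra (𝒢 x)]
  {H : Type*} [Ring H] [HopfAlgebra ℂ H] [StarRing H] [StarModule ℂ H] [RibbonHopfStarAlgebra H]
  {ι : Type*} (tw : ∀ x, TwistEquiv (𝒢 x) H) (D : RepData H ι)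

/-- `τ^I_x = τ^I_∗ ∘ ι_x`. -/
def repAt (x : S) (I : ι) : 𝒢 x →ₐ[ℂ] Matrix (Fin (D.dim I)) (Fin (D.dim I)) ℂ :=
  (D.τ I).comp ((tw x).iso : 𝒢 x →ₐ[ℂ] H)

/-- The twisted Clebsch-Gordan maps `C^a_x[IJ|K] = C^a_∗[IJ|K] (τ^I_∗ ⊗ τ^J_∗)(F_x)`. -/
def cgAt (x : S) (I J K : ι) (a : Fin (D.mult I J K)) :
    Matrix (Fin (D.dim K)) (Fin (D.dim I) × Fin (D.dim J)) ℂ :=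
  D.C I J K a * tensorMat (D.τ I) (D.τ J) ((tw x).F : H ⊗[ℂ] H)

/-- The indices of `U^I(i)`: the first one belongs to the source, the second one to the target
of the link `i`. -/
abbrev RepData.Ix (D : RepData H ι) (I : ι) : Type := Fin (D.dim I) × Fin (D.dim I)

/-- The contragredient representation `ξ ↦ ᵗτ^I_x(S(ξ))`, acting on the source index. -/
def sourceRep (x : S) (I : ι) : 𝒢 x →ₐ[ℂ] Matrix (D.Ix I) (D.Ix I) ℂ where
  toFun ξ := (repAt tw D x I (HopfAlgebra.antipode ℂ ξ)).transpose ⊗ₖ 1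
  map_one' := by simp
  map_mul' a b := by
    rw [HopfAlgebra.antipode_mul_antidistrib, map_mul, Matrix.transpose_mul,
      ← Matrix.mul_kronecker_mul, mul_one]
  map_zero' := by simp
  map_add' a b := by
    rw [map_add, map_add, Matrix.transpose_add, Matrix.add_kronecker]
  commutes' c := by
    simp only [Algebra.algebraMap_eq_smul_one, map_smul, HopfAlgebra.antipode_one, map_one,
      Matrix.transpose_smul, Matrix.transpose_one, Matrix.smul_kronecker, Matrix.one_kronecker_one]

/-- The representation `τ^I_y`, acting on the target index. -/
def targetRep (y : S) (I : ι) : 𝒢 y →ₐ[ℂ] Matrix (D.Ix I) (D.Ix I) ℂ where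
  toFun ξ := (1 : Matrix (Fin (D.dim I)) (Fin (D.dim I)) ℂ) ⊗ₖ repAt tw D y I ξ
  map_one' := by simp
  map_mul' a b := by rw [map_mul, ← Matrix.mul_kronecker_mul, mul_one]
  map_zero' := by simp
  map_add' a b := by rw [map_add, Matrix.kronecker_add]
  commutes' c := by
    simp only [Algebra.algebraMap_eq_smul_one, map_smul, map_one, Matrix.kronecker_smul,
      Matrix.one_kronecker_one]

theorem source_target_commute (x y : S) (I : ι) (a : 𝒢 x) (b : 𝒢 y) :
    Commute (sourceRep tw D x I a) (targetRep tw D y I b) := by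
  simp only [Commute, SemiconjBy, sourceRep, targetRep, AlgHom.coe_mk, RingHom.coe_mk,
    MonoidHom.coe_mk, OneHom.coe_mk, ← Matrix.mul_kronecker_mul, mul_one, one_mul]

/-- The restriction of `τ^{I,i}` to the local algebra `𝒢_z`. -/
def linkRepAt (I : ι) (i : G.Dart) (z : S) : 𝒢 z →ₐ[ℂ] Matrix (D.Ix I) (D.Ix I) ℂ :=
  if z = i.snd then targetRep tw D z I
  else if z = i.fst then sourceRep tw D z I
  else (Algebra.ofId ℂ _).comp (Bialgebra.counitAlgHom ℂ (𝒢 z))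

theorem linkRepAt_commute (I : ι) (i : G.Dart) :
    Pairwise fun x y => ∀ (a : 𝒢 x) (b : 𝒢 y),
      Commute (linkRepAt tw D I i x a) (linkRepAt tw D I i y b) := by
  intro x y hxy a b
  have hz : ∀ (z : S) (c : ℂ) (M : Matrix (D.Ix I) (D.Ix I) ℂ),
      Commute (Algebra.ofId ℂ (Matrix (D.Ix I) (D.Ix I) ℂ) c) M :=
    fun z c M => Algebra.commutes c M
  unfold linkRepAt
  split_ifs with h₁ h₂ h₃ h₄ h₅ h₆ h₇
  · exact absurd (h₁.trans h₂.symm) hxy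
  · exact (source_target_commute tw D _ _ I _ _).symm
  · exact (hz x _ _).symm
  · exact source_target_commute tw D _ _ I _ _
  · exact absurd (h₄.trans h₆.symm) hxy
  · exact (hz x _ _).symm
  all_goals exact hz x _ _

/-- The representation `τ^{I,i}` of `𝒢`. -/
def linkRep (I : ι) (i : G.Dart) : GaugeAlg 𝒢 →ₐ[ℂ] Matrix (D.Ix I) (D.Ix I) ℂ :=
  piLift (linkRepAt tw D I i) (linkRepAt_commute tw D I i)

/-- The matrix elements `η^{I,i}_{βα}` of `η^{I,i} = e^I_x ⊗ ᵗτ^I_y(S(u_y))`, where `i` points from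
`x` to `y`. Here `β` is an index of `U^I(-i)`, hence lists the `y`-index first, and `α` is an index
of `U^I(i)`, hence lists the `x`-index first. -/
def eta (I : ι) (i : G.Dart) (β α : D.Ix I) : ℂ :=
  (if β.2 = α.1 then 1 else 0) *
    repAt tw D i.snd I (HopfAlgebra.antipode ℂ
      (drinfeldElt ((RibbonHopfStarAlgebra.R : (𝒢 i.snd ⊗[ℂ] 𝒢 i.snd)ˣ) :
        𝒢 i.snd ⊗[ℂ] 𝒢 i.snd))) α.2 β.1

end Link

/-! ### The lattice algebra -/

/-- The generators of the lattice algebra: gauge transformations `ξ ∈ 𝒢` and the matrix elements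
`U^I_α(i)` of the lattice connection. -/
inductive Gen {S : Type*} (G : SimpleGraph S) (𝒢 : S → Type*)
    [∀ x, Ring (𝒢 x)] [∀ x, HopfAlgebra ℂ (𝒢 x)]
    {H : Type*} [Ring H] [HopfAlgebra ℂ H] [StarRing H] [StarModule ℂ H]
    [RibbonHopfStarAlgebra H] {ι : Type*} (D : RepData H ι)
  | gauge (ξ : ⨂[ℂ] x, 𝒢 x)
  | conn (I : ι) (i : G.Dart) (α : D.Ix I)

/-- A ciliation: a linear order on the set of links pointing towards `x`, for every vertex `x`. -/
abbrev Ciliation {S : Type*} (G : SimpleGraph S) := ∀ x : S, LinearOrder {i : G.Dart // i.snd = x}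

/-- `i < j`, i.e. `i` and `j` point towards the same vertex `x`, and `i` precedes `j` there. -/
def Ciliation.Before {S : Type*} {G : SimpleGraph S} (cil : Ciliation G) (i j : G.Dart) : Prop :=
  ∃ (x : S) (hi : i.snd = x) (hj : j.snd = x), (cil x).lt ⟨i, hi⟩ ⟨j, hj⟩

/-- The links `i` and `j` have no common endpoint. -/
def NoCommonEnd {S : Type*} {G : SimpleGraph S} (i j : G.Dart) : Prop :=
  i.fst ≠ j.fst ∧ i.fst ≠ j.snd ∧ i.snd ≠ j.fst ∧ i.snd ≠ j.snd

section Lattice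

variable {S : Type*} [Fintype S] [DecidableEq S] {G : SimpleGraph S} (cil : Ciliation G)
  {𝒢 : S → Type*}
  [∀ x, Ring (𝒢 x)] [∀ x, HopfAlgebra ℂ (𝒢 x)] [∀ x, StarRing (𝒢 x)]
  [∀ x, StarModule ℂ (𝒢 x)] [∀ x, RibbonHopfStarAlgebra (𝒢 x)]
  {H : Type*} [Ring H] [HopfAlgebra ℂ H] [StarRing H] [StarModule ℂ H] [RibbonHopfStarAlgebra H]
  {ι : Type*} [Fintype ι] (tw : ∀ x, TwistEquiv (𝒢 x) H) (D : RepData H ι)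

/-- A generator `ξ ∈ 𝒢` in the free algebra. -/
def freeGauge (G : SimpleGraph S) (D : RepData H ι) (ξ : GaugeAlg 𝒢) :
    FreeAlgebra ℂ (Gen G 𝒢 D) :=
  FreeAlgebra.ι ℂ (Gen.gauge ξ)

/-- A generator `U^I_α(i)` in the free algebra. -/
def freeConn (𝒢 : S → Type*) [∀ x, Ring (𝒢 x)] [∀ x, HopfAlgebra ℂ (𝒢 x)]
    (D : RepData H ι) (I : ι) (i : G.Dart) (α : D.Ix I) : FreeAlgebra ℂ (Gen G 𝒢 D) :=
  FreeAlgebra.ι ℂ (Gen.conn I i α)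

/-- The defining relations of the lattice algebra. -/
inductive Rel : FreeAlgebra ℂ (Gen G 𝒢 D) → FreeAlgebra ℂ (Gen G 𝒢 D) → Prop
  -- `𝒢` is a unital subalgebra
  | gauge_one : Rel (freeGauge G D 1) 1
  | gauge_mul (ξ ξ' : GaugeAlg 𝒢) : Rel (freeGauge G D (ξ * ξ')) (freeGauge G D ξ * freeGauge G D ξ')
  | gauge_add (ξ ξ' : GaugeAlg 𝒢) : Rel (freeGauge G D (ξ + ξ')) (freeGauge G D ξ + freeGauge G D ξ')
  | gauge_smul (c : ℂ) (ξ : GaugeAlg 𝒢) : Rel (freeGauge G D (c • ξ)) (c • freeGauge G D ξ)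
  -- covariance
  | covariance (ξ : GaugeAlg 𝒢) (I : ι) (i : G.Dart) (α : D.Ix I) :
      Rel (freeGauge G D ξ * freeConn 𝒢 D I i α)
        (∑ β, freeConn 𝒢 D I i β *
          freeGauge G D (slice (linkRep tw D I i) β α (gaugeComul 𝒢 ξ)))
  -- functoriality; with `i` pointing from `x` to `y`, the matrix elements of
  -- `C^a[IJ|K]^i = C^a_y[IJ|K] ⊗ ᵗ(C^a_x[IJ|K]^*)` are written out
  | functoriality (I J : ι) (i : G.Dart) (α : D.Ix I) (β : D.Ix J) :
      Rel (freeConn 𝒢 D I i α * freeConn 𝒢 D J i β)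
        (∑ K, ∑ a : Fin (D.mult I J K), ∑ γ : D.Ix K,
          (cgAt tw D i.snd I J K a γ.2 (α.2, β.2) *
            (cgAt tw D i.fst I J K a).conjTranspose.transpose γ.1 (α.1, β.1)) •
              freeConn 𝒢 D K i γ)
  -- `U^I(i) U^I(-i) = 1` as matrices, for all oriented links `i`
  | inverse (I : ι) (i : G.Dart) (a c : Fin (D.dim I)) :
      Rel (∑ b, freeConn 𝒢 D I i (a, b) * freeConn 𝒢 D I i.symm (b, c)) (if a = c then 1 else 0)
  -- braid relations of different links
  | braid (i j : G.Dart) (h : cil.Before i j ∨ NoCommonEnd i j)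
      (I J : ι) (α : D.Ix I) (β : D.Ix J) :
      Rel (freeConn 𝒢 D I i α * freeConn 𝒢 D J j β)
        (∑ δ : D.Ix I, ∑ γ : D.Ix J,
          tensorMat (linkRep tw D I i) (linkRep tw D J j)
              (gaugeR 𝒢 : GaugeAlg 𝒢 ⊗[ℂ] GaugeAlg 𝒢) (δ, γ) (α, β) •
            (freeConn 𝒢 D J j γ * freeConn 𝒢 D I i δ))
  -- braid relations of a link `i` from `x` to `y` with itself:
  -- `U¹(i) U²(i) = R_x U²(i) U¹(i) (R_y')⁻¹`
  | braid_self (i : G.Dart) (I J : ι) (α : D.Ix I) (β : D.Ix J) :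
      Rel (freeConn 𝒢 D I i α * freeConn 𝒢 D J i β)
        (∑ δ : D.Ix I, ∑ γ : D.Ix J,
          (tensorMat (repAt tw D i.fst I) (repAt tw D i.fst J)
              ((RibbonHopfStarAlgebra.R : (𝒢 i.fst ⊗[ℂ] 𝒢 i.fst)ˣ) : 𝒢 i.fst ⊗[ℂ] 𝒢 i.fst)
              (α.1, β.1) (δ.1, γ.1) *
            tensorMat (repAt tw D i.snd I) (repAt tw D i.snd J)
              (((swapUnit (𝒢 i.snd) RibbonHopfStarAlgebra.R)⁻¹ : (𝒢 i.snd ⊗[ℂ] 𝒢 i.snd)ˣ) :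
                𝒢 i.snd ⊗[ℂ] 𝒢 i.snd)
              (δ.2, γ.2) (α.2, β.2)) •
            (freeConn 𝒢 D J i γ * freeConn 𝒢 D I i δ))

/-- The lattice algebra `ℬ` of the ciliated graph. -/
abbrev LatticeAlg := RingQuot (Rel cil tw D)

/-- The image of `ξ ∈ 𝒢` in `ℬ`. -/
def gauge (ξ : GaugeAlg 𝒢) : LatticeAlg cil tw D :=
  RingQuot.mkAlgHom ℂ (Rel cil tw D) (freeGauge G D ξ)

/-- The generator `U^I_α(i)` of `ℬ`. -/
def conn (I : ι) (i : G.Dart) (α : D.Ix I) : LatticeAlg cil tw D :=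
  RingQuot.mkAlgHom ℂ (Rel cil tw D) (freeConn 𝒢 D I i α)

/-- The defining properties of the anti-homomorphism `θ` of `ℬ`. -/
structure IsTheta (θ : LatticeAlg cil tw D →ₗ⋆[ℂ] LatticeAlg cil tw D) : Prop where
  map_one : θ 1 = 1
  map_mul : ∀ A B, θ (A * B) = θ B * θ A
  map_gauge : ∀ ξ, θ (gauge cil tw D ξ) = gauge cil tw D (gaugeStar 𝒢 ξ)
  map_conn : ∀ I i α, θ (conn cil tw D I i α) =
    ∑ γ : D.Ix I, ∑ β : D.Ix I, eta tw D I i β α • (conn cil tw D I i.symm γ *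
      gauge cil tw D (slice (linkRep tw D I i.symm) γ β
        (((gaugeR 𝒢)⁻¹ : (GaugeAlg 𝒢 ⊗[ℂ] GaugeAlg 𝒢)ˣ) : GaugeAlg 𝒢 ⊗[ℂ] GaugeAlg 𝒢)))

/-- `B ↦ g⁻¹ B g` for an invertible `g ∈ 𝒢`. -/
def conjBy (g : (GaugeAlg 𝒢)ˣ) (B : LatticeAlg cil tw D) : LatticeAlg cil tw D :=
  gauge cil tw D ((g⁻¹ : (GaugeAlg 𝒢)ˣ) : GaugeAlg 𝒢) * B * gauge cil tw D (g : GaugeAlg 𝒢)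

/-- `κ = ⊗_x ι_x⁻¹(κ_∗) ∈ 𝒢`. -/
def gaugeKappa (k : H) : GaugeAlg 𝒢 :=
  PiTensorProduct.tprod ℂ fun x => (tw x).iso.symm k

end Lattice

end LatticeGauge

end

open scoped TensorProduct Kronecker

noncomputable section

namespace LatticeGauge

open Coalgebra HopfAlgebra

/-! ### Contractions with the antipode -/

section Sandwich

variable {A A' M : Type*} [Ring A] [Algebra ℂ A] [Ring A'] [Algebra ℂ A'] [Ring M] [Algebra ℂ M]

/-! For a link i from x to y regard U(i) as a matrix over the lattice algebra, and let 𝐑_z be the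
matrix (τ_z ⊗ id)(R_z). The prescription for θ through η is an indexed form of a shorter one:
θ(U_{ab}(i)) is the (b,a)-entry of 𝐑_y U(-i) 𝐑_x⁻¹, which is `connStar`. The factor S(u_y) in η is
exactly what turns the contragredient action of R_y⁻¹ at the source of -i into left multiplication
by 𝐑_y (`antipode_drinfeldElt_mul_sandwich`, `connStar_apply`).

In this form the existence of θ is a check of relations. A conjugate-linear anti-homomorphism is a
homomorphism into the conjugate opposite algebra `ConjOp`, so it suffices that the matrices
`connStar` satisfy the reversed and conjugated defining relations. By covariance and (id ⊗ Δ)R =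
R₁₃R₁₂, moving a link matrix past some 𝐑 produces a numerical R-matrix. For a link with itself, the
two R-matrices so produced are those of its self-braid relation and are absorbed by it
(`connStar_mul_connStar_self_eq`). The Clebsch-Gordan maps then slide past the outer factors,
because (Δ ⊗ id)R = R₁₃R₂₃ fuses these (`connStar_functoriality`). The braid relations reduce to the
Yang-Baxter equation (`connStar_braid_self`, `connStar_braid_target`), and covariance to RΔ = Δ'R
(`connStar_covariance`). Uniqueness holds because gauge elements and link matrix elements generate
the lattice algebra.

Applying θ twice gives (R'R)_x U(i) (R'R)_y⁻¹, by unitarity of R (`thetaMat_connStar`). Since Δ(v) =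
(R'R)⁻¹(v ⊗ v) and v acts in τ^I by a number, this equals v U(i) v⁻¹: the number appearing at x is
absorbed at y (`theta_theta_conn_mul`).

Finally, Schur's lemma and the density theorem produce an element of the semisimple algebra with
prescribed scalar values on the irreducible representations, and these representations separate
points. Hence κ_∗ exists, is unique and central, squares to v and is unitary. Conjugation by κ then
corrects θ to an involution: (σ_κ ∘ θ)² is conjugation by κ⁻²v = 1. -/

/-- The linear map `a ⊗ b ↦ p(a) U q(b)`. -/
def sandwich (p : A →ₗ[ℂ] M) (q : A' →ₗ[ℂ] M) (U : M) : A ⊗[ℂ] A' →ₗ[ℂ] M :=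
  LinearMap.mul' ℂ M ∘ₗ TensorProduct.map (LinearMap.mulRight ℂ U ∘ₗ p) q

@[simp] theorem sandwich_tmul (p : A →ₗ[ℂ] M) (q : A' →ₗ[ℂ] M) (U : M) (a : A) (b : A') :
    sandwich p q U (a ⊗ₜ b) = p a * U * q b := by
  simp [sandwich]

end Sandwich

section Hopf

variable {A : Type*} [Ring A] [HopfAlgebra ℂ A]

@[simp] theorem swap_tmul (a b : A) : swap A (a ⊗ₜ b) = b ⊗ₜ a := rfl

@[simp] theorem swap_swap (X : A ⊗[ℂ] A) : swap A (swap A X) = X := by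
  induction X with
  | zero => simp
  | add X Y hX hY => rw [map_add, map_add, hX, hY]
  | tmul a b => simp

variable {M : Type*} [Ring M] [Algebra ℂ M]

theorem sandwich_antipode_comul (f : A →ₐ[ℂ] M) (U : M) (Φ : A →ₗ[ℂ] M) (a : A) :
    sandwich ((f : A →ₗ[ℂ] M) ∘ₗ LinearMap.mul' ℂ A ∘ₗ (antipode ℂ).lTensor A) Φ U
      ((comul (R := ℂ)).rTensor A (comul a)) = U * Φ a := by
  have h : ∀ X : A ⊗[ℂ] A,
      sandwich ((f : A →ₗ[ℂ] M) ∘ₗ LinearMap.mul' ℂ A ∘ₗ (antipode ℂ).lTensor A) Φ U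
        ((comul (R := ℂ)).rTensor A X) =
      LinearMap.mulLeft ℂ U (Φ (TensorProduct.lid ℂ A ((counit (R := ℂ)).rTensor A X))) := by
    intro X
    induction X with
    | zero => simp
    | add X Y hX hY => simp only [map_add, hX, hY]
    | tmul a b => simp [Algebra.algebraMap_eq_smul_one]
  rw [h]
  simp

/-- Applying the hypothesis to the second leg gives f(a₁)g(a₂)U = f(a₁S(a₂)) U g(a₃), and the
antipode axiom removes the first two legs. This trades covariance under a contragredient
representation for a relation without the antipode. -/
theorem lift_comul_mul_eq (f g : A →ₐ[ℂ] M) (h : ∀ a b, Commute (f a) (g b)) (U : M)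
    (hU : ∀ a, g a * U =
      sandwich ((f : A →ₗ[ℂ] M) ∘ₗ antipode ℂ) (g : A →ₗ[ℂ] M) U (comul (R := ℂ) a)) (a : A) :
    Algebra.TensorProduct.lift f g h (comul (R := ℂ) a) * U = U * g a := by
  have key : ∀ X : A ⊗[ℂ] A, Algebra.TensorProduct.lift f g h X * U =
      sandwich ((f : A →ₗ[ℂ] M) ∘ₗ LinearMap.mul' ℂ A ∘ₗ (antipode ℂ).lTensor A)
        (g : A →ₗ[ℂ] M) U
        ((TensorProduct.assoc ℂ A A A).symm ((comul (R := ℂ)).lTensor A X)) := by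
    intro X
    induction X with
    | zero => simp
    | add X Y hX hY => simp only [map_add, add_mul, hX, hY]
    | tmul a b =>
      simp only [Algebra.TensorProduct.lift_tmul, LinearMap.lTensor_tmul, mul_assoc, hU]
      generalize comul (R := ℂ) b = Y
      induction Y with
      | zero => simp
      | add X Y hX hY => simp only [TensorProduct.tmul_add, map_add, mul_add, hX, hY]
      | tmul b c => simp [mul_assoc]
  rw [key, Coalgebra.coassoc_symm_apply, sandwich_antipode_comul]
  rfl

/-- The opposite passage, for the conjugate link matrices: g(a₁) W f(S(a₂)) = W g(a₁) f(a₂S(a₃)) = W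
g(a), using that f and g commute. -/
theorem sandwich_comul_eq_mul (f g : A →ₐ[ℂ] M) (h : ∀ a b, Commute (f a) (g b)) (W : M)
    (hW : ∀ a, g a * W = W * Algebra.TensorProduct.lift f g h (swap A (comul (R := ℂ) a))) (a : A) :
    sandwich (g : A →ₗ[ℂ] M) ((f : A →ₗ[ℂ] M) ∘ₗ antipode ℂ) W (comul (R := ℂ) a) = W * g a := by
  have key : ∀ X : A ⊗[ℂ] A,
      sandwich (g : A →ₗ[ℂ] M) ((f : A →ₗ[ℂ] M) ∘ₗ antipode ℂ) W X =
      W * sandwich (g : A →ₗ[ℂ] M)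
        ((f : A →ₗ[ℂ] M) ∘ₗ LinearMap.mul' ℂ A ∘ₗ (antipode ℂ).lTensor A) 1
        (TensorProduct.assoc ℂ A A A ((comul (R := ℂ)).rTensor A X)) := by
    intro X
    induction X with
    | zero => simp
    | add X Y hX hY => simp only [map_add, mul_add, hX, hY]
    | tmul a b =>
      have e : sandwich (g : A →ₗ[ℂ] M) ((f : A →ₗ[ℂ] M) ∘ₗ antipode ℂ) W (a ⊗ₜ b) =
          W * Algebra.TensorProduct.lift f g h (swap A (comul (R := ℂ) a)) * f (antipode ℂ b) := by
        rw [← hW]; simp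
      rw [e, LinearMap.rTensor_tmul]
      generalize comul (R := ℂ) a = Y
      induction Y with
      | zero => simp
      | add X Y hX hY => simp only [TensorProduct.add_tmul, map_add, mul_add, add_mul, hX, hY]
      | tmul c d =>
        simp only [swap_tmul, Algebra.TensorProduct.lift_tmul, (h _ _).eq]
        simp [mul_assoc]
  have key2 : ∀ X : A ⊗[ℂ] A, sandwich (g : A →ₗ[ℂ] M)
        ((f : A →ₗ[ℂ] M) ∘ₗ LinearMap.mul' ℂ A ∘ₗ (antipode ℂ).lTensor A) 1
        ((comul (R := ℂ)).lTensor A X) =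
      g (TensorProduct.rid ℂ A ((counit (R := ℂ)).lTensor A X)) := by
    intro X
    induction X with
    | zero => simp
    | add X Y hX hY => simp only [map_add, hX, hY]
    | tmul a b => simp [Algebra.algebraMap_eq_smul_one]
  rw [key, Coalgebra.coassoc_apply, key2]
  simp

theorem swap_star [StarRing A] [StarModule ℂ A] (X : A ⊗[ℂ] A) : swap A (star X) = star (swap A X)
    := by
  induction X with
  | zero => simp
  | add X Y hX hY => simp only [map_add, star_add, hX, hY]
  | tmul a b => simp

theorem lift_commute {A' : Type*} [Ring A'] [Algebra ℂ A'] {f : A →ₐ[ℂ] M} {g : A' →ₐ[ℂ] M}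
    (h : ∀ a b, Commute (f a) (g b)) {x : M} (h₁ : ∀ a, Commute (f a) x)
    (h₂ : ∀ a, Commute (g a) x) (X : A ⊗[ℂ] A') :
    Commute (Algebra.TensorProduct.lift f g h X) x := by
  induction X with
  | zero => simp
  | add X Y hX hY => rw [map_add]; exact hX.add_left hY
  | tmul a b => rw [Algebra.TensorProduct.lift_tmul]; exact (h₁ a).mul_left (h₂ b)

theorem lift_swap (f g : A →ₐ[ℂ] M) (h : ∀ a b, Commute (f a) (g b)) (X : A ⊗[ℂ] A) :
    Algebra.TensorProduct.lift f g h (swap A X) =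
      Algebra.TensorProduct.lift g f (fun a b => (h b a).symm) X := by
  induction X with
  | zero => simp
  | add X Y hX hY => simp only [map_add, hX, hY]
  | tmul a b => simpa using (h b a).eq

variable (f₁ f₂ g : A →ₐ[ℂ] M) (h₁₂ : ∀ a b, Commute (f₁ a) (f₂ b))
  (h₁ : ∀ a b, Commute (f₁ a) (g b)) (h₂ : ∀ a b, Commute (f₂ a) (g b))

/-- `a ⊗ (b ⊗ c) ↦ f₁(a) f₂(b) g(c)`. -/
def lift₃ : A ⊗[ℂ] (A ⊗[ℂ] A) →ₐ[ℂ] M :=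
  Algebra.TensorProduct.lift f₁ (Algebra.TensorProduct.lift f₂ g h₂) fun a X =>
    (lift_commute h₂ (fun b => (h₁₂ a b).symm) (fun b => (h₁ a b).symm) X).symm

theorem lift₃_leg (X : A ⊗[ℂ] A) :
    lift₃ f₁ f₂ g h₁₂ h₁ h₂ (leg12 A X) = Algebra.TensorProduct.lift f₁ f₂ h₁₂ X ∧
    lift₃ f₁ f₂ g h₁₂ h₁ h₂ (leg13 A X) = Algebra.TensorProduct.lift f₁ g h₁ X ∧
    lift₃ f₁ f₂ g h₁₂ h₁ h₂ (leg23 A X) = Algebra.TensorProduct.lift f₂ g h₂ X := by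
  induction X with
  | zero => simp
  | add X Y hX hY => simp only [map_add, hX, hY, and_self]
  | tmul a b => simp [lift₃, leg12, leg13, leg23]

/-- `ξ ↦ (f₁ ⊗ f₂)(Δ(ξ))`. -/
def conv : A →ₐ[ℂ] M :=
  (Algebra.TensorProduct.lift f₁ f₂ h₁₂).comp (Bialgebra.comulAlgHom ℂ A)

theorem conv_apply (a : A) :
    conv f₁ f₂ h₁₂ a = Algebra.TensorProduct.lift f₁ f₂ h₁₂ (comul (R := ℂ) a) := rfl

variable {f₁ f₂ g h₁₂ h₁ h₂}

theorem conv_commute (h₁ : ∀ a b, Commute (f₁ a) (g b)) (h₂ : ∀ a b, Commute (f₂ a) (g b))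
    (a b : A) : Commute (conv f₁ f₂ h₁₂ a) (g b) :=
  lift_commute h₁₂ (fun a => h₁ a b) (fun a => h₂ a b) _

theorem commute_conv (h₁₂ : ∀ a b, Commute (f₁ a) (f₂ b)) (h₁ : ∀ a b, Commute (f₁ a) (g b))
    (a b : A) : Commute (f₁ a) (conv f₂ g h₂ b) :=
  (lift_commute h₂ (fun c => (h₁₂ a c).symm) (fun c => (h₁ a c).symm) _).symm

end Hopf

/-! ### The `R`-matrix -/

section RMatrix

variable {A : Type*} [Ring A] [HopfAlgebra ℂ A] [StarRing A] [StarModule ℂ A]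
  [RibbonHopfStarAlgebra A]

variable (A) in
/-- The `R`-matrix, as an element of the tensor product. -/
abbrev Rm : A ⊗[ℂ] A := ((RibbonHopfStarAlgebra.R : (A ⊗[ℂ] A)ˣ) : A ⊗[ℂ] A)

variable (A) in
/-- The inverse of the `R`-matrix, as an element of the tensor product. -/
abbrev Ri : A ⊗[ℂ] A := (((RibbonHopfStarAlgebra.R : (A ⊗[ℂ] A)ˣ)⁻¹ : (A ⊗[ℂ] A)ˣ) : A ⊗[ℂ] A)

theorem Rm_mul_Ri : Rm A * Ri A = 1 := Units.mul_inv _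

theorem Ri_mul_Rm : Ri A * Rm A = 1 := Units.inv_mul _

theorem Ri_mul_swap_comul (a : A) :
    Ri A * swap A (comul (R := ℂ) a) = comul (R := ℂ) a * Ri A := by
  have h := RibbonHopfStarAlgebra.R_comul a
  calc Ri A * swap A (comul (R := ℂ) a)
      = Ri A * (swap A (comul (R := ℂ) a) * Rm A) * Ri A := by
        rw [← mul_assoc, mul_assoc _ (Rm A), Rm_mul_Ri, mul_one]
    _ = comul (R := ℂ) a * Ri A := by rw [← h, ← mul_assoc, Ri_mul_Rm, one_mul]

/-- The `star` on the tensor product does not flip the factors, so the condition R^* = R⁻¹ for the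
flipped conjugation acquires a prime here. -/
theorem star_Rm : star (Rm A) = swap A (Ri A) := by
  rw [Ri, ← RibbonHopfStarAlgebra.R_star, flipStar, swap_swap]

theorem star_Ri : star (Ri A) = swap A (Rm A) := by
  have h := congrArg (fun X => swap A (star X)) (star_Rm (A := A))
  simp only [star_star, swap_star, swap_swap] at h
  exact h.symm

theorem star_comul (a : A) : star (comul (R := ℂ) a) = swap A (comul (R := ℂ) (star a)) := by
  rw [RibbonHopfStarAlgebra.comul_star, flipStar, swap_swap]

variable {M : Type*} [Ring M] [Algebra ℂ M]

theorem lift_mul_lift_inv {f g : A →ₐ[ℂ] M} (h : ∀ a b, Commute (f a) (g b)) :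
    Algebra.TensorProduct.lift f g h (Rm A) * Algebra.TensorProduct.lift f g h (Ri A) = 1 := by
  rw [← map_mul, Rm_mul_Ri, map_one]

theorem lift_inv_mul_lift {f g : A →ₐ[ℂ] M} (h : ∀ a b, Commute (f a) (g b)) :
    Algebra.TensorProduct.lift f g h (Ri A) * Algebra.TensorProduct.lift f g h (Rm A) = 1 := by
  rw [← map_mul, Ri_mul_Rm, map_one]

variable {f₁ f₂ g : A →ₐ[ℂ] M} {h₁₂ : ∀ a b, Commute (f₁ a) (f₂ b)}
  {h₁ : ∀ a b, Commute (f₁ a) (g b)} {h₂ : ∀ a b, Commute (f₂ a) (g b)}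

/-- The axiom (Δ ⊗ id)R = R₁₃R₂₃, read in three commuting representations. -/
theorem lift_conv_left (h : ∀ a b, Commute (conv f₁ f₂ h₁₂ a) (g b)) :
    Algebra.TensorProduct.lift (conv f₁ f₂ h₁₂) g h (Rm A) =
      Algebra.TensorProduct.lift f₁ g h₁ (Rm A) * Algebra.TensorProduct.lift f₂ g h₂ (Rm A) := by
  have key : ∀ X : A ⊗[ℂ] A, Algebra.TensorProduct.lift (conv f₁ f₂ h₁₂) g h X =
      lift₃ f₁ f₂ g h₁₂ h₁ h₂ (comulId A X) := by
    intro X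
    induction X with
    | zero => simp
    | add X Y hX hY => simp only [map_add, hX, hY]
    | tmul a b =>
      simp only [Algebra.TensorProduct.lift_tmul, conv_apply, comulId, AlgHom.comp_apply,
        Algebra.TensorProduct.map_tmul, Bialgebra.comulAlgHom_apply, AlgHom.id_apply]
      generalize comul (R := ℂ) a = Y
      induction Y with
      | zero => simp
      | add X Y hX hY => simp only [TensorProduct.add_tmul, map_add, add_mul, hX, hY]
      | tmul b c => simp [lift₃, mul_assoc]
  rw [key, RibbonHopfStarAlgebra.comulId_R, map_mul, (lift₃_leg f₁ f₂ g h₁₂ h₁ h₂ _).2.1,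
    (lift₃_leg f₁ f₂ g h₁₂ h₁ h₂ _).2.2]

theorem lift_conv_right (h : ∀ a b, Commute (f₁ a) (conv f₂ g h₂ b)) :
    Algebra.TensorProduct.lift f₁ (conv f₂ g h₂) h (Rm A) =
      Algebra.TensorProduct.lift f₁ g h₁ (Rm A) * Algebra.TensorProduct.lift f₁ f₂ h₁₂ (Rm A) := by
  have key : ∀ X : A ⊗[ℂ] A, Algebra.TensorProduct.lift f₁ (conv f₂ g h₂) h X =
      lift₃ f₁ f₂ g h₁₂ h₁ h₂ (idComul A X) := by
    intro X
    induction X with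
    | zero => simp
    | add X Y hX hY => simp only [map_add, hX, hY]
    | tmul a b =>
      simp [conv_apply, idComul, lift₃]
  rw [key, RibbonHopfStarAlgebra.idComul_R, map_mul, (lift₃_leg f₁ f₂ g h₁₂ h₁ h₂ _).2.1,
    (lift₃_leg f₁ f₂ g h₁₂ h₁ h₂ _).1]

/-- The Yang-Baxter equation in a representation. -/
theorem yang_baxter :
    Algebra.TensorProduct.lift f₁ f₂ h₁₂ (Rm A) *
        (Algebra.TensorProduct.lift f₁ g h₁ (Rm A) * Algebra.TensorProduct.lift f₂ g h₂ (Rm A)) =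
      Algebra.TensorProduct.lift f₂ g h₂ (Rm A) * Algebra.TensorProduct.lift f₁ g h₁ (Rm A) *
        Algebra.TensorProduct.lift f₁ f₂ h₁₂ (Rm A) := by
  have h₂₁ : ∀ a b, Commute (f₂ a) (f₁ b) := fun a b => (h₁₂ b a).symm
  rw [← lift_conv_left (h₁₂ := h₁₂) (conv_commute h₁ h₂),
    ← lift_conv_left (h₁₂ := h₂₁) (conv_commute h₂ h₁)]
  -- Both sides contain R₁₂. For any X = a ⊗ b it carries Δ(a) into Δ'(a) and commutes with the
  -- third leg; X = R is the case needed.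
  have key : ∀ X : A ⊗[ℂ] A, Algebra.TensorProduct.lift f₁ f₂ h₁₂ (Rm A) *
      Algebra.TensorProduct.lift (conv f₁ f₂ h₁₂) g (conv_commute h₁ h₂) X =
      Algebra.TensorProduct.lift (conv f₂ f₁ h₂₁) g (conv_commute h₂ h₁) X *
        Algebra.TensorProduct.lift f₁ f₂ h₁₂ (Rm A) := by
    intro X
    induction X with
    | zero => simp
    | add X Y hX hY => simp only [map_add, mul_add, add_mul, hX, hY]
    | tmul a b =>
      have hc : Commute (Algebra.TensorProduct.lift f₁ f₂ h₁₂ (Rm A)) (g b) :=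
        lift_commute _ (fun a => h₁ a b) (fun a => h₂ a b) _
      rw [Algebra.TensorProduct.lift_tmul, Algebra.TensorProduct.lift_tmul, mul_assoc, ← hc.eq,
        ← mul_assoc, ← mul_assoc, conv_apply, conv_apply, ← map_mul,
        RibbonHopfStarAlgebra.R_comul, map_mul, lift_swap]
  exact key _

/-- Moving V past g applies Δ to the second leg of R, and (id ⊗ Δ)R = R₁₃R₁₂ splits the result. This
is the source of every numerical R-matrix that arises when a link matrix passes a gauge factor. -/
theorem mul_lift_eq {V : M} (hV₁ : ∀ a, Commute V (f₁ a))
    (hV₂ : ∀ a, V * g a = Algebra.TensorProduct.lift f₂ g h₂ (comul (R := ℂ) a) * V) :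
    V * Algebra.TensorProduct.lift f₁ g h₁ (Rm A) =
      Algebra.TensorProduct.lift f₁ g h₁ (Rm A) * Algebra.TensorProduct.lift f₁ f₂ h₁₂ (Rm A) *
        V := by
  have key : ∀ X : A ⊗[ℂ] A, V * Algebra.TensorProduct.lift f₁ g h₁ X =
      Algebra.TensorProduct.lift f₁ (conv f₂ g h₂) (commute_conv h₁₂ h₁) X * V := by
    intro X
    induction X with
    | zero => simp
    | add X Y hX hY => simp only [map_add, mul_add, add_mul, hX, hY]
    | tmul a b =>
      rw [Algebra.TensorProduct.lift_tmul, Algebra.TensorProduct.lift_tmul, ← mul_assoc,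
        (hV₁ a).eq, mul_assoc, hV₂, mul_assoc, conv_apply]
  rw [key, lift_conv_right]

/-- The mirror image of `mul_lift_eq`: here the gauge factor stands to the left of V, and the
numerical R-matrix has its legs in the opposite order. -/
theorem lift_mul_eq {V : M} (hV₂ : ∀ a, Commute V (f₂ a))
    (hV₁ : ∀ a, g a * V = V * Algebra.TensorProduct.lift f₁ g h₁ (comul (R := ℂ) a)) :
    Algebra.TensorProduct.lift f₂ g h₂ (Rm A) * V =
      V * (Algebra.TensorProduct.lift f₂ g h₂ (Rm A) *
        Algebra.TensorProduct.lift f₁ f₂ h₁₂ (swap A (Rm A))) := by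
  have h₂₁ : ∀ a b, Commute (f₂ a) (f₁ b) := fun a b => (h₁₂ b a).symm
  have key : ∀ X : A ⊗[ℂ] A, Algebra.TensorProduct.lift f₂ g h₂ X * V =
      V * Algebra.TensorProduct.lift f₂ (conv f₁ g h₁) (commute_conv h₂₁ h₂) X := by
    intro X
    induction X with
    | zero => simp
    | add X Y hX hY => simp only [map_add, mul_add, add_mul, hX, hY]
    | tmul a b =>
      rw [Algebra.TensorProduct.lift_tmul, Algebra.TensorProduct.lift_tmul, ← mul_assoc,
        (hV₂ a).eq, mul_assoc, hV₁, mul_assoc, conv_apply]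
  rw [key, lift_conv_right (h₁₂ := h₂₁) (h₁ := h₂), lift_swap]

end RMatrix

/-! ### The Drinfeld element, its inverse, and the antipode on the R-matrix -/

section Drinfeld

variable {A : Type*} [Ring A] [HopfAlgebra ℂ A]

variable (A) in
/-- The map `a ⊗ b ↦ S(a) b`. -/
def antipodeMul : A ⊗[ℂ] A →ₗ[ℂ] A :=
  LinearMap.mul' ℂ A ∘ₗ (antipode ℂ).rTensor A

@[simp] theorem antipodeMul_tmul (a b : A) : antipodeMul A (a ⊗ₜ b) = antipode ℂ a * b := by
  simp [antipodeMul]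

variable (A) in
/-- The map `a ⊗ (b ⊗ c) ↦ S(a) b ⊗ c`. -/
def antipodeMulLeft : A ⊗[ℂ] (A ⊗[ℂ] A) →ₗ[ℂ] A ⊗[ℂ] A :=
  (antipodeMul A).rTensor A ∘ₗ (TensorProduct.assoc ℂ A A A).symm.toLinearMap

@[simp] theorem antipodeMulLeft_tmul (a b c : A) :
    antipodeMulLeft A (a ⊗ₜ (b ⊗ₜ c)) = (antipode ℂ a * b) ⊗ₜ c := by
  simp [antipodeMulLeft]

theorem antipodeMul_mul_tmul (X : A ⊗[ℂ] A) (c b : A) :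
    antipodeMul A (X * (c ⊗ₜ b)) = antipode ℂ c * antipodeMul A X * b := by
  induction X with
  | zero => simp
  | add X Y hX hY => simp only [add_mul, mul_add, map_add, hX, hY]
  | tmul r s => simp [antipode_mul_antidistrib, mul_assoc]

/-- For X = r ⊗ s the value is S(r) S(a₁)a₂ s; the antipode reverses products, so the antipode axiom
applies in the middle. -/
theorem antipodeMul_comul_mul (a : A) (X : A ⊗[ℂ] A) :
    antipodeMul A (comul (R := ℂ) a * X) = counit (R := ℂ) a • antipodeMul A X := by
  have h : antipodeMul A (comul (R := ℂ) a) = counit (R := ℂ) a • 1 := by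
    rw [← Algebra.algebraMap_eq_smul_one, ← mul_antipode_rTensor_comul_apply]
    rfl
  induction X with
  | zero => simp
  | add X Y hX hY => simp only [mul_add, map_add, hX, hY, smul_add]
  | tmul r s => rw [antipodeMul_mul_tmul, h]; simp

theorem antipodeMulLeft_comulId (X : A ⊗[ℂ] A) :
    antipodeMulLeft A (comulId A X) =
      1 ⊗ₜ TensorProduct.lid ℂ A ((counit (R := ℂ)).rTensor A X) := by
  induction X with
  | zero => simp
  | add X Y hX hY => simp only [map_add, hX, hY, TensorProduct.tmul_add]
  | tmul a b =>
    have h : antipodeMulLeft A (comulId A (a ⊗ₜ b)) =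
        antipodeMul A (comul (R := ℂ) a) ⊗ₜ b := by
      simp only [comulId, AlgHom.comp_apply, Algebra.TensorProduct.map_tmul,
        Bialgebra.comulAlgHom_apply, AlgHom.id_apply]
      generalize comul (R := ℂ) a = Y
      induction Y with
      | zero => simp
      | add X Y hX hY => simp only [TensorProduct.add_tmul, map_add, hX, hY]
      | tmul b c => simp
    have h' := antipodeMul_comul_mul a 1
    rw [mul_one] at h'
    rw [h, h']
    simp [Algebra.TensorProduct.one_def, TensorProduct.smul_tmul]

theorem antipodeMulLeft_leg13_mul_leg23 (X Y : A ⊗[ℂ] A) :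
    antipodeMulLeft A (leg13 A X * leg23 A Y) = (antipode ℂ).rTensor A X * Y := by
  induction X with
  | zero => simp
  | add X X' hX hX' => simp only [map_add, add_mul, hX, hX']
  | tmul a b =>
    induction Y with
    | zero => simp
    | add Y Y' hY hY' => simp only [map_add, mul_add, hY, hY']
    | tmul c d => simp [leg13, leg23]

theorem antipodeMulLeft_leg12_mul_leg13 (X Y : A ⊗[ℂ] A) :
    antipodeMulLeft A (leg12 A X * leg13 A Y) =
      TensorProduct.map (LinearMap.mulRight ℂ (antipodeMul A X) ∘ₗ antipode ℂ) LinearMap.id Y := by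
  induction Y with
  | zero => simp
  | add Y Y' hY hY' => simp only [map_add, mul_add, hY, hY']
  | tmul c d =>
    induction X with
    | zero => simp
    | add X X' hX hX' =>
      simp only [map_add, add_mul, hX, hX', TensorProduct.map_tmul, LinearMap.comp_apply,
        LinearMap.mulRight_apply, mul_add, TensorProduct.add_tmul]
    | tmul a b => simp [leg12, leg13, antipode_mul_antidistrib, mul_assoc]

variable {M : Type*} [Ring M] [Algebra ℂ M]

/-- The co-unit, with values in an algebra. -/
def counitHom (A M : Type*) [Ring A] [HopfAlgebra ℂ A] [Ring M] [Algebra ℂ M] : A →ₐ[ℂ] M :=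
  (Algebra.ofId ℂ M).comp (Bialgebra.counitAlgHom ℂ A)

theorem counitHom_apply (a : A) : counitHom A M a = algebraMap ℂ M (counit (R := ℂ) a) := rfl

theorem counitHom_commute (a : A) (x : M) : Commute (counitHom A M a) x :=
  Algebra.commutes _ _

theorem lift_counitHom_left (g : A →ₐ[ℂ] M) (h : ∀ a b, Commute (counitHom A M a) (g b))
    (a : A) : Algebra.TensorProduct.lift (counitHom A M) g h (comul (R := ℂ) a) = g a := by
  have key : ∀ X : A ⊗[ℂ] A, Algebra.TensorProduct.lift (counitHom A M) g h X =
      g (TensorProduct.lid ℂ A ((counit (R := ℂ)).rTensor A X)) := by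
    intro X
    induction X with
    | zero => simp
    | add X Y hX hY => simp only [map_add, hX, hY]
    | tmul a b => simp [counitHom_apply, Algebra.algebraMap_eq_smul_one]
  rw [key]
  simp

variable [StarRing A] [StarModule ℂ A] [RibbonHopfStarAlgebra A]

/-- The convolution of ε with itself is ε, so (Δ ⊗ id)R = R₁₃R₂₃ makes (ε ⊗ g)(R) idempotent. It is
also invertible, hence 1. -/
theorem lift_counitHom_Rm_left (g : A →ₐ[ℂ] M) (h : ∀ a b, Commute (counitHom A M a) (g b)) :
    Algebra.TensorProduct.lift (counitHom A M) g h (Rm A) = 1 := by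
  have hc : conv (counitHom A M) (counitHom A M) (fun a b => counitHom_commute a _) =
      counitHom A M := AlgHom.ext fun a => lift_counitHom_left _ (fun a _ => counitHom_commute a _)
          a
  have e := lift_conv_left (f₁ := counitHom A M) (f₂ := counitHom A M) (g := g) (h₁ := h)
    (h₂ := h) (h₁₂ := fun a b => counitHom_commute a _) (conv_commute h h)
  simp only [hc] at e
  calc _ = Algebra.TensorProduct.lift (counitHom A M) g h (Rm A) *
        Algebra.TensorProduct.lift (counitHom A M) g h (Rm A) *
          Algebra.TensorProduct.lift (counitHom A M) g h (Ri A) := by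
        rw [mul_assoc, lift_mul_lift_inv, mul_one]
    _ = 1 := by rw [← e, lift_mul_lift_inv]

theorem lift_counitHom_Rm_right (f : A →ₐ[ℂ] M) (h : ∀ a b, Commute (f a) (counitHom A M b)) :
    Algebra.TensorProduct.lift f (counitHom A M) h (Rm A) = 1 := by
  have hc : conv (counitHom A M) (counitHom A M) (fun a b => counitHom_commute a _) =
      counitHom A M := AlgHom.ext fun a => lift_counitHom_left _ (fun a _ => counitHom_commute a _)
          a
  have e := lift_conv_right (f₁ := f) (f₂ := counitHom A M) (g := counitHom A M) (h₁ := h)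
    (h₂ := fun a b => counitHom_commute a _) (h₁₂ := h) (commute_conv h h)
  simp only [hc] at e
  calc _ = Algebra.TensorProduct.lift f (counitHom A M) h (Rm A) *
        Algebra.TensorProduct.lift f (counitHom A M) h (Rm A) *
          Algebra.TensorProduct.lift f (counitHom A M) h (Ri A) := by
        rw [mul_assoc, lift_mul_lift_inv, mul_one]
    _ = 1 := by rw [← e, lift_mul_lift_inv]

theorem lift_counitHom_Ri_left (g : A →ₐ[ℂ] M) (h : ∀ a b, Commute (counitHom A M a) (g b)) :
    Algebra.TensorProduct.lift (counitHom A M) g h (Ri A) = 1 := by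
  have e := lift_inv_mul_lift h
  rwa [lift_counitHom_Rm_left, mul_one] at e

theorem counit_rTensor_Rm :
    TensorProduct.lid ℂ A ((counit (R := ℂ)).rTensor A (Rm A)) = 1 := by
  have key : ∀ X : A ⊗[ℂ] A, Algebra.TensorProduct.lift (counitHom A A) (AlgHom.id ℂ A)
      (fun a b => counitHom_commute a _) X =
      (TensorProduct.lid ℂ A ((counit (R := ℂ)).rTensor A X)) := by
    intro X
    induction X with
    | zero => simp
    | add X Y hX hY => simp only [map_add, hX, hY]
    | tmul a b => simp [counitHom_apply, Algebra.algebraMap_eq_smul_one]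
  rw [← key, lift_counitHom_Rm_left]

/-- Apply a ⊗ b ⊗ c ↦ S(a)b ⊗ c to (Δ ⊗ id)R = R₁₃R₂₃: one side collapses to (ε ⊗ id)R = 1, the
other is (S ⊗ id)(R)·R. -/
theorem antipode_rTensor_Rm : (antipode ℂ).rTensor A (Rm A) = Ri A := by
  have h : (antipode ℂ).rTensor A (Rm A) * Rm A = 1 := by
    rw [← antipodeMulLeft_leg13_mul_leg23, ← RibbonHopfStarAlgebra.comulId_R,
      antipodeMulLeft_comulId, counit_rTensor_Rm, Algebra.TensorProduct.one_def]
  calc _ = (antipode ℂ).rTensor A (Rm A) * (Rm A * Ri A) := by rw [Rm_mul_Ri, mul_one]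
    _ = Ri A := by rw [← mul_assoc, h, one_mul]

variable (A) in
/-- The element `∑ S(r¹) r²` for `R⁻¹ = ∑ r¹ ⊗ r²`. -/
def contraction : A := antipodeMul A (Ri A)

/-- The contraction c implements S². From R⁻¹Δ' = ΔR⁻¹ one gets S(a₂) c a₁ = ε(a) c, and an
additional antipode leg turns this into S²(a) c = c a. -/
theorem antipode_antipode_mul_contraction (a : A) :
    antipode ℂ (antipode ℂ a) * contraction A = contraction A * a := by
  have key : ∀ X : A ⊗[ℂ] A, sandwich (antipode ℂ) LinearMap.id (contraction A) (swap A X) =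
      antipodeMul A (Ri A * swap A X) := by
    intro X
    induction X with
    | zero => simp
    | add X Y hX hY => simp only [map_add, mul_add, hX, hY]
    | tmul a b => simp [antipodeMul_mul_tmul, contraction]
  have key2 : ∀ a : A, sandwich (antipode ℂ) LinearMap.id (contraction A)
      (swap A (comul (R := ℂ) a)) = counit (R := ℂ) a • contraction A := by
    intro a
    rw [key, Ri_mul_swap_comul, antipodeMul_comul_mul, contraction]
  -- The expression S(a₂S(a₃)) c a₁ is evaluated in two ways. Grouping legs 2 and 3 gives c a;
  -- expanding to S²(a₃)S(a₂) c a₁ and grouping legs 1 and 2 gives S²(a) c.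
  let Φ : A ⊗[ℂ] (A ⊗[ℂ] A) →ₗ[ℂ] A :=
    sandwich (antipode ℂ ∘ₗ LinearMap.mul' ℂ A ∘ₗ (antipode ℂ).lTensor A) LinearMap.id
      (contraction A) ∘ₗ (TensorProduct.comm ℂ A (A ⊗[ℂ] A)).toLinearMap
  have h₁ : ∀ X : A ⊗[ℂ] A, Φ (TensorProduct.assoc ℂ A A A ((comul (R := ℂ)).rTensor A X)) =
      antipode ℂ (antipode ℂ (TensorProduct.lid ℂ A ((counit (R := ℂ)).rTensor A X))) *
        contraction A := by
    intro X
    induction X with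
    | zero => simp
    | add X Y hX hY => simp only [map_add, add_mul, hX, hY]
    | tmul a b =>
      have e : antipode ℂ (antipode ℂ (TensorProduct.lid ℂ A
          ((counit (R := ℂ)).rTensor A (a ⊗ₜ b)))) * contraction A =
          antipode ℂ (antipode ℂ b) * sandwich (antipode ℂ) LinearMap.id (contraction A)
            (swap A (comul (R := ℂ) a)) := by
        rw [key2]; simp
      rw [e, LinearMap.rTensor_tmul]
      generalize comul (R := ℂ) a = Y
      induction Y with
      | zero => simp
      | add X Y hX hY => simp only [TensorProduct.add_tmul, map_add, mul_add, hX, hY]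
      | tmul c d => simp [Φ, antipode_mul_antidistrib, mul_assoc]
  have h₂ : ∀ X : A ⊗[ℂ] A, Φ ((comul (R := ℂ)).lTensor A X) =
      contraction A * TensorProduct.rid ℂ A ((counit (R := ℂ)).lTensor A X) := by
    intro X
    induction X with
    | zero => simp
    | add X Y hX hY => simp only [map_add, mul_add, hX, hY]
    | tmul a b => simp [Φ, Algebra.algebraMap_eq_smul_one]
  have h := h₁ (comul (R := ℂ) a)
  rw [Coalgebra.coassoc_apply, h₂] at h
  simpa using h.symm

/-- With R = ∑ a ⊗ b one has S(u) = ∑ S(a)S²(b). Moving c to the left of b turns S(u) c into ∑ S(a)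
c b, which is the contraction of R⁻¹R = 1. -/
theorem antipode_drinfeldElt_mul_contraction :
    antipode ℂ (drinfeldElt (Rm A)) * contraction A = 1 := by
  have key : ∀ X : A ⊗[ℂ] A, antipode ℂ (drinfeldElt X) * contraction A =
      antipodeMul A (Ri A * X) := by
    intro X
    induction X with
    | zero => simp [drinfeldElt]
    | add X Y hX hY =>
      simp only [drinfeldElt] at hX hY
      simp only [drinfeldElt, map_add, add_mul, mul_add, hX, hY]
    | tmul a b =>
      rw [antipodeMul_mul_tmul]
      simp only [drinfeldElt, swap_tmul, LinearMap.rTensor_tmul, LinearMap.mul'_apply,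
        antipode_mul_antidistrib, mul_assoc]
      rw [antipode_antipode_mul_contraction]
      rfl
  rw [key, Ri_mul_Rm, Algebra.TensorProduct.one_def]
  simp

/-- The identity `∑ S(u) S(r¹) r²₍₁₎ ⊗ r²₍₂₎ = R`, where `R⁻¹ = ∑ r¹ ⊗ r²`. -/
theorem antipode_drinfeldElt_mul_antipodeMulLeft :
    (antipode ℂ (drinfeldElt (Rm A)) ⊗ₜ 1) * antipodeMulLeft A (idComul A (Ri A)) = Rm A := by
  have h₁ : idComul A (Ri A) = leg12 A (Ri A) * leg13 A (Ri A) := by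
    have e : (leg13 A (Rm A) * leg12 A (Rm A)) * (leg12 A (Ri A) * leg13 A (Ri A)) = 1 := by
      rw [mul_assoc, ← mul_assoc (leg12 A (Rm A)), ← map_mul (leg12 A), Rm_mul_Ri, map_one, one_mul,
        ← map_mul, Rm_mul_Ri, map_one]
    calc _ = idComul A (Ri A) * ((leg13 A (Rm A) * leg12 A (Rm A)) *
          (leg12 A (Ri A) * leg13 A (Ri A))) := by rw [e, mul_one]
      _ = _ := by
        rw [← RibbonHopfStarAlgebra.idComul_R, ← mul_assoc, ← map_mul, Ri_mul_Rm, map_one, one_mul]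
  -- The first leg of X becomes S(u) S²(a) c = S(u) c a = a. Applied to X = R, after writing one
  -- copy of R⁻¹ as (S ⊗ id)R.
  have key : ∀ X : A ⊗[ℂ] A, (antipode ℂ (drinfeldElt (Rm A)) ⊗ₜ 1) *
      TensorProduct.map (LinearMap.mulRight ℂ (contraction A) ∘ₗ antipode ℂ) LinearMap.id
        ((antipode ℂ).rTensor A X) = X := by
    intro X
    induction X with
    | zero => simp
    | add X Y hX hY => simp only [map_add, mul_add, hX, hY]
    | tmul a b =>
      simp [antipode_antipode_mul_contraction, ← mul_assoc, antipode_drinfeldElt_mul_contraction]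
  rw [h₁, antipodeMulLeft_leg12_mul_leg13, ← contraction]
  conv_lhs => rw [← antipode_rTensor_Rm]
  exact key _

/-- This removes the Drinfeld element from the formula for θ. With R⁻¹ = ∑ r¹ ⊗ r², covariance
rewrites V g(r²) as (f ⊗ g)(Δ(r²)) V, and the preceding identity resums the coefficients to R. -/
theorem antipode_drinfeldElt_mul_sandwich (f g : A →ₐ[ℂ] M) (h : ∀ a b, Commute (f a) (g b))
    (V : M) (hV : ∀ a, V * g a = Algebra.TensorProduct.lift f g h (comul (R := ℂ) a) * V) :
    f (antipode ℂ (drinfeldElt (Rm A))) *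
        sandwich ((f : A →ₗ[ℂ] M) ∘ₗ antipode ℂ) (g : A →ₗ[ℂ] M) V (Ri A) =
      Algebra.TensorProduct.lift f g h (Rm A) * V := by
  have key : ∀ X : A ⊗[ℂ] A,
      sandwich ((f : A →ₗ[ℂ] M) ∘ₗ antipode ℂ) (g : A →ₗ[ℂ] M) V X =
      Algebra.TensorProduct.lift f g h (antipodeMulLeft A (idComul A X)) * V := by
    intro X
    induction X with
    | zero => simp
    | add X Y hX hY => simp only [map_add, add_mul, hX, hY]
    | tmul a b =>
      have e : sandwich ((f : A →ₗ[ℂ] M) ∘ₗ antipode ℂ) (g : A →ₗ[ℂ] M) V (a ⊗ₜ b) =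
          f (antipode ℂ a) * (Algebra.TensorProduct.lift f g h (comul (R := ℂ) b) * V) := by
        rw [← hV]; simp [mul_assoc]
      simp only [e, idComul, Algebra.TensorProduct.map_tmul, AlgHom.id_apply,
        Bialgebra.comulAlgHom_apply]
      generalize comul (R := ℂ) b = Y
      induction Y with
      | zero => simp
      | add X Y hX hY => simp only [TensorProduct.tmul_add, map_add, mul_add, add_mul, hX, hY]
      | tmul c d => simp [mul_assoc]
  have e : f (antipode ℂ (drinfeldElt (Rm A))) = Algebra.TensorProduct.lift f g h
      (antipode ℂ (drinfeldElt (Rm A)) ⊗ₜ 1) := by simp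
  rw [key, e, ← mul_assoc, ← map_mul, antipode_drinfeldElt_mul_antipodeMulLeft]

end Drinfeld

/-! ### Matrices over an algebra -/

set_option linter.unusedSectionVars false

section MatrixOver

variable {A A' B : Type*} [Ring A] [Algebra ℂ A] [Ring A'] [Algebra ℂ A'] [Ring B] [Algebra ℂ B]
variable {m n : Type*} [Fintype m] [DecidableEq m] [Fintype n] [DecidableEq n]

/-- Scalar matrices, as matrices over `B`. -/
def cstHom (B m : Type*) [Ring B] [Algebra ℂ B] [Fintype m] [DecidableEq m] :
    Matrix m m ℂ →ₐ[ℂ] Matrix m m B :=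
  (Algebra.ofId ℂ B).mapMatrix

@[simp] theorem cstHom_apply (P : Matrix m m ℂ) (a b : m) :
    cstHom B m P a b = algebraMap ℂ B (P a b) := rfl

/-- Elements of `B`, as multiples of the unit matrix. -/
def diagHom (B m : Type*) [Ring B] [Algebra ℂ B] [Fintype m] [DecidableEq m] :
    B →ₐ[ℂ] Matrix m m B :=
  Matrix.scalarAlgHom m ℂ

theorem diagHom_mul_apply (b : B) (X : Matrix m m B) (p q : m) :
    (diagHom B m b * X) p q = b * X p q := by
  simp [diagHom, Matrix.scalar_apply]

theorem mul_diagHom_apply (b : B) (X : Matrix m m B) (p q : m) :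
    (X * diagHom B m b) p q = X p q * b := by
  simp [diagHom, Matrix.scalar_apply]

theorem cstHom_commute_diagHom (P : Matrix m m ℂ) (b : B) :
    Commute (cstHom B m P) (diagHom B m b) := by
  ext p q
  rw [diagHom_mul_apply, mul_diagHom_apply, cstHom_apply, Algebra.commutes]

/-- `(ρ ⊗ g)(X)` as a matrix over `B`. -/
def lop (ρ : A →ₐ[ℂ] Matrix m m ℂ) (g : A' →ₐ[ℂ] B) : A ⊗[ℂ] A' →ₐ[ℂ] Matrix m m B :=
  Algebra.TensorProduct.lift ((cstHom B m).comp ρ) ((diagHom B m).comp g)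
    fun _ _ => cstHom_commute_diagHom _ _

theorem lop_tmul (ρ : A →ₐ[ℂ] Matrix m m ℂ) (g : A' →ₐ[ℂ] B) (a : A) (b : A') :
    lop ρ g (a ⊗ₜ b) = cstHom B m (ρ a) * diagHom B m (g b) :=
  Algebra.TensorProduct.lift_tmul _ _ _ a b

theorem lop_tmul_apply (ρ : A →ₐ[ℂ] Matrix m m ℂ) (g : A' →ₐ[ℂ] B) (a : A) (b : A') (p q : m) :
    lop ρ g (a ⊗ₜ b) p q = ρ a p q • g b := by
  rw [lop_tmul, mul_diagHom_apply, cstHom_apply, Algebra.smul_def]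

theorem lop_apply (ρ : A →ₐ[ℂ] Matrix m m ℂ) (g : A' →ₐ[ℂ] B) (X : A ⊗[ℂ] A') (p q : m) :
    lop ρ g X p q = g (slice ρ p q X) := by
  induction X with
  | zero => simp
  | add X Y hX hY => simp only [map_add, Matrix.add_apply, hX, hY]
  | tmul a b => rw [lop_tmul_apply]; simp [slice]

/-- Rectangular scalar matrices, as matrices over `B`. -/
def cstMap (B : Type*) [Ring B] [Algebra ℂ B] (T : Matrix n m ℂ) : Matrix n m B :=
  T.map (algebraMap ℂ B)

theorem cstMap_mul (T : Matrix n m ℂ) {k : Type*} (T' : Matrix m k ℂ) :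
    cstMap B (T * T') = cstMap B T * cstMap B T' :=
  Matrix.map_mul

theorem cstMap_mul_mul_cstMap_apply {k l : Type*} (T : Matrix k m ℂ) (X : Matrix m n B)
    (T' : Matrix n l ℂ) (p : k) (q : l) :
    (cstMap B T * X * cstMap B T') p q = ∑ d, ∑ c, (T p c * T' d q) • X c d := by
  rw [Matrix.mul_apply]
  refine Finset.sum_congr rfl fun d _ => ?_
  rw [Matrix.mul_apply, Finset.sum_mul]
  refine Finset.sum_congr rfl fun c _ => ?_
  rw [cstMap, cstMap, Matrix.map_apply, Matrix.map_apply, ← Algebra.commutes, ← Algebra.smul_def,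
    ← Algebra.smul_def, smul_smul, mul_comm]

theorem cstMap_mul_diagHom (T : Matrix n m ℂ) (b : B) :
    cstMap B T * diagHom B m b = diagHom B n b * cstMap B T := by
  ext p q
  simp [diagHom, Matrix.scalar_apply, cstMap, Algebra.commutes]

theorem cstMap_mul_lop {T : Matrix n m ℂ} {ρ : A →ₐ[ℂ] Matrix m m ℂ} {σ : A →ₐ[ℂ] Matrix n n ℂ}
    (h : ∀ a, T * ρ a = σ a * T) (g : A' →ₐ[ℂ] B) (X : A ⊗[ℂ] A') :
    cstMap B T * lop ρ g X = lop σ g X * cstMap B T := by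
  induction X with
  | zero => simp
  | add X Y hX hY => simp only [map_add, Matrix.mul_add, Matrix.add_mul, hX, hY]
  | tmul a b =>
    have e : cstMap B T * cstHom B m (ρ a) = cstHom B n (σ a) * cstMap B T := by
      have := congrArg (cstMap B) (h a)
      rwa [cstMap_mul, cstMap_mul] at this
    rw [lop_tmul, lop_tmul, ← Matrix.mul_assoc, e, Matrix.mul_assoc, cstMap_mul_diagHom,
      ← Matrix.mul_assoc]

/-! ### Tensor products of matrices over an algebra -/

variable (B m n) in
/-- The embedding `X ↦ X ⊗ 1`. -/
def inLeft : Matrix m m B →ₐ[ℂ] Matrix (m × n) (m × n) B :=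
  AlgHom.ofLinearMap
    { toFun := fun X => Matrix.of fun p q => if p.2 = q.2 then X p.1 q.1 else 0
      map_add' := fun X Y => by ext p q; by_cases h : p.2 = q.2 <;> simp [h]
      map_smul' := fun c X => by ext p q; by_cases h : p.2 = q.2 <;> simp [h] }
    (by ext ⟨a, c⟩ ⟨b, d⟩; by_cases h : c = d <;> by_cases h' : a = b <;> simp
        [Matrix.one_apply, h, h'])
    (fun X Y => by
      ext ⟨a, c⟩ ⟨b, d⟩
      by_cases h : c = d <;> simp [Matrix.mul_apply, Fintype.sum_prod_type, h])

variable (B m n) in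
/-- The embedding `Y ↦ 1 ⊗ Y`. -/
def inRight : Matrix n n B →ₐ[ℂ] Matrix (m × n) (m × n) B :=
  AlgHom.ofLinearMap
    { toFun := fun X => Matrix.of fun p q => if p.1 = q.1 then X p.2 q.2 else 0
      map_add' := fun X Y => by ext p q; by_cases h : p.1 = q.1 <;> simp [h]
      map_smul' := fun c X => by ext p q; by_cases h : p.1 = q.1 <;> simp [h] }
    (by ext ⟨a, c⟩ ⟨b, d⟩; simp [Matrix.one_apply, ite_and])
    (fun X Y => by
      ext ⟨a, c⟩ ⟨b, d⟩
      by_cases h : a = b <;> simp [Matrix.mul_apply, Fintype.sum_prod_type, h])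

theorem inLeft_apply (X : Matrix m m B) (p q : m × n) :
    inLeft B m n X p q = if p.2 = q.2 then X p.1 q.1 else 0 := rfl

theorem inRight_apply (X : Matrix n n B) (p q : m × n) :
    inRight B m n X p q = if p.1 = q.1 then X p.2 q.2 else 0 := rfl

/-- The entries need not commute, so the order of the two embeddings records the order of the
entries. Exchange relations between matrix elements thus become relations between `inLeft` and
`inRight`. -/
theorem inLeft_mul_inRight_apply (X : Matrix m m B) (Y : Matrix n n B) (p q : m × n) :
    (inLeft B m n X * inRight B m n Y) p q = X p.1 q.1 * Y p.2 q.2 := by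
  simp [Matrix.mul_apply, Fintype.sum_prod_type, inLeft_apply, inRight_apply]

theorem inRight_mul_inLeft_apply (X : Matrix m m B) (Y : Matrix n n B) (p q : m × n) :
    (inRight B m n Y * inLeft B m n X) p q = Y p.2 q.2 * X p.1 q.1 := by
  simp [Matrix.mul_apply, Fintype.sum_prod_type, inLeft_apply, inRight_apply]

theorem inLeft_commute_inRight {X : Matrix m m B} {Y : Matrix n n B}
    (h : ∀ a b c d, Commute (X a b) (Y c d)) : Commute (inLeft B m n X) (inRight B m n Y) := by
  ext p q
  rw [inLeft_mul_inRight_apply, inRight_mul_inLeft_apply, (h _ _ _ _).eq]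

theorem inLeft_cstHom_commute (P : Matrix m m ℂ) (Y : Matrix n n B) :
    Commute (inLeft B m n (cstHom B m P)) (inRight B m n Y) :=
  inLeft_commute_inRight fun _ _ _ _ => Algebra.commutes _ _

theorem inRight_cstHom_commute (P : Matrix n n ℂ) (X : Matrix m m B) :
    Commute (inRight B m n (cstHom B n P)) (inLeft B m n X) :=
  (inLeft_commute_inRight fun _ _ _ _ => (Algebra.commutes _ _).symm).symm

theorem inLeft_diagHom (b : B) : inLeft B m n (diagHom B m b) = diagHom B (m × n) b := by
  ext ⟨a, c⟩ ⟨a', d⟩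
  by_cases h : c = d <;> by_cases h' : a = a' <;>
    simp [inLeft_apply, diagHom, Matrix.scalar_apply, h, h']

theorem inRight_diagHom (b : B) : inRight B m n (diagHom B n b) = diagHom B (m × n) b := by
  ext ⟨a, c⟩ ⟨a', d⟩
  simp [inRight_apply, diagHom, Matrix.scalar_apply, Matrix.diagonal_apply, ite_and]

variable (B m n) in
/-- A representation acting on the first tensor factor. -/
def repL (ρ : A →ₐ[ℂ] Matrix m m ℂ) : A →ₐ[ℂ] Matrix (m × n) (m × n) B :=
  (inLeft B m n).comp ((cstHom B m).comp ρ)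

variable (B m n) in
/-- A representation acting on the second tensor factor. -/
def repR (σ : A →ₐ[ℂ] Matrix n n ℂ) : A →ₐ[ℂ] Matrix (m × n) (m × n) B :=
  (inRight B m n).comp ((cstHom B n).comp σ)

variable (ρ : A →ₐ[ℂ] Matrix m m ℂ) (σ : A' →ₐ[ℂ] Matrix n n ℂ)

theorem repL_commute_repR (a : A) (b : A') : Commute (repL B m n ρ a) (repR B m n σ b) :=
  inLeft_cstHom_commute _ _

theorem repL_commute_diagHom (a : A) (b : B) :
    Commute (repL B m n ρ a) (diagHom B (m × n) b) := by
  rw [← inLeft_diagHom]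
  exact (cstHom_commute_diagHom _ _).map (inLeft B m n)

theorem repR_commute_diagHom (a : A') (b : B) :
    Commute (repR B m n σ a) (diagHom B (m × n) b) := by
  rw [← inRight_diagHom]
  exact (cstHom_commute_diagHom _ _).map (inRight B m n)

theorem cstHom_tensorMat (X : A ⊗[ℂ] A') :
    cstHom B (m × n) (tensorMat ρ σ X) =
      Algebra.TensorProduct.lift (repL B m n ρ) (repR B m n σ) (repL_commute_repR ρ σ) X := by
  induction X with
  | zero => simp
  | add X Y hX hY => simp only [map_add, hX, hY]
  | tmul a b =>
    ext p q
    rw [Algebra.TensorProduct.lift_tmul]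
    simp only [repL, repR, AlgHom.comp_apply, inLeft_mul_inRight_apply]
    simp [tensorMat, Matrix.kroneckerMap_apply]

theorem inLeft_lop (g : A' →ₐ[ℂ] B) (X : A ⊗[ℂ] A') :
    inLeft B m n (lop ρ g X) = Algebra.TensorProduct.lift (repL B m n ρ)
      ((diagHom B (m × n)).comp g) (fun _ _ => repL_commute_diagHom ρ _ _) X := by
  induction X with
  | zero => simp
  | add X Y hX hY => simp only [map_add, hX, hY]
  | tmul a b => rw [lop_tmul, map_mul, inLeft_diagHom]; simp [repL]

theorem inRight_lop (g : A →ₐ[ℂ] B) (X : A' ⊗[ℂ] A) :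
    inRight B m n (lop σ g X) = Algebra.TensorProduct.lift (repR B m n σ)
      ((diagHom B (m × n)).comp g) (fun _ _ => repR_commute_diagHom σ _ _) X := by
  induction X with
  | zero => simp
  | add X Y hX hY => simp only [map_add, hX, hY]
  | tmul a b => rw [lop_tmul, map_mul, inRight_diagHom]; simp [repR]

end MatrixOver

/-! ### The `R`-matrix in matrix representations -/

section LopR

variable {A B : Type*} [Ring A] [HopfAlgebra ℂ A] [StarRing A] [StarModule ℂ A]
  [RibbonHopfStarAlgebra A] [Ring B] [Algebra ℂ B]
variable {m n : Type*} [Fintype m] [DecidableEq m] [Fintype n] [DecidableEq n]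
variable (ρ : A →ₐ[ℂ] Matrix m m ℂ) (σ : A →ₐ[ℂ] Matrix n n ℂ) (g : A →ₐ[ℂ] B)

/-- (Δ ⊗ id)R = R₁₃R₂₃ with matrices in the first two legs: R in a tensor product of representations
factorizes. With Δ' in place of Δ, the factors occur in reverse order. -/
theorem lop_tensorMat_comul (T : A →ₐ[ℂ] Matrix (m × n) (m × n) ℂ)
    (hT : ∀ a, T a = tensorMat ρ σ (comul (R := ℂ) a)) :
    lop T g (Rm A) = inLeft B m n (lop ρ g (Rm A)) * inRight B m n (lop σ g (Rm A)) := by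
  have e : (cstHom B (m × n)).comp T =
      conv (repL B m n ρ) (repR B m n σ) (repL_commute_repR ρ σ) := by
    ext1 a
    rw [AlgHom.comp_apply, hT, cstHom_tensorMat]
    rfl
  have h₁ : ∀ a b, Commute (repL B m n ρ a) ((diagHom B (m × n)).comp g b) :=
    fun a b => repL_commute_diagHom ρ a (g b)
  have h₂ : ∀ a b, Commute (repR B m n σ a) ((diagHom B (m × n)).comp g b) :=
    fun a b => repR_commute_diagHom σ a (g b)
  rw [inLeft_lop, inRight_lop, ← lift_conv_left (h₁₂ := repL_commute_repR ρ σ)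
    (h₁ := h₁) (h₂ := h₂) (conv_commute h₁ h₂)]
  simp only [lop, e]

theorem lop_tensorMat_swap_comul (T : A →ₐ[ℂ] Matrix (m × n) (m × n) ℂ)
    (hT : ∀ a, T a = tensorMat ρ σ (swap A (comul (R := ℂ) a))) :
    lop T g (Rm A) = inRight B m n (lop σ g (Rm A)) * inLeft B m n (lop ρ g (Rm A)) := by
  have e : (cstHom B (m × n)).comp T =
      conv (repR B m n σ) (repL B m n ρ) (fun a b => (repL_commute_repR ρ σ b a).symm) := by
    ext1 a
    rw [AlgHom.comp_apply, hT, cstHom_tensorMat, lift_swap]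
    rfl
  have h₁ : ∀ a b, Commute (repL B m n ρ a) ((diagHom B (m × n)).comp g b) :=
    fun a b => repL_commute_diagHom ρ a (g b)
  have h₂ : ∀ a b, Commute (repR B m n σ a) ((diagHom B (m × n)).comp g b) :=
    fun a b => repR_commute_diagHom σ a (g b)
  rw [inLeft_lop, inRight_lop, ← lift_conv_left
    (h₁₂ := fun a b => (repL_commute_repR ρ σ b a).symm) (h₁ := h₂) (h₂ := h₁) (conv_commute h₂ h₁)]
  simp only [lop, e]

theorem lop_yang_baxter :
    cstHom B (m × n) (tensorMat ρ σ (Rm A)) *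
        (inLeft B m n (lop ρ g (Rm A)) * inRight B m n (lop σ g (Rm A))) =
      inRight B m n (lop σ g (Rm A)) * inLeft B m n (lop ρ g (Rm A)) *
        cstHom B (m × n) (tensorMat ρ σ (Rm A)) := by
  rw [cstHom_tensorMat, inLeft_lop, inRight_lop]
  exact yang_baxter

/-- The hypothesis is the form that covariance takes at the source of a link. -/
theorem inRight_mul_inLeft_lop {V : Matrix n n B}
    (hV : ∀ a, V * diagHom B n (g a) = lop σ g (comul (R := ℂ) a) * V) :
    inRight B m n V * inLeft B m n (lop ρ g (Rm A)) =
      inLeft B m n (lop ρ g (Rm A)) * cstHom B (m × n) (tensorMat ρ σ (Rm A)) *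
        inRight B m n V := by
  rw [cstHom_tensorMat, inLeft_lop]
  refine mul_lift_eq (h₂ := fun _ _ => repR_commute_diagHom σ _ _)
    (fun a => (inLeft_cstHom_commute _ _).symm) fun a => ?_
  have h := congrArg (inRight B m n) (hV a)
  rwa [map_mul, map_mul, inRight_diagHom, inRight_lop] at h

/-- The hypothesis is the form that covariance takes at the target of a link. -/
theorem inRight_lop_mul_inLeft {V : Matrix m m B}
    (hV : ∀ a, diagHom B m (g a) * V = V * lop ρ g (comul (R := ℂ) a)) :
    inRight B m n (lop σ g (Rm A)) * inLeft B m n V =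
      inLeft B m n V * (inRight B m n (lop σ g (Rm A)) *
        cstHom B (m × n) (tensorMat ρ σ (swap A (Rm A)))) := by
  rw [cstHom_tensorMat, inRight_lop]
  refine lift_mul_eq (h₁ := fun _ _ => repL_commute_diagHom ρ _ _)
    (fun a => (inRight_cstHom_commute _ _).symm) fun a => ?_
  have h := congrArg (inLeft B m n) (hV a)
  rwa [map_mul, map_mul, inLeft_diagHom, inLeft_lop] at h

theorem lop_Rm_mul_lop_Ri : lop ρ g (Rm A) * lop ρ g (Ri A) = 1 := by
  rw [← map_mul, Rm_mul_Ri, map_one]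

theorem lop_Ri_mul_lop_Rm : lop ρ g (Ri A) * lop ρ g (Rm A) = 1 := by
  rw [← map_mul, Ri_mul_Rm, map_one]

variable {ρ σ g}

theorem lop_tensorMat_comul_inv {T : A →ₐ[ℂ] Matrix (m × n) (m × n) ℂ}
    (hT : ∀ a, T a = tensorMat ρ σ (comul (R := ℂ) a)) :
    lop T g (Ri A) = inRight B m n (lop σ g (Ri A)) * inLeft B m n (lop ρ g (Ri A)) := by
  have h := lop_tensorMat_comul ρ σ g T hT
  have e : inLeft B m n (lop ρ g (Rm A)) * inRight B m n (lop σ g (Rm A)) *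
      (inRight B m n (lop σ g (Ri A)) * inLeft B m n (lop ρ g (Ri A))) = 1 := by
    rw [mul_assoc, ← mul_assoc (inRight B m n _), ← map_mul, lop_Rm_mul_lop_Ri, map_one, one_mul,
      ← map_mul, lop_Rm_mul_lop_Ri, map_one]
  calc _ = lop T g (Ri A) * (lop T g (Rm A) *
        (inRight B m n (lop σ g (Ri A)) * inLeft B m n (lop ρ g (Ri A)))) := by
        rw [h, e, mul_one]
    _ = _ := by rw [← mul_assoc, lop_Ri_mul_lop_Rm, one_mul]

theorem inRight_lop_Ri_mul_inLeft {V : Matrix m m B}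
    (hV : ∀ a, diagHom B m (g a) * V = V * lop ρ g (comul (R := ℂ) a)) :
    inRight B m n (lop σ g (Ri A)) * inLeft B m n V =
      inLeft B m n V * cstHom B (m × n) (tensorMat ρ σ (swap A (Ri A))) *
        inRight B m n (lop σ g (Ri A)) := by
  have h := inRight_lop_mul_inLeft ρ σ g hV
  have e₁ : inRight B m n (lop σ g (Ri A)) * inRight B m n (lop σ g (Rm A)) = 1 := by
    rw [← map_mul, lop_Ri_mul_lop_Rm, map_one]
  have e₂ : inRight B m n (lop σ g (Rm A)) * inRight B m n (lop σ g (Ri A)) = 1 := by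
    rw [← map_mul, lop_Rm_mul_lop_Ri, map_one]
  have e₃ : cstHom B (m × n) (tensorMat ρ σ (swap A (Rm A))) *
      cstHom B (m × n) (tensorMat ρ σ (swap A (Ri A))) = 1 := by
    rw [← map_mul, ← map_mul, ← map_mul, Rm_mul_Ri, map_one, map_one, map_one]
  calc _ = inRight B m n (lop σ g (Ri A)) * (inLeft B m n V * (inRight B m n (lop σ g (Rm A)) *
        cstHom B (m × n) (tensorMat ρ σ (swap A (Rm A))))) *
        cstHom B (m × n) (tensorMat ρ σ (swap A (Ri A))) * inRight B m n (lop σ g (Ri A)) := by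
        simp only [mul_assoc]
        rw [← mul_assoc (cstHom B (m × n) (tensorMat ρ σ (swap A (Rm A)))), e₃, one_mul, e₂,
          mul_one]
    _ = _ := by
        rw [← h, ← mul_assoc (inRight B m n (lop σ g (Ri A))) (inRight B m n (lop σ g (Rm A))), e₁,
          one_mul]

end LopR

/-! ### The relations of the lattice algebra in matrix form -/

section LatticeRelations

variable {S : Type*} [Fintype S] [DecidableEq S] {G : SimpleGraph S} (cil : Ciliation G)
  {𝒢 : S → Type*}
  [∀ x, Ring (𝒢 x)] [∀ x, HopfAlgebra ℂ (𝒢 x)] [∀ x, StarRing (𝒢 x)]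
  [∀ x, StarModule ℂ (𝒢 x)] [∀ x, RibbonHopfStarAlgebra (𝒢 x)]
  {H : Type*} [Ring H] [HopfAlgebra ℂ H] [StarRing H] [StarModule ℂ H] [RibbonHopfStarAlgebra H]
  {ι : Type*} [Fintype ι] (tw : ∀ x, TwistEquiv (𝒢 x) H) (D : RepData H ι)

/-- The embedding of the gauge algebra as a homomorphism. -/
def gaugeHom : GaugeAlg 𝒢 →ₐ[ℂ] LatticeAlg cil tw D :=
  AlgHom.ofLinearMap
    { toFun := gauge cil tw D
      map_add' := fun ξ ξ' => by
        rw [gauge, RingQuot.mkAlgHom_rel ℂ (Rel.gauge_add ξ ξ'), map_add]; rfl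
      map_smul' := fun c ξ => by
        rw [gauge, RingQuot.mkAlgHom_rel ℂ (Rel.gauge_smul c ξ), map_smul]; rfl }
    (by
      change gauge cil tw D 1 = 1
      rw [gauge, RingQuot.mkAlgHom_rel ℂ Rel.gauge_one, map_one])
    (fun ξ ξ' => by
      change gauge cil tw D (ξ * ξ') = gauge cil tw D ξ * gauge cil tw D ξ'
      rw [gauge, RingQuot.mkAlgHom_rel ℂ (Rel.gauge_mul ξ ξ'), map_mul]; rfl)

/-- The embedding of the gauge algebra at the site `x`. -/
def gaugeAt (x : S) : 𝒢 x →ₐ[ℂ] LatticeAlg cil tw D :=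
  (gaugeHom cil tw D).comp (PiTensorProduct.singleAlgHom x)

theorem gaugeAt_apply (x : S) (ξ : 𝒢 x) :
    gaugeAt cil tw D x ξ = gauge cil tw D (PiTensorProduct.singleAlgHom x ξ) := rfl

theorem gaugeAt_commute {x y : S} (h : x ≠ y) (a : 𝒢 x) (b : 𝒢 y) :
    Commute (gaugeAt cil tw D x a) (gaugeAt cil tw D y b) :=
  (single_commute h a b).map (gaugeHom cil tw D)

/-- The elements `U^I_{ab}(i)` as a matrix. -/
def connMat (I : ι) (i : G.Dart) :
    Matrix (Fin (D.dim I)) (Fin (D.dim I)) (LatticeAlg cil tw D) :=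
  Matrix.of fun a b => conn cil tw D I i (a, b)

theorem connMat_apply (I : ι) (i : G.Dart) (a b : Fin (D.dim I)) :
    connMat cil tw D I i a b = conn cil tw D I i (a, b) := rfl

/-- The matrix `(τ^I_x ⊗ id)(X)`. -/
abbrev siteMat (x : S) (I : ι) :
    𝒢 x ⊗[ℂ] 𝒢 x →ₐ[ℂ] Matrix (Fin (D.dim I)) (Fin (D.dim I)) (LatticeAlg cil tw D) :=
  lop (repAt tw D x I) (gaugeAt cil tw D x)

/-- A gauge transformation at the site `x`, as a multiple of the unit matrix. -/
abbrev siteDiag (x : S) (I : ι) :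
    𝒢 x →ₐ[ℂ] Matrix (Fin (D.dim I)) (Fin (D.dim I)) (LatticeAlg cil tw D) :=
  (diagHom _ _).comp (gaugeAt cil tw D x)

theorem lop_linkRep_singleTensor (I : ι) (i : G.Dart) (z : S) (X : 𝒢 z ⊗[ℂ] 𝒢 z) :
    lop (linkRep tw D I i) (gaugeHom cil tw D) (singleTensor z X) =
      lop (linkRepAt tw D I i z) (gaugeAt cil tw D z) X := by
  induction X with
  | zero => simp
  | add X Y hX hY => simp only [map_add, hX, hY]
  | tmul a b =>
    rw [singleTensor, Algebra.TensorProduct.map_tmul, lop_tmul, lop_tmul, linkRep, piLift_single]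
    rfl

theorem gaugeComul_single (z : S) (ξ : 𝒢 z) :
    gaugeComul 𝒢 (PiTensorProduct.singleAlgHom z ξ) = singleTensor z (comul (R := ℂ) ξ) :=
  piLift_single _ _ z ξ

theorem covariance_at (I : ι) (i : G.Dart) (z : S) (ξ : 𝒢 z) (α : D.Ix I) :
    gaugeAt cil tw D z ξ * conn cil tw D I i α =
      ∑ β, conn cil tw D I i β *
        lop (linkRepAt tw D I i z) (gaugeAt cil tw D z) (comul (R := ℂ) ξ) β α := by
  rw [gaugeAt_apply, gauge, conn, ← map_mul,
    RingQuot.mkAlgHom_rel ℂ (Rel.covariance (PiTensorProduct.singleAlgHom z ξ) I i α), map_sum]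
  refine Finset.sum_congr rfl fun β _ => ?_
  rw [map_mul, ← lop_linkRep_singleTensor, lop_apply, gaugeComul_single]
  rfl

theorem linkRepAt_target (I : ι) (i : G.Dart) {y : S} (h : i.snd = y) :
    linkRepAt tw D I i y = targetRep tw D y I := by
  simp [linkRepAt, h]

theorem linkRepAt_source (I : ι) (i : G.Dart) {x : S} (h : i.fst = x) :
    linkRepAt tw D I i x = sourceRep tw D x I := by
  subst h
  simp [linkRepAt, i.adj.ne]

theorem linkRepAt_other (I : ι) (i : G.Dart) {z : S} (h₁ : z ≠ i.fst) (h₂ : z ≠ i.snd) :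
    linkRepAt tw D I i z = counitHom (𝒢 z) _ := by
  simp [linkRepAt, h₁, h₂, counitHom]

theorem lop_targetRep (I : ι) (y : S) (X : 𝒢 y ⊗[ℂ] 𝒢 y) (β α : D.Ix I) :
    lop (targetRep tw D y I) (gaugeAt cil tw D y) X β α =
      if β.1 = α.1 then siteMat cil tw D y I X β.2 α.2 else 0 := by
  induction X with
  | zero => simp
  | add X Y hX hY =>
    simp only [map_add, Matrix.add_apply, hX, hY]
    split_ifs <;> simp
  | tmul a b =>
    rw [lop_tmul_apply, lop_tmul_apply]
    by_cases h : β.1 = α.1 <;> simp [targetRep, Matrix.kroneckerMap_apply, Matrix.one_apply, h]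

/-- `a ⊗ b ↦ τ^I_x(S(a)) U b`. -/
abbrev sourceAct (x : S) (I : ι)
    (U : Matrix (Fin (D.dim I)) (Fin (D.dim I)) (LatticeAlg cil tw D)) :
    𝒢 x ⊗[ℂ] 𝒢 x →ₗ[ℂ] Matrix (Fin (D.dim I)) (Fin (D.dim I)) (LatticeAlg cil tw D) :=
  sandwich ((((cstHom (LatticeAlg cil tw D) _).comp (repAt tw D x I) : _ →ₐ[ℂ] _) : _ →ₗ[ℂ] _) ∘ₗ
    antipode ℂ) (siteDiag cil tw D x I : _ →ₗ[ℂ] _) U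

theorem sourceAct_apply (x : S) (I : ι)
    (U : Matrix (Fin (D.dim I)) (Fin (D.dim I)) (LatticeAlg cil tw D)) (X : 𝒢 x ⊗[ℂ] 𝒢 x)
    (a b : Fin (D.dim I)) :
    sourceAct cil tw D x I U X a b =
      ∑ β : D.Ix I, U β.1 β.2 * lop (sourceRep tw D x I) (gaugeAt cil tw D x) X β (a, b) := by
  induction X with
  | zero => simp
  | add X Y hX hY =>
    simp only [map_add, Matrix.add_apply, hX, hY, mul_add, Finset.sum_add_distrib]
  | tmul p q =>
    simp only [sandwich_tmul, LinearMap.comp_apply]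
    change (cstHom (LatticeAlg cil tw D) (Fin (D.dim I)) (repAt tw D x I (antipode ℂ p)) * U *
      diagHom (LatticeAlg cil tw D) (Fin (D.dim I)) (gaugeAt cil tw D x q)) a b = _
    rw [mul_diagHom_apply, Fintype.sum_prod_type, Matrix.mul_apply, Finset.sum_mul]
    refine Finset.sum_congr rfl fun c _ => ?_
    rw [Finset.sum_eq_single b]
    · rw [lop_tmul_apply]
      simp [sourceRep, Matrix.kroneckerMap_apply, ← Algebra.smul_def]
    · intro d _ hd
      rw [lop_tmul_apply]
      simp [sourceRep, Matrix.kroneckerMap_apply, hd]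
    · simp

theorem target_covariance (I : ι) (i : G.Dart) {y : S} (h : i.snd = y) (ξ : 𝒢 y) :
    siteDiag cil tw D y I ξ * connMat cil tw D I i =
      connMat cil tw D I i * siteMat cil tw D y I (comul (R := ℂ) ξ) := by
  ext a b
  rw [AlgHom.comp_apply, diagHom_mul_apply, connMat_apply, covariance_at, linkRepAt_target tw D I i
      h,
    Fintype.sum_prod_type, Finset.sum_eq_single a, Matrix.mul_apply]
  · simp [lop_targetRep, connMat_apply]
  · intro c _ hc
    simp [lop_targetRep, hc]
  · simp

/-- The defining relation at the source uses ᵗτ(S(ξ)), which acts on U(i) from the left through S.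
`lift_comul_mul_eq` removes the antipode, so that source and target take symmetric roles. -/
theorem source_covariance (I : ι) (i : G.Dart) {x : S} (h : i.fst = x) (ξ : 𝒢 x) :
    siteMat cil tw D x I (comul (R := ℂ) ξ) * connMat cil tw D I i =
      connMat cil tw D I i * siteDiag cil tw D x I ξ := by
  refine lift_comul_mul_eq _ _ _ _ (fun ξ => ?_) ξ
  ext a b
  rw [AlgHom.comp_apply, diagHom_mul_apply, connMat_apply, covariance_at, linkRepAt_source tw D I i
      h]
  exact (sourceAct_apply cil tw D x I (connMat cil tw D I i) _ a b).symm

theorem other_covariance (I : ι) (i : G.Dart) {z : S} (h₁ : z ≠ i.fst) (h₂ : z ≠ i.snd)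
    (ξ : 𝒢 z) (α : D.Ix I) :
    Commute (gaugeAt cil tw D z ξ) (conn cil tw D I i α) := by
  have e : lop (linkRepAt tw D I i z) (gaugeAt cil tw D z) (comul (R := ℂ) ξ) =
      diagHom _ _ (gaugeAt cil tw D z ξ) := by
    rw [linkRepAt_other tw D I i h₁ h₂]
    have e' : (cstHom (LatticeAlg cil tw D) (D.Ix I)).comp (counitHom (𝒢 z) _) =
        counitHom (𝒢 z) _ := by
      ext1 a
      exact (cstHom (LatticeAlg cil tw D) (D.Ix I)).commutes _
    simp only [lop, e']
    exact lift_counitHom_left _ _ ξ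
  rw [Commute, SemiconjBy, covariance_at, e]
  simp only [diagHom, Matrix.scalarAlgHom_apply, Matrix.scalar_apply, Matrix.diagonal_apply,
    mul_ite, mul_zero]
  simp

theorem connMat_mul_connMat_symm (I : ι) (i : G.Dart) :
    connMat cil tw D I i * connMat cil tw D I i.symm = 1 := by
  ext a c
  have h := RingQuot.mkAlgHom_rel ℂ (Rel.inverse (cil := cil) (tw := tw) (D := D) I i a c)
  rw [map_sum] at h
  simp only [map_mul] at h
  rw [Matrix.mul_apply, Matrix.one_apply]
  refine h.trans ?_
  split_ifs <;> simp

theorem connMat_functoriality (I J : ι) (i : G.Dart) :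
    inLeft _ _ _ (connMat cil tw D I i) * inRight _ _ _ (connMat cil tw D J i) =
      ∑ K, ∑ a, cstMap (LatticeAlg cil tw D) (cgAt tw D i.fst I J K a).conjTranspose * connMat cil
          tw D K i *
        cstMap (LatticeAlg cil tw D) (cgAt tw D i.snd I J K a) := by
  ext ⟨a, a'⟩ ⟨b, b'⟩
  have h := RingQuot.mkAlgHom_rel ℂ
    (Rel.functoriality (cil := cil) (tw := tw) (D := D) I J i (a, b) (a', b'))
  rw [inLeft_mul_inRight_apply]
  simp only [map_mul, map_sum, map_smul] at h
  refine h.trans ?_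
  simp only [Matrix.sum_apply]
  refine Finset.sum_congr rfl fun K _ => Finset.sum_congr rfl fun e _ => ?_
  refine (Fintype.sum_prod_type_right _).trans ?_
  rw [cstMap_mul_mul_cstMap_apply]
  refine Finset.sum_congr rfl fun d _ => Finset.sum_congr rfl fun c _ => ?_
  rw [mul_comm]
  rfl

theorem connMat_braid_self (I J : ι) (i : G.Dart) :
    inLeft _ _ _ (connMat cil tw D I i) * inRight _ _ _ (connMat cil tw D J i) =
      cstHom _ _ (tensorMat (repAt tw D i.fst I) (repAt tw D i.fst J) (Rm (𝒢 i.fst))) *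
        (inRight _ _ _ (connMat cil tw D J i) * inLeft _ _ _ (connMat cil tw D I i)) *
        cstHom _ _ (tensorMat (repAt tw D i.snd I) (repAt tw D i.snd J)
          (swap _ (Ri (𝒢 i.snd)))) := by
  ext ⟨a, a'⟩ ⟨b, b'⟩
  have h := RingQuot.mkAlgHom_rel ℂ
    (Rel.braid_self (cil := cil) (tw := tw) (D := D) i I J (a, b) (a', b'))
  have hs : (((swapUnit (𝒢 i.snd) RibbonHopfStarAlgebra.R)⁻¹ : (𝒢 i.snd ⊗[ℂ] 𝒢 i.snd)ˣ) :
      𝒢 i.snd ⊗[ℂ] 𝒢 i.snd) = swap _ (Ri (𝒢 i.snd)) := rfl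
  rw [inLeft_mul_inRight_apply]
  simp only [map_mul, map_sum, map_smul, hs] at h
  refine h.trans ?_
  generalize tensorMat (repAt tw D i.fst I) (repAt tw D i.fst J) (Rm (𝒢 i.fst)) = P
  generalize tensorMat (repAt tw D i.snd I) (repAt tw D i.snd J) (swap _ (Ri (𝒢 i.snd))) = Q
  change _ = (cstMap (LatticeAlg cil tw D) P *
    (inRight _ (Fin (D.dim I)) (Fin (D.dim J)) (connMat cil tw D J i) *
      inLeft _ (Fin (D.dim I)) (Fin (D.dim J)) (connMat cil tw D I i)) *
    cstMap (LatticeAlg cil tw D) Q) (a, a') (b, b')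
  rw [cstMap_mul_mul_cstMap_apply]
  simp only [inRight_mul_inLeft_apply]
  simp only [Fintype.sum_prod_type]
  rw [Finset.sum_comm]
  refine Finset.sum_congr rfl fun d _ => ?_
  rw [Finset.sum_comm]
  refine (Finset.sum_congr rfl fun c _ => Finset.sum_comm).trans ?_
  rw [Finset.sum_comm]
  exact Finset.sum_congr rfl fun e _ => Finset.sum_comm

theorem connMat_braid (i j : G.Dart) (h : cil.Before i j ∨ NoCommonEnd i j) (I J : ι)
    (α : D.Ix I) (β : D.Ix J) :
    conn cil tw D I i α * conn cil tw D J j β =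
      ∑ δ : D.Ix I, ∑ γ : D.Ix J,
        tensorMat (linkRep tw D I i) (linkRep tw D J j)
          (gaugeR 𝒢 : GaugeAlg 𝒢 ⊗[ℂ] GaugeAlg 𝒢) (δ, γ) (α, β) •
        (conn cil tw D J j γ * conn cil tw D I i δ) := by
  have h := RingQuot.mkAlgHom_rel ℂ (Rel.braid (cil := cil) (tw := tw) (D := D) i j h I J α β)
  simp only [map_mul, map_sum, map_smul] at h
  exact h

end LatticeRelations

/-! ### Evaluation of the `R`-matrix of the gauge algebra -/

/-- An element of a finite product is the product of its commuting one-site components. The R-matrix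
of the gauge algebra can therefore be evaluated site by site. -/
theorem pi_monoidHom_congr {S M : Type*} [Fintype S] [DecidableEq S] {N : S → Type*}
    [∀ z, Monoid (N z)] [Monoid M] (φ : (∀ z, N z) →* M) {m m' : ∀ z, N z}
    (h : ∀ z, φ (Pi.mulSingle z (m z)) = φ (Pi.mulSingle z (m' z))) : φ m = φ m' := by
  have comm : ∀ m : ∀ z, N z, ((Finset.univ : Finset S) : Set S).Pairwise
      (Function.onFun Commute fun z => φ (Pi.mulSingle z (m z))) := fun m i _ j _ _ =>
    (Pi.mulSingle_apply_commute m i j).map φ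
  have key : ∀ m, φ m = Finset.univ.noncommProd (fun z => φ (Pi.mulSingle z (m z))) (comm m) :=
    fun m => (congrArg φ (Finset.noncommProd_mulSingle m)).symm.trans
      (Finset.univ.map_noncommProd (fun z => Pi.mulSingle z (m z))
        (fun i _ j _ _ => Pi.mulSingle_apply_commute m i j) φ)
  rw [key m, key m']
  exact Finset.noncommProd_congr rfl (fun z _ => h z) _

section CounitEval

variable {A M : Type*} [Ring A] [HopfAlgebra ℂ A] [StarRing A] [StarModule ℂ A]
  [RibbonHopfStarAlgebra A] [Ring M] [Algebra ℂ M]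

/-- A homomorphism that is the co-unit on the first leg has the form ε ⊗ g, so (ε ⊗ id)R = 1
applies. Sites at which a link acts trivially thus drop out of R. -/
theorem algHom_Rm_eq_one_left (Ψ : A ⊗[ℂ] A →ₐ[ℂ] M)
    (h : ∀ a : A, Ψ (a ⊗ₜ 1) = algebraMap ℂ M (counit (R := ℂ) a)) : Ψ (Rm A) = 1 := by
  rw [← lift_counitHom_Rm_left (Ψ.comp Algebra.TensorProduct.includeRight)
    fun a b => counitHom_commute a _]
  congr 1
  ext a
  · simp [h, counitHom_apply]
  · simp

theorem algHom_Rm_eq_one_right (Ψ : A ⊗[ℂ] A →ₐ[ℂ] M)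
    (h : ∀ a : A, Ψ (1 ⊗ₜ a) = algebraMap ℂ M (counit (R := ℂ) a)) : Ψ (Rm A) = 1 := by
  rw [← lift_counitHom_Rm_right (Ψ.comp Algebra.TensorProduct.includeLeft)
    fun a b => (counitHom_commute b _).symm]
  congr 1
  ext a
  · simp
  · simp [h, counitHom_apply]

end CounitEval

section Braid

variable {S : Type*} [Fintype S] [DecidableEq S] {G : SimpleGraph S} (cil : Ciliation G)
  {𝒢 : S → Type*}
  [∀ x, Ring (𝒢 x)] [∀ x, HopfAlgebra ℂ (𝒢 x)] [∀ x, StarRing (𝒢 x)]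
  [∀ x, StarModule ℂ (𝒢 x)] [∀ x, RibbonHopfStarAlgebra (𝒢 x)]
  {H : Type*} [Ring H] [HopfAlgebra ℂ H] [StarRing H] [StarModule ℂ H] [RibbonHopfStarAlgebra H]
  {ι : Type*} [Fintype ι] (tw : ∀ x, TwistEquiv (𝒢 x) H) (D : RepData H ι)

variable {M : Type*} [Ring M] [Algebra ℂ M]

/-- Evaluation of a homomorphism on `⊗_z X_z`, as a homomorphism of monoids. -/
def shuffleEval (Ψ : GaugeAlg 𝒢 ⊗[ℂ] GaugeAlg 𝒢 →ₐ[ℂ] M) : (∀ z, 𝒢 z ⊗[ℂ] 𝒢 z) →* M :=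
  ((Ψ.comp (shuffle 𝒢) : _ →* M)).comp (PiTensorProduct.tprodMonoidHom ℂ)

theorem shuffleEval_mulSingle (Ψ : GaugeAlg 𝒢 ⊗[ℂ] GaugeAlg 𝒢 →ₐ[ℂ] M) (z : S)
    (X : 𝒢 z ⊗[ℂ] 𝒢 z) : shuffleEval Ψ (Pi.mulSingle z X) = Ψ (singleTensor z X) :=
  congrArg Ψ (piLift_single (fun x => singleTensor (A := 𝒢) x)
    (fun _ _ h X Y => singleTensor_commute h X Y) z X)

theorem apply_gaugeR (Ψ : GaugeAlg 𝒢 ⊗[ℂ] GaugeAlg 𝒢 →ₐ[ℂ] M) :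
    Ψ (gaugeR 𝒢 : GaugeAlg 𝒢 ⊗[ℂ] GaugeAlg 𝒢) = shuffleEval Ψ fun z => Rm (𝒢 z) := rfl

theorem apply_gaugeR_inv (Ψ : GaugeAlg 𝒢 ⊗[ℂ] GaugeAlg 𝒢 →ₐ[ℂ] M) :
    Ψ (((gaugeR 𝒢)⁻¹ : (GaugeAlg 𝒢 ⊗[ℂ] GaugeAlg 𝒢)ˣ) : GaugeAlg 𝒢 ⊗[ℂ] GaugeAlg 𝒢) =
      shuffleEval Ψ fun z => Ri (𝒢 z) := rfl

theorem shuffleEval_eq_one (Ψ : GaugeAlg 𝒢 ⊗[ℂ] GaugeAlg 𝒢 →ₐ[ℂ] M) (m : ∀ z, 𝒢 z ⊗[ℂ] 𝒢 z)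
    (h : ∀ z, Ψ (singleTensor z (m z)) = 1) : shuffleEval Ψ m = 1 := by
  rw [← map_one (shuffleEval Ψ)]
  refine pi_monoidHom_congr _ fun z => ?_
  rw [shuffleEval_mulSingle, h, Pi.one_apply, Pi.mulSingle_one, map_one]

theorem shuffleEval_eq_single (Ψ : GaugeAlg 𝒢 ⊗[ℂ] GaugeAlg 𝒢 →ₐ[ℂ] M)
    (m : ∀ z, 𝒢 z ⊗[ℂ] 𝒢 z) (y : S) (h : ∀ z, z ≠ y → Ψ (singleTensor z (m z)) = 1) :
    shuffleEval Ψ m = Ψ (singleTensor y (m y)) := by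
  rw [← shuffleEval_mulSingle]
  refine pi_monoidHom_congr _ fun z => ?_
  by_cases hz : z = y
  · subst hz; simp
  · rw [shuffleEval_mulSingle, h z hz, Pi.mulSingle_eq_of_ne hz, Pi.mulSingle_one, map_one]

theorem shuffleEval_eq_pair (Ψ : GaugeAlg 𝒢 ⊗[ℂ] GaugeAlg 𝒢 →ₐ[ℂ] M)
    (m : ∀ z, 𝒢 z ⊗[ℂ] 𝒢 z) {x y : S} (hxy : x ≠ y)
    (h : ∀ z, z ≠ x → z ≠ y → Ψ (singleTensor z (m z)) = 1) :
    shuffleEval Ψ m = Ψ (singleTensor x (m x)) * Ψ (singleTensor y (m y)) := by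
  rw [← shuffleEval_mulSingle, ← shuffleEval_mulSingle, ← map_mul]
  refine pi_monoidHom_congr _ fun z => ?_
  by_cases hx : z = x
  · subst hx; simp [hxy]
  by_cases hy : z = y
  · subst hy; simp [hxy.symm]
  rw [shuffleEval_mulSingle, h z hx hy, Pi.mul_apply, Pi.mulSingle_eq_of_ne hx,
    Pi.mulSingle_eq_of_ne hy, one_mul, Pi.mulSingle_one, map_one]

theorem tensorMat_linkRep_singleTensor (I J : ι) (i j : G.Dart) (z : S) (X : 𝒢 z ⊗[ℂ] 𝒢 z) :
    tensorMat (linkRep tw D I i) (linkRep tw D J j) (singleTensor z X) =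
      tensorMat (linkRepAt tw D I i z) (linkRepAt tw D J j z) X := by
  induction X with
  | zero => simp
  | add X Y hX hY => simp only [map_add, hX, hY]
  | tmul a b =>
    simp only [singleTensor, Algebra.TensorProduct.map_tmul, tensorMat, AlgHom.comp_apply, linkRep,
      piLift_single]

theorem tensorMat_counitHom_left {z : S} {n m : Type*} [Fintype m] [DecidableEq m] [Fintype n]
    [DecidableEq n] (σ : 𝒢 z →ₐ[ℂ] Matrix n n ℂ) :
    tensorMat (counitHom (𝒢 z) (Matrix m m ℂ)) σ (Rm (𝒢 z)) = 1 := by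
  refine algHom_Rm_eq_one_left _ fun a => ?_
  ext p q
  by_cases h₁ : p.1 = q.1 <;> by_cases h₂ : p.2 = q.2 <;>
    simp [tensorMat, counitHom_apply, Matrix.kroneckerMap_apply, Matrix.algebraMap_matrix_apply,
      Matrix.one_apply, Prod.ext_iff, h₁, h₂]

theorem tensorMat_counitHom_right {z : S} {n m : Type*} [Fintype m] [DecidableEq m] [Fintype n]
    [DecidableEq n] (σ : 𝒢 z →ₐ[ℂ] Matrix n n ℂ) :
    tensorMat σ (counitHom (𝒢 z) (Matrix m m ℂ)) (Rm (𝒢 z)) = 1 := by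
  refine algHom_Rm_eq_one_right _ fun a => ?_
  ext p q
  by_cases h₁ : p.1 = q.1 <;> by_cases h₂ : p.2 = q.2 <;>
    simp [tensorMat, counitHom_apply, Matrix.kroneckerMap_apply, Matrix.algebraMap_matrix_apply,
      Matrix.one_apply, Prod.ext_iff, h₁, h₂]

/-- At every site at least one of the two links acts through the co-unit, so every local factor is
1. -/
theorem tensorMat_linkRep_gaugeR_of_noCommonEnd (I J : ι) {i j : G.Dart} (h : NoCommonEnd i j) :
    tensorMat (linkRep tw D I i) (linkRep tw D J j)
      (gaugeR 𝒢 : GaugeAlg 𝒢 ⊗[ℂ] GaugeAlg 𝒢) = 1 := by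
  rw [apply_gaugeR]
  refine shuffleEval_eq_one _ _ fun z => ?_
  rw [tensorMat_linkRep_singleTensor]
  by_cases hz : z = i.fst ∨ z = i.snd
  · rw [linkRepAt_other tw D J j, tensorMat_counitHom_right]
    · rcases hz with rfl | rfl
      · exact h.1
      · exact h.2.2.1
    · rcases hz with rfl | rfl
      · exact h.2.1
      · exact h.2.2.2
  · rw [not_or] at hz
    rw [linkRepAt_other tw D I i hz.1 hz.2, tensorMat_counitHom_left]

/-- The common target is the only site at which both links act non-trivially: the sources differ,
and neither of them is y because a simple graph has no loops. -/
theorem tensorMat_linkRep_gaugeR_of_target (I J : ι) {i j : G.Dart} {y : S} (hi : i.snd = y)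
    (hj : j.snd = y) (hij : i.fst ≠ j.fst) :
    tensorMat (linkRep tw D I i) (linkRep tw D J j)
      (gaugeR 𝒢 : GaugeAlg 𝒢 ⊗[ℂ] GaugeAlg 𝒢) =
      tensorMat (targetRep tw D y I) (targetRep tw D y J) (Rm (𝒢 y)) := by
  rw [apply_gaugeR, shuffleEval_eq_single _ _ y, tensorMat_linkRep_singleTensor,
    linkRepAt_target tw D I i hi, linkRepAt_target tw D J j hj]
  intro z hz
  rw [tensorMat_linkRep_singleTensor]
  by_cases hz' : z = i.fst
  · rw [linkRepAt_other tw D J j (hz' ▸ hij) (hj ▸ hz), tensorMat_counitHom_right]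
  · rw [linkRepAt_other tw D I i hz' (hi ▸ hz), tensorMat_counitHom_left]

theorem tensorMat_targetRep (I J : ι) (y : S) (X : 𝒢 y ⊗[ℂ] 𝒢 y) (δ α : D.Ix I) (γ β : D.Ix J) :
    tensorMat (targetRep tw D y I) (targetRep tw D y J) X (δ, γ) (α, β) =
      if δ.1 = α.1 then if γ.1 = β.1 then
        tensorMat (repAt tw D y I) (repAt tw D y J) X (δ.2, γ.2) (α.2, β.2) else 0 else 0 := by
  induction X with
  | zero => simp
  | add X Y hX hY =>
    simp only [map_add, Matrix.add_apply, hX, hY]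
    split_ifs <;> simp
  | tmul a b =>
    by_cases h : δ.1 = α.1 <;> by_cases h' : γ.1 = β.1 <;>
      simp [tensorMat, targetRep, Matrix.kroneckerMap_apply, Matrix.one_apply, h, h']

theorem conn_commute_of_noCommonEnd (I J : ι) {i j : G.Dart} (h : NoCommonEnd i j) (α : D.Ix I)
    (β : D.Ix J) : Commute (conn cil tw D I i α) (conn cil tw D J j β) := by
  rw [Commute, SemiconjBy, connMat_braid cil tw D i j (Or.inr h) I J,
    tensorMat_linkRep_gaugeR_of_noCommonEnd tw D I J h]
  simp only [Matrix.one_apply, Prod.mk.injEq, ite_and, ite_smul, one_smul, zero_smul]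
  simp

/-- A simple graph has no multiple edges, so distinct links into one vertex start at distinct
vertices. -/
theorem before_fst_ne {cil : Ciliation G} {i j : G.Dart} (h : cil.Before i j) :
    i.snd = j.snd ∧ i.fst ≠ j.fst := by
  obtain ⟨x, hi, hj, hlt⟩ := h
  refine ⟨hi.trans hj.symm, fun hf => ?_⟩
  have e : i = j := SimpleGraph.Dart.ext _ _ (Prod.ext hf (hi.trans hj.symm))
  subst e
  exact @lt_irrefl _ (cil x).toPreorder _ hlt

theorem connMat_braid_target (I J : ι) {i j : G.Dart} (h : cil.Before i j) {y : S}
    (hi : i.snd = y) (hj : j.snd = y) :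
    inLeft _ _ _ (connMat cil tw D I i) * inRight _ _ _ (connMat cil tw D J j) =
      inRight _ _ _ (connMat cil tw D J j) * inLeft _ _ _ (connMat cil tw D I i) *
        cstHom _ _ (tensorMat (repAt tw D y I) (repAt tw D y J) (Rm (𝒢 y))) := by
  ext ⟨a, a'⟩ ⟨b, b'⟩
  rw [inLeft_mul_inRight_apply, connMat_apply, connMat_apply, connMat_braid cil tw D i j (Or.inl h),
    tensorMat_linkRep_gaugeR_of_target tw D I J hi hj (before_fst_ne h).2, Matrix.mul_apply]
  simp only [inRight_mul_inLeft_apply, tensorMat_targetRep, connMat_apply, cstHom_apply, ite_smul,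
    zero_smul, Fintype.sum_prod_type]
  rw [Finset.sum_eq_single a]
  · refine Finset.sum_congr rfl fun c _ => ?_
    rw [Finset.sum_eq_single a']
    · refine Finset.sum_congr rfl fun d _ => ?_
      simp [Algebra.smul_def, Algebra.commutes]
    · intro d _ hd
      simp [hd]
    · simp
  · intro c _ hc
    simp [hc]
  · simp

end Braid

/-! ### Exchange of the tensor factors of matrices -/

section Exchange

variable {A A' B : Type*} [Ring A] [Algebra ℂ A] [Ring A'] [Algebra ℂ A'] [Ring B] [Algebra ℂ B]
variable {m n : Type*} [Fintype m] [DecidableEq m] [Fintype n] [DecidableEq n]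

variable (B m n) in
/-- The exchange of the tensor factors. -/
def exchange : Matrix (m × n) (m × n) B ≃ₐ[ℂ] Matrix (n × m) (n × m) B :=
  Matrix.reindexAlgEquiv ℂ B (Equiv.prodComm m n)

theorem exchange_apply (X : Matrix (m × n) (m × n) B) (p q : n × m) :
    exchange B m n X p q = X p.swap q.swap := rfl

theorem exchange_inLeft (X : Matrix m m B) :
    exchange B m n (inLeft B m n X) = inRight B n m X := rfl

theorem exchange_inRight (X : Matrix n n B) :
    exchange B m n (inRight B m n X) = inLeft B n m X := rfl

theorem exchange_tensorMat {A : Type*} [Ring A] [HopfAlgebra ℂ A] (ρ : A →ₐ[ℂ] Matrix m m ℂ)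
    (σ : A →ₐ[ℂ] Matrix n n ℂ) (X : A ⊗[ℂ] A) :
    exchange B m n (cstHom B (m × n) (tensorMat ρ σ X)) =
      cstHom B (n × m) (tensorMat σ ρ (swap A X)) := by
  induction X with
  | zero => simp
  | add X Y hX hY => simp only [map_add, hX, hY]
  | tmul a b =>
    ext p q
    simp [exchange_apply, tensorMat, Matrix.kroneckerMap_apply, mul_comm]

theorem inLeft_lop_commute_inRight (ρ : A →ₐ[ℂ] Matrix m m ℂ) (g : A' →ₐ[ℂ] B)
    (X : A ⊗[ℂ] A') {V : Matrix n n B} (h : ∀ a b c, Commute (g a) (V b c)) :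
    Commute (inLeft B m n (lop ρ g X)) (inRight B m n V) :=
  inLeft_commute_inRight fun a b c d => by rw [lop_apply]; exact h _ _ _

theorem inRight_lop_commute_inLeft (σ : A →ₐ[ℂ] Matrix n n ℂ) (g : A' →ₐ[ℂ] B)
    (X : A ⊗[ℂ] A') {V : Matrix m m B} (h : ∀ a b c, Commute (g a) (V b c)) :
    Commute (inRight B m n (lop σ g X)) (inLeft B m n V) :=
  (inLeft_commute_inRight fun a b c d => by rw [lop_apply]; exact (h _ _ _).symm).symm

/-- The common pattern of all products of two conjugate link matrices a v c, with a and c the gauge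
factors at the two ends: like factors are collected at the cost of r, from moving v₂ past a₁, and s,
from moving c₂ past v₁. -/
theorem mul_exchange {M : Type*} [Monoid M] {a₁ a₂ v₁ v₂ c₁ c₂ r s : M} (h₁ : c₂ * a₁ = a₁ * c₂)
    (h₂ : v₂ * a₁ = a₁ * r * v₂) (h₃ : c₂ * v₁ = v₁ * s * c₂) :
    a₂ * v₂ * c₂ * (a₁ * v₁ * c₁) = a₂ * a₁ * r * (v₂ * v₁) * s * (c₂ * c₁) := by
  calc _ = a₂ * (v₂ * (c₂ * a₁)) * v₁ * c₁ := by simp only [mul_assoc]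
    _ = a₂ * (v₂ * a₁) * (c₂ * v₁) * c₁ := by rw [h₁]; simp only [mul_assoc]
    _ = _ := by rw [h₂, h₃]; simp only [mul_assoc]

end Exchange

/-! ### The conjugate link matrices and their products along one link -/

section ConnStar

variable {S : Type*} [Fintype S] [DecidableEq S] {G : SimpleGraph S} (cil : Ciliation G)
  {𝒢 : S → Type*}
  [∀ x, Ring (𝒢 x)] [∀ x, HopfAlgebra ℂ (𝒢 x)] [∀ x, StarRing (𝒢 x)]
  [∀ x, StarModule ℂ (𝒢 x)] [∀ x, RibbonHopfStarAlgebra (𝒢 x)]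
  {H : Type*} [Ring H] [HopfAlgebra ℂ H] [StarRing H] [StarModule ℂ H] [RibbonHopfStarAlgebra H]
  {ι : Type*} [Fintype ι] (tw : ∀ x, TwistEquiv (𝒢 x) H) (D : RepData H ι)

/-- The matrix `(τ_y ⊗ id)(R_y) U^I(-i) (τ_x ⊗ id)(R_x⁻¹)`, for a link `i` from `x` to `y`. -/
def connStar (I : ι) (i : G.Dart) :
    Matrix (Fin (D.dim I)) (Fin (D.dim I)) (LatticeAlg cil tw D) :=
  siteMat cil tw D i.snd I (Rm (𝒢 i.snd)) * connMat cil tw D I i.symm *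
    siteMat cil tw D i.fst I (Ri (𝒢 i.fst))

theorem connStar_symm_mul_connStar (I : ι) (i : G.Dart) :
    connStar cil tw D I i.symm * connStar cil tw D I i = 1 := by
  have e : connStar cil tw D I i.symm =
      siteMat cil tw D i.fst I (Rm (𝒢 i.fst)) * connMat cil tw D I i *
        siteMat cil tw D i.snd I (Ri (𝒢 i.snd)) := by
    have := SimpleGraph.Dart.symm_symm i
    unfold connStar
    rw [this]
    rfl
  calc _ = siteMat cil tw D i.fst I (Rm (𝒢 i.fst)) * (connMat cil tw D I i *
        ((siteMat cil tw D i.snd I (Ri (𝒢 i.snd)) * siteMat cil tw D i.snd I (Rm (𝒢 i.snd))) *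
          connMat cil tw D I i.symm)) * siteMat cil tw D i.fst I (Ri (𝒢 i.fst)) := by
        rw [e, connStar]; simp only [mul_assoc]
    _ = 1 := by
        rw [lop_Ri_mul_lop_Rm, one_mul, connMat_mul_connMat_symm, mul_one, lop_Rm_mul_lop_Ri]

theorem connMat_symm_mul_connMat (I : ι) (i : G.Dart) :
    connMat cil tw D I i.symm * connMat cil tw D I i = 1 := by
  have h := connMat_mul_connMat_symm cil tw D I i.symm
  rwa [SimpleGraph.Dart.symm_symm] at h

theorem gaugeAt_commute_siteMat {x y : S} (h : x ≠ y) (J : ι) (a : 𝒢 x) (X : 𝒢 y ⊗[ℂ] 𝒢 y)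
    (b c : Fin (D.dim J)) : Commute (gaugeAt cil tw D x a) (siteMat cil tw D y J X b c) := by
  rw [siteMat, lop_apply]
  exact gaugeAt_commute cil tw D h _ _

/-- The link -i starts at y and ends at x. Passing U(-i) across 𝐑_y uses source covariance and
yields R_y; passing 𝐑_x⁻¹ across U(-i) uses target covariance and yields (R_x')⁻¹. Factors at
different ends commute. -/
theorem connStar_mul_connStar_self (I J : ι) (i : G.Dart) :
    inRight _ _ _ (connStar cil tw D J i) * inLeft _ _ _ (connStar cil tw D I i) =
      inRight _ _ _ (siteMat cil tw D i.snd J (Rm _)) *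
        inLeft _ _ _ (siteMat cil tw D i.snd I (Rm _)) *
        cstHom _ _ (tensorMat (repAt tw D i.snd I) (repAt tw D i.snd J) (Rm _)) *
        (inRight _ _ _ (connMat cil tw D J i.symm) * inLeft _ _ _ (connMat cil tw D I i.symm)) *
        cstHom _ _ (tensorMat (repAt tw D i.fst I) (repAt tw D i.fst J) (swap _ (Ri _))) *
        (inRight _ _ _ (siteMat cil tw D i.fst J (Ri _)) *
          inLeft _ _ _ (siteMat cil tw D i.fst I (Ri _))) := by
  simp only [connStar, map_mul]
  refine mul_exchange ?_ ?_ ?_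
  · exact inRight_lop_commute_inLeft _ _ _ fun a b c =>
      gaugeAt_commute_siteMat cil tw D i.adj.ne I a _ b c
  · exact inRight_mul_inLeft_lop _ _ _ fun a => (source_covariance cil tw D J i.symm rfl a).symm
  · exact inRight_lop_Ri_mul_inLeft fun a => target_covariance cil tw D I i.symm rfl a

/-- The two numerical R-matrices are precisely those of the self-braid relation of -i, which absorbs
them and reverses the order of the link matrices. -/
theorem connStar_mul_connStar_self_eq (I J : ι) (i : G.Dart) :
    inRight _ _ _ (connStar cil tw D J i) * inLeft _ _ _ (connStar cil tw D I i) =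
      inRight _ _ _ (siteMat cil tw D i.snd J (Rm _)) *
        inLeft _ _ _ (siteMat cil tw D i.snd I (Rm _)) *
        (inLeft _ _ _ (connMat cil tw D I i.symm) * inRight _ _ _ (connMat cil tw D J i.symm)) *
        (inRight _ _ _ (siteMat cil tw D i.fst J (Ri _)) *
          inLeft _ _ _ (siteMat cil tw D i.fst I (Ri _))) := by
  rw [connStar_mul_connStar_self, connMat_braid_self cil tw D I J i.symm]
  simp only [mul_assoc]
  rfl

theorem connStar_mul_connStar_self_eq' (I J : ι) (i : G.Dart) :
    inLeft _ _ _ (connStar cil tw D I i) * inRight _ _ _ (connStar cil tw D J i) =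
      inLeft _ _ _ (siteMat cil tw D i.snd I (Rm _)) *
        inRight _ _ _ (siteMat cil tw D i.snd J (Rm _)) *
        (inRight _ _ _ (connMat cil tw D J i.symm) * inLeft _ _ _ (connMat cil tw D I i.symm)) *
        (inLeft _ _ _ (siteMat cil tw D i.fst I (Ri _)) *
          inRight _ _ _ (siteMat cil tw D i.fst J (Ri _))) := by
  have h := congrArg (exchange _ _ _) (connStar_mul_connStar_self_eq cil tw D J I i)
  simp only [map_mul, exchange_inLeft, exchange_inRight] at h
  exact h

theorem siteMat_yang_baxter (y : S) (I J : ι) :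
    cstHom _ _ (tensorMat (repAt tw D y I) (repAt tw D y J) (Rm _)) *
        (inLeft _ _ _ (siteMat cil tw D y I (Rm _)) * inRight _ _ _ (siteMat cil tw D y J (Rm _))) =
      inRight _ _ _ (siteMat cil tw D y J (Rm _)) * inLeft _ _ _ (siteMat cil tw D y I (Rm _)) *
        cstHom _ _ (tensorMat (repAt tw D y I) (repAt tw D y J) (Rm _)) :=
  lop_yang_baxter _ _ _

theorem siteMat_yang_baxter_swap (y : S) (I J : ι) :
    inLeft _ _ _ (siteMat cil tw D y I (Rm _)) * inRight _ _ _ (siteMat cil tw D y J (Rm _)) *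
        cstHom _ _ (tensorMat (repAt tw D y I) (repAt tw D y J) (swap _ (Rm _))) =
      cstHom _ _ (tensorMat (repAt tw D y I) (repAt tw D y J) (swap _ (Rm _))) *
        (inRight _ _ _ (siteMat cil tw D y J (Rm _)) *
          inLeft _ _ _ (siteMat cil tw D y I (Rm _))) := by
  have h := congrArg (exchange _ _ _) (siteMat_yang_baxter cil tw D y J I)
  simp only [map_mul, exchange_inLeft, exchange_inRight, exchange_tensorMat] at h
  exact h.symm

end ConnStar

/-! ### Braid relations and functoriality of the conjugate link matrices -/

theorem inv_braid {M : Type*} [Monoid M] {a a' b b' r r' : M} (ha : a * a' = 1) (ha' : a' * a = 1)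
    (hb : b * b' = 1) (hb' : b' * b = 1) (hr : r * r' = 1) (hr' : r' * r = 1)
    (h : a * b * r = r * (b * a)) : a' * b' * r' = r' * (b' * a') := by
  let A : Mˣ := ⟨a, a', ha, ha'⟩
  let B : Mˣ := ⟨b, b', hb, hb'⟩
  let R : Mˣ := ⟨r, r', hr, hr'⟩
  have e : A * B * R = R * (B * A) := Units.ext h
  have e' := congrArg Units.val (congrArg (·⁻¹) e)
  simp only [mul_inv_rev] at e'
  exact e'.symm

theorem mul_eq_of_braid {M : Type*} [Monoid M] {u₁ u₂ v₁ v₂ r : M} (e₁ : u₁ * v₁ = 1)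
    (e₁' : v₁ * u₁ = 1) (e₂ : u₂ * v₂ = 1) (e₂' : v₂ * u₂ = 1) (hb : u₁ * u₂ = u₂ * u₁ * r) :
    v₁ * v₂ = r * (v₂ * v₁) := by
  calc v₁ * v₂ = v₁ * v₂ * (u₁ * (u₂ * v₂) * v₁) := by rw [e₂, mul_one, e₁, mul_one]
    _ = v₁ * v₂ * (u₁ * u₂) * v₂ * v₁ := by simp only [mul_assoc]
    _ = v₁ * (v₂ * u₂) * u₁ * r * v₂ * v₁ := by rw [hb]; simp only [mul_assoc]
    _ = r * (v₂ * v₁) := by rw [e₂', mul_one, e₁', one_mul, mul_assoc]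

section ConnStarRelations

variable {S : Type*} [Fintype S] [DecidableEq S] {G : SimpleGraph S} (cil : Ciliation G)
  {𝒢 : S → Type*}
  [∀ x, Ring (𝒢 x)] [∀ x, HopfAlgebra ℂ (𝒢 x)] [∀ x, StarRing (𝒢 x)]
  [∀ x, StarModule ℂ (𝒢 x)] [∀ x, RibbonHopfStarAlgebra (𝒢 x)]
  {H : Type*} [Ring H] [HopfAlgebra ℂ H] [StarRing H] [StarModule ℂ H] [RibbonHopfStarAlgebra H]
  {ι : Type*} [Fintype ι] (tw : ∀ x, TwistEquiv (𝒢 x) H) (D : RepData H ι)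

theorem siteMat_Rm_mul_Ri (x : S) (I : ι) :
    siteMat cil tw D x I (Rm _) * siteMat cil tw D x I (Ri _) = 1 := lop_Rm_mul_lop_Ri _ _

theorem siteMat_Ri_mul_Rm (x : S) (I : ι) :
    siteMat cil tw D x I (Ri _) * siteMat cil tw D x I (Rm _) = 1 := lop_Ri_mul_lop_Rm _ _

theorem siteMat_yang_baxter_inv (x : S) (I J : ι) :
    inLeft _ _ _ (siteMat cil tw D x I (Ri _)) * inRight _ _ _ (siteMat cil tw D x J (Ri _)) *
        cstHom _ _ (tensorMat (repAt tw D x I) (repAt tw D x J) (swap _ (Ri _))) =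
      cstHom _ _ (tensorMat (repAt tw D x I) (repAt tw D x J) (swap _ (Ri _))) *
        (inRight _ _ _ (siteMat cil tw D x J (Ri _)) *
          inLeft _ _ _ (siteMat cil tw D x I (Ri _))) := by
  refine inv_braid ?_ ?_ ?_ ?_ ?_ ?_ (siteMat_yang_baxter_swap cil tw D x I J)
  · exact map_mul_eq_one _ (siteMat_Rm_mul_Ri cil tw D x I)
  · exact map_mul_eq_one _ (siteMat_Ri_mul_Rm cil tw D x I)
  · exact map_mul_eq_one _ (siteMat_Rm_mul_Ri cil tw D x J)
  · exact map_mul_eq_one _ (siteMat_Ri_mul_Rm cil tw D x J)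
  · exact map_mul_eq_one _ (map_mul_eq_one _ (map_mul_eq_one _ Rm_mul_Ri))
  · exact map_mul_eq_one _ (map_mul_eq_one _ (map_mul_eq_one _ Ri_mul_Rm))

/-- Both products contain the same product of link matrices, and differ in the order of the two
factors 𝐑_y and of the two factors 𝐑_x⁻¹. The Yang-Baxter equation at y and its inverse form at x
exchange these orders. -/
theorem connStar_braid_self (I J : ι) (i : G.Dart) :
    inRight _ _ _ (connStar cil tw D J i) * inLeft _ _ _ (connStar cil tw D I i) =
      cstHom _ _ (tensorMat (repAt tw D i.snd I) (repAt tw D i.snd J) (Rm _)) *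
        (inLeft _ _ _ (connStar cil tw D I i) * inRight _ _ _ (connStar cil tw D J i)) *
        cstHom _ _ (tensorMat (repAt tw D i.fst I) (repAt tw D i.fst J) (swap _ (Ri _))) := by
  rw [connStar_mul_connStar_self, connStar_mul_connStar_self_eq',
    ← siteMat_yang_baxter cil tw D i.snd I J]
  simp only [mul_assoc]
  rw [← siteMat_yang_baxter_inv cil tw D i.fst I J]
  simp only [mul_assoc]

theorem connStar_eq (I : ι) (i : G.Dart) {y : S} (h : i.snd = y) :
    connStar cil tw D I i = siteMat cil tw D y I (Rm (𝒢 y)) * connMat cil tw D I i.symm *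
      siteMat cil tw D i.fst I (Ri (𝒢 i.fst)) := by
  subst h; rfl

theorem inRight_connMat_mul_inLeft_siteMat (I J : ι) (j : G.Dart) {y : S} (h : j.fst = y) :
    inRight _ _ _ (connMat cil tw D J j) * inLeft _ _ _ (siteMat cil tw D y I (Rm _)) =
      inLeft _ _ _ (siteMat cil tw D y I (Rm _)) *
        cstHom _ _ (tensorMat (repAt tw D y I) (repAt tw D y J) (Rm _)) *
        inRight _ _ _ (connMat cil tw D J j) :=
  inRight_mul_inLeft_lop _ _ _ fun a => (source_covariance cil tw D J j h a).symm

theorem inLeft_connMat_mul_inRight_siteMat (I J : ι) (j : G.Dart) {y : S} (h : j.fst = y) :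
    inLeft _ _ _ (connMat cil tw D I j) * inRight _ _ _ (siteMat cil tw D y J (Rm _)) =
      inRight _ _ _ (siteMat cil tw D y J (Rm _)) *
        cstHom _ _ (tensorMat (repAt tw D y I) (repAt tw D y J) (swap _ (Rm _))) *
        inLeft _ _ _ (connMat cil tw D I j) := by
  have e := congrArg (exchange _ _ _) (inRight_connMat_mul_inLeft_siteMat cil tw D J I j h)
  simp only [map_mul, exchange_inLeft, exchange_inRight, exchange_tensorMat] at e
  exact e

theorem connMat_symm_braid_target (I J : ι) {i j : G.Dart} (h : cil.Before i j) {y : S}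
    (hi : i.snd = y) (hj : j.snd = y) :
    inLeft _ _ _ (connMat cil tw D I i.symm) * inRight _ _ _ (connMat cil tw D J j.symm) =
      cstHom _ _ (tensorMat (repAt tw D y I) (repAt tw D y J) (Rm (𝒢 y))) *
        (inRight _ _ _ (connMat cil tw D J j.symm) *
          inLeft _ _ _ (connMat cil tw D I i.symm)) := by
  have hb := connMat_braid_target cil tw D I J h hi hj
  have e₁ := map_mul_eq_one (inLeft (LatticeAlg cil tw D) _ (Fin (D.dim J)))
    (connMat_mul_connMat_symm cil tw D I i)
  have e₁' := map_mul_eq_one (inLeft (LatticeAlg cil tw D) _ (Fin (D.dim J)))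
    (connMat_symm_mul_connMat cil tw D I i)
  have e₂ := map_mul_eq_one (inRight (LatticeAlg cil tw D) (Fin (D.dim I)) _)
    (connMat_mul_connMat_symm cil tw D J j)
  have e₂' := map_mul_eq_one (inRight (LatticeAlg cil tw D) (Fin (D.dim I)) _)
    (connMat_symm_mul_connMat cil tw D J j)
  exact mul_eq_of_braid e₁ e₁' e₂ e₂' hb

/-- The sources are different, so a numerical R-matrix arises only at the common target y. One of
these cancels against the braid relation of the reversed links, and the Yang-Baxter equation at y
restores the order of the factors 𝐑_y. -/
theorem connStar_braid_target (I J : ι) {i j : G.Dart} (h : cil.Before i j) {y : S}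
    (hi : i.snd = y) (hj : j.snd = y) :
    inRight _ _ _ (connStar cil tw D J j) * inLeft _ _ _ (connStar cil tw D I i) =
      cstHom _ _ (tensorMat (repAt tw D y I) (repAt tw D y J) (swap _ (Ri _))) *
        (inLeft _ _ _ (connStar cil tw D I i) * inRight _ _ _ (connStar cil tw D J j)) := by
  have hxz := (before_fst_ne h).2
  have hx : i.fst ≠ y := hi ▸ i.adj.ne
  have hz : j.fst ≠ y := hj ▸ j.adj.ne
  rw [connStar_eq cil tw D I i hi, connStar_eq cil tw D J j hj]
  simp only [map_mul (inLeft _ _ _), map_mul (inRight _ _ _)]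
  -- `s := 1`: the gauge factor at the source of one link commutes with the other link matrix, since
  -- that vertex is not an end of the other link.
  rw [mul_exchange (s := 1) ?_ (inRight_connMat_mul_inLeft_siteMat cil tw D I J j.symm hj) ?_,
    mul_exchange (s := 1) ?_ (inLeft_connMat_mul_inRight_siteMat cil tw D I J i.symm hi) ?_]
  · have hc : Commute (inLeft _ _ (Fin (D.dim J)) (siteMat cil tw D i.fst I (Ri _)))
        (inRight _ (Fin (D.dim I)) _ (siteMat cil tw D j.fst J (Ri _))) :=
      inLeft_lop_commute_inRight _ _ _ fun a b c => gaugeAt_commute_siteMat cil tw D hxz J a _ b c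
    have e : cstHom (LatticeAlg cil tw D) _
        (tensorMat (repAt tw D y I) (repAt tw D y J) (swap _ (Ri (𝒢 y)))) *
        cstHom (LatticeAlg cil tw D) _
          (tensorMat (repAt tw D y I) (repAt tw D y J) (swap _ (Rm (𝒢 y)))) = 1 :=
      map_mul_eq_one _ (map_mul_eq_one _ (map_mul_eq_one _ Ri_mul_Rm))
    rw [siteMat_yang_baxter_swap cil tw D y I J, connMat_symm_braid_target cil tw D I J h hi hj,
      hc.eq]
    simp only [← mul_assoc]
    rw [e]
    simp only [mul_assoc, one_mul, mul_one]
  · exact (inLeft_lop_commute_inRight _ _ _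
      fun a b c => gaugeAt_commute_siteMat cil tw D hx J a _ b c).eq
  · rw [mul_one]
    exact (inLeft_lop_commute_inRight _ _ _ fun a b c =>
      other_covariance cil tw D J j.symm (by rw [← hj] at hx; exact hx) hxz a (b, c)).eq
  · exact (inRight_lop_commute_inLeft _ _ _
      fun a b c => gaugeAt_commute_siteMat cil tw D hz I a _ b c).eq
  · rw [mul_one]
    exact (inRight_lop_commute_inLeft _ _ _ fun a b c =>
      other_covariance cil tw D I i.symm (by rw [← hi] at hz; exact hz) hxz.symm a (b, c)).eq

theorem connStar_commute (I J : ι) {i j : G.Dart} (h : NoCommonEnd i j) :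
    Commute (inLeft _ _ _ (connStar cil tw D I i)) (inRight _ _ _ (connStar cil tw D J j)) := by
  have hsite : ∀ (x : S) (X : 𝒢 x ⊗[ℂ] 𝒢 x), x ≠ j.fst → x ≠ j.snd →
      Commute (inLeft _ _ (Fin (D.dim J)) (siteMat cil tw D x I X))
        (inRight _ (Fin (D.dim I)) _ (connStar cil tw D J j)) := by
    intro x X h₁ h₂
    rw [connStar, map_mul, map_mul]
    refine Commute.mul_right (Commute.mul_right ?_ ?_) ?_
    · exact inLeft_lop_commute_inRight _ _ _
        fun a b c => gaugeAt_commute_siteMat cil tw D h₂ J a _ b c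
    · exact inLeft_lop_commute_inRight _ _ _
        fun a b c => other_covariance cil tw D J j.symm h₂ h₁ a (b, c)
    · exact inLeft_lop_commute_inRight _ _ _
        fun a b c => gaugeAt_commute_siteMat cil tw D h₁ J a _ b c
  have hsite' : ∀ (x : S) (X : 𝒢 x ⊗[ℂ] 𝒢 x), x ≠ i.fst → x ≠ i.snd →
      Commute (inLeft _ _ (Fin (D.dim J)) (connMat cil tw D I i.symm))
        (inRight _ (Fin (D.dim I)) _ (siteMat cil tw D x J X)) := fun x X h₁ h₂ =>
    (inRight_lop_commute_inLeft _ _ _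
      fun a b c => other_covariance cil tw D I i.symm h₂ h₁ a (b, c)).symm
  rw [connStar, map_mul, map_mul]
  refine Commute.mul_left (Commute.mul_left ?_ ?_) ?_
  · exact hsite _ _ h.2.2.1 h.2.2.2
  · rw [connStar, map_mul, map_mul]
    refine Commute.mul_right (Commute.mul_right ?_ ?_) ?_
    · exact hsite' _ _ h.2.1.symm h.2.2.2.symm
    · exact inLeft_commute_inRight fun a b c d =>
        conn_commute_of_noCommonEnd cil tw D I J ⟨h.2.2.2, h.2.2.1, h.2.1, h.1⟩ (a, b) (c, d)
    · exact hsite' _ _ h.1.symm h.2.2.1.symm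
  · exact hsite _ _ h.1 h.2.1

theorem repAt_star (x : S) (I : ι) (a : 𝒢 x) :
    repAt tw D x I (star a) = (repAt tw D x I a).conjTranspose := by
  simp only [repAt, AlgHom.comp_apply]
  rw [← D.unitary]
  congr 1
  exact (tw x).iso_star a

theorem tensorMat_star {A A' m n : Type*} [Ring A] [Algebra ℂ A] [StarRing A] [StarModule ℂ A]
    [Ring A'] [Algebra ℂ A'] [StarRing A'] [StarModule ℂ A']
    [Fintype m] [DecidableEq m] [Fintype n] [DecidableEq n]
    {ρ : A →ₐ[ℂ] Matrix m m ℂ} {σ : A' →ₐ[ℂ] Matrix n n ℂ}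
    (hρ : ∀ a, ρ (star a) = (ρ a).conjTranspose) (hσ : ∀ a, σ (star a) = (σ a).conjTranspose)
    (X : A ⊗[ℂ] A') :
    tensorMat ρ σ (star X) = (tensorMat ρ σ X).conjTranspose := by
  induction X with
  | zero => simp
  | add X Y hX hY => simp only [star_add, map_add, Matrix.conjTranspose_add, hX, hY]
  | tmul a b =>
    ext p q
    simp [tensorMat, hρ, hσ, Matrix.kroneckerMap_apply]

/-- The factor F_x in the twisted Clebsch-Gordan map cancels the F_x⁻¹ of the twisted co-product,
which leaves the untwisted intertwining relation. -/
theorem cgAt_intertwines (x : S) (I J K : ι) (a : Fin (D.mult I J K)) (ξ : 𝒢 x) :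
    cgAt tw D x I J K a * tensorMat (repAt tw D x I) (repAt tw D x J) (comul (R := ℂ) ξ) =
      repAt tw D x K ξ * cgAt tw D x I J K a := by
  have e : ∀ X : 𝒢 x ⊗[ℂ] 𝒢 x, tensorMat (repAt tw D x I) (repAt tw D x J) X =
      tensorMat (D.τ I) (D.τ J) (Algebra.TensorProduct.map ((tw x).iso : 𝒢 x →ₐ[ℂ] H)
        ((tw x).iso : 𝒢 x →ₐ[ℂ] H) X) := by
    intro X
    induction X with
    | zero => simp
    | add X Y hX hY => simp only [map_add, hX, hY]
    | tmul a b => rfl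
  have hF : tensorMat (D.τ I) (D.τ J) ((tw x).F : H ⊗[ℂ] H) *
      tensorMat (D.τ I) (D.τ J) (((tw x).F⁻¹ : (H ⊗[ℂ] H)ˣ) : H ⊗[ℂ] H) = 1 :=
    map_mul_eq_one _ (Units.mul_inv _)
  rw [e, (tw x).iso_comul, map_mul, map_mul, cgAt, Matrix.mul_assoc, ← Matrix.mul_assoc _ (_ * _),
    ← Matrix.mul_assoc _ (tensorMat _ _ _), hF, Matrix.one_mul, ← Matrix.mul_assoc,
    D.C_intertwines, Matrix.mul_assoc]
  rfl

/-- Adjoint of the intertwining relation at ξ^*. The conjugation on the tensor square flips the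
factors, so Δ' appears; this matches the reversed order of the factors 𝐑_y in products of conjugate
link matrices. -/
theorem cgAt_conjTranspose_intertwines (x : S) (I J K : ι) (a : Fin (D.mult I J K)) (ξ : 𝒢 x) :
    (cgAt tw D x I J K a).conjTranspose * repAt tw D x K ξ =
      tensorMat (repAt tw D x I) (repAt tw D x J) (swap _ (comul (R := ℂ) ξ)) *
        (cgAt tw D x I J K a).conjTranspose := by
  have h := congrArg Matrix.conjTranspose (cgAt_intertwines tw D x I J K a (star ξ))
  rw [Matrix.conjTranspose_mul, Matrix.conjTranspose_mul, ← repAt_star,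
    ← tensorMat_star (repAt_star tw D x I) (repAt_star tw D x J), star_comul, star_star] at h
  exact h.symm

/-- After absorption of the numerical R-matrices, the middle product is fused by functoriality for
-i. The outer factors are 𝐑_y in the representation by Δ' and 𝐑_x⁻¹ in the one by Δ; C_y^* and C_x
intertwine these with τ^K and slide outwards. -/
theorem connStar_functoriality (I J : ι) (i : G.Dart) :
    inRight _ _ _ (connStar cil tw D J i) * inLeft _ _ _ (connStar cil tw D I i) =
      ∑ K, ∑ a, cstMap (LatticeAlg cil tw D) (cgAt tw D i.snd I J K a).conjTranspose *
        connStar cil tw D K i * cstMap (LatticeAlg cil tw D) (cgAt tw D i.fst I J K a) := by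
  rw [connStar_mul_connStar_self_eq, connMat_functoriality, Finset.mul_sum, Finset.sum_mul]
  refine Finset.sum_congr rfl fun K _ => ?_
  rw [Finset.mul_sum, Finset.sum_mul]
  refine Finset.sum_congr rfl fun a _ => ?_
  have h₁ := lop_tensorMat_swap_comul (repAt tw D i.snd I) (repAt tw D i.snd J)
    (gaugeAt cil tw D i.snd) ((tensorMat (repAt tw D i.snd I) (repAt tw D i.snd J)).comp
      ((swap _).comp (Bialgebra.comulAlgHom ℂ _))) fun _ => rfl
  have h₂ := lop_tensorMat_comul_inv (g := gaugeAt cil tw D i.fst)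
    (T := (tensorMat (repAt tw D i.fst I) (repAt tw D i.fst J)).comp
      (Bialgebra.comulAlgHom ℂ _)) fun _ => rfl
  rw [← h₁, ← h₂]
  have h₃ := cstMap_mul_lop (ρ := repAt tw D i.snd K)
    (σ := (tensorMat (repAt tw D i.snd I) (repAt tw D i.snd J)).comp
      ((swap _).comp (Bialgebra.comulAlgHom ℂ _)))
    (cgAt_conjTranspose_intertwines tw D i.snd I J K a) (gaugeAt cil tw D i.snd) (Rm _)
  have h₄ := cstMap_mul_lop (σ := repAt tw D i.fst K)
    (ρ := (tensorMat (repAt tw D i.fst I) (repAt tw D i.fst J)).comp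
      (Bialgebra.comulAlgHom ℂ _))
    (cgAt_intertwines tw D i.fst I J K a) (gaugeAt cil tw D i.fst) (Ri _)
  calc _ = lop ((tensorMat (repAt tw D i.snd I) (repAt tw D i.snd J)).comp
          ((swap _).comp (Bialgebra.comulAlgHom ℂ _))) (gaugeAt cil tw D i.snd) (Rm _) *
        cstMap (LatticeAlg cil tw D) (cgAt tw D i.snd I J K a).conjTranspose *
        connMat cil tw D K i.symm *
        (cstMap (LatticeAlg cil tw D) (cgAt tw D i.fst I J K a) *
          lop ((tensorMat (repAt tw D i.fst I) (repAt tw D i.fst J)).comp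
            (Bialgebra.comulAlgHom ℂ _)) (gaugeAt cil tw D i.fst) (Ri _)) := by
        simp only [Matrix.mul_assoc]; rfl
    _ = _ := by
        rw [← h₃, h₄, connStar]
        simp only [Matrix.mul_assoc]

end ConnStarRelations

section StarCovariance

variable {S : Type*} [Fintype S] [DecidableEq S] {G : SimpleGraph S} (cil : Ciliation G)
  {𝒢 : S → Type*}
  [∀ x, Ring (𝒢 x)] [∀ x, HopfAlgebra ℂ (𝒢 x)] [∀ x, StarRing (𝒢 x)]
  [∀ x, StarModule ℂ (𝒢 x)] [∀ x, RibbonHopfStarAlgebra (𝒢 x)]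
  {H : Type*} [Ring H] [HopfAlgebra ℂ H] [StarRing H] [StarModule ℂ H] [RibbonHopfStarAlgebra H]
  {ι : Type*} [Fintype ι] (tw : ∀ x, TwistEquiv (𝒢 x) H) (D : RepData H ι)

/-! ### The conjugation of the gauge algebra -/

theorem gaugeStar_smul_tprod (c : ℂ) (f : ∀ x, 𝒢 x) :
    gaugeStar 𝒢 (c • PiTensorProduct.tprod ℂ f) =
      star c • PiTensorProduct.tprod ℂ fun x => star (f x) := by
  rw [map_smulₛₗ, gaugeStar_tprod]
  rfl

theorem gaugeStar_mul (ξ ξ' : GaugeAlg 𝒢) :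
    gaugeStar 𝒢 (ξ * ξ') = gaugeStar 𝒢 ξ' * gaugeStar 𝒢 ξ := by
  induction ξ using PiTensorProduct.induction_on with
  | smul_tprod r f =>
    induction ξ' using PiTensorProduct.induction_on with
    | smul_tprod r' f' =>
      rw [PiTensorProduct.smul_tprod_mul_smul_tprod, gaugeStar_smul_tprod, gaugeStar_smul_tprod,
        gaugeStar_smul_tprod, PiTensorProduct.smul_tprod_mul_smul_tprod, star_mul]
      simp only [Pi.mul_apply, star_mul]
      rfl
    | add X Y hX hY => rw [mul_add, map_add, hX, hY, map_add, add_mul]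
  | add X Y hX hY => rw [add_mul, map_add, hX, hY, map_add, mul_add]

theorem gaugeStar_gaugeStar (ξ : GaugeAlg 𝒢) : gaugeStar 𝒢 (gaugeStar 𝒢 ξ) = ξ := by
  induction ξ using PiTensorProduct.induction_on with
  | smul_tprod r f => rw [gaugeStar_smul_tprod, gaugeStar_smul_tprod]; simp
  | add X Y hX hY => rw [map_add, map_add, hX, hY]

theorem gaugeStar_one : gaugeStar 𝒢 (1 : GaugeAlg 𝒢) = 1 := by
  rw [PiTensorProduct.one_def, gaugeStar_tprod]
  simp only [Pi.one_apply, star_one]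
  rfl

theorem gaugeStar_single (z : S) (a : 𝒢 z) :
    gaugeStar 𝒢 (PiTensorProduct.singleAlgHom z a) = PiTensorProduct.singleAlgHom z (star a) := by
  rw [PiTensorProduct.singleAlgHom_apply, PiTensorProduct.singleAlgHom_apply, gaugeStar_tprod]
  congr 1
  funext y
  by_cases h : y = z
  · subst h; simp
  · simp [h]

/-- The one-site algebras generate the gauge algebra, which reduces covariance to a single site. -/
theorem gaugeAlg_subalgebra_eq_top (P : Subalgebra ℂ (GaugeAlg 𝒢))
    (h : ∀ z a, PiTensorProduct.singleAlgHom z a ∈ P) : P = ⊤ := by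
  have ht : ∀ f : ∀ z, 𝒢 z, PiTensorProduct.tprod ℂ f ∈ P := by
    intro f
    have hf : f ∈ P.toSubmonoid.comap (PiTensorProduct.tprodMonoidHom ℂ) := by
      rw [← Finset.noncommProd_mulSingle f]
      refine Submonoid.noncommProd_mem _ _ _ _ fun z _ => ?_
      have := h z (f z)
      rwa [PiTensorProduct.singleAlgHom_apply] at this
    exact hf
  refine Algebra.eq_top_iff.2 fun ξ => ?_
  induction ξ using PiTensorProduct.induction_on with
  | smul_tprod r f => exact P.smul_mem (ht f) r
  | add X Y hX hY => exact P.add_mem hX hY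

/-! ### Covariance of the conjugate link matrices -/

/-- Source covariance of -i moves ζ to the left as Δ(ζ), and R_y Δ = Δ' R_y then produces Δ'. The
flip is what the conjugate of Δ requires. -/
theorem connStar_target_covariance (I : ι) (i : G.Dart) {y : S} (h : i.snd = y) (ζ : 𝒢 y) :
    connStar cil tw D I i * siteDiag cil tw D y I ζ =
      siteMat cil tw D y I (swap _ (comul (R := ℂ) ζ)) * connStar cil tw D I i := by
  have hx : i.fst ≠ y := h ▸ i.adj.ne
  have hc : Commute (siteMat cil tw D i.fst I (Ri _)) (siteDiag cil tw D y I ζ) := by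
    ext a b
    rw [AlgHom.comp_apply, mul_diagHom_apply, diagHom_mul_apply,
      (gaugeAt_commute_siteMat cil tw D hx.symm I ζ _ a b).eq]
  have hs := source_covariance cil tw D I i.symm (x := y) h ζ
  have hR := congrArg (siteMat cil tw D y I) (RibbonHopfStarAlgebra.R_comul ζ)
  rw [map_mul, map_mul] at hR
  rw [connStar_eq cil tw D I i h, mul_assoc, hc.eq, ← mul_assoc, mul_assoc _ _
      (siteDiag _ _ _ _ _ _),
    ← hs, ← mul_assoc, hR]
  simp only [mul_assoc]

theorem connStar_source_covariance (I : ι) (i : G.Dart) {x : S} (h : i.fst = x) (ζ : 𝒢 x) :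
    siteDiag cil tw D x I ζ * connStar cil tw D I i =
      connStar cil tw D I i * siteMat cil tw D x I (swap _ (comul (R := ℂ) ζ)) := by
  subst h
  have hc : Commute (siteDiag cil tw D i.fst I ζ) (siteMat cil tw D i.snd I (Rm _)) := by
    ext a b
    rw [AlgHom.comp_apply, mul_diagHom_apply, diagHom_mul_apply,
      (gaugeAt_commute_siteMat cil tw D i.adj.ne I ζ _ a b).eq]
  have hs := target_covariance cil tw D I i.symm (y := i.fst) rfl ζ
  have hR := congrArg (siteMat cil tw D i.fst I) (Ri_mul_swap_comul ζ)
  rw [map_mul, map_mul] at hR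
  rw [connStar, ← mul_assoc, ← mul_assoc, hc.eq, mul_assoc _ _ (connMat _ _ _ _ _), hs,
    mul_assoc _ _ (siteMat _ _ _ _ _ (swap _ _)), hR]
  simp only [mul_assoc]

theorem connStar_other_covariance (I : ι) (i : G.Dart) {z : S} (h₁ : z ≠ i.fst) (h₂ : z ≠ i.snd)
    (ξ : 𝒢 z) (a b : Fin (D.dim I)) :
    Commute (gaugeAt cil tw D z ξ) (connStar cil tw D I i a b) := by
  have h : Commute (siteDiag cil tw D z I ξ) (connStar cil tw D I i) := by
    refine Commute.mul_right (Commute.mul_right ?_ ?_) ?_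
    · ext a b
      rw [AlgHom.comp_apply, mul_diagHom_apply, diagHom_mul_apply,
        (gaugeAt_commute_siteMat cil tw D h₂ I ξ _ a b).eq]
    · ext a b
      rw [AlgHom.comp_apply, mul_diagHom_apply, diagHom_mul_apply]
      exact (other_covariance cil tw D I i.symm h₂ h₁ ξ (a, b)).eq
    · ext a b
      rw [AlgHom.comp_apply, mul_diagHom_apply, diagHom_mul_apply,
        (gaugeAt_commute_siteMat cil tw D h₁ I ξ _ a b).eq]
  have e := congrFun (congrFun h.eq a) b
  rwa [AlgHom.comp_apply, mul_diagHom_apply, diagHom_mul_apply] at e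

theorem slice_singleTensor (I : ι) (i : G.Dart) (z : S) (X : 𝒢 z ⊗[ℂ] 𝒢 z) (β α : D.Ix I) :
    slice (linkRep tw D I i) β α (singleTensor z X) =
      PiTensorProduct.singleAlgHom (R := ℂ) (A := 𝒢) z (slice (linkRepAt tw D I i z) β α X) := by
  induction X with
  | zero => rw [map_zero, map_zero, map_zero, map_zero]
  | add X Y hX hY => simp only [map_add, hX, hY]
  | tmul a b =>
    simp only [singleTensor, Algebra.TensorProduct.map_tmul, slice, LinearMap.comp_apply,
      LinearMap.rTensor_tmul, LinearEquiv.coe_coe, TensorProduct.lid_tmul, AlgHom.toLinearMap_apply,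
      linkRep, piLift_single, map_smul]

/-- The image of the generator `ξ ↦ (τ^{I,i}_{βα} ⊗ id)(X)` of the gauge algebra at a site under
the conjugation. -/
def starSlice (I : ι) (i : G.Dart) (z : S) (β α : D.Ix I) (X : 𝒢 z ⊗[ℂ] 𝒢 z) :
    LatticeAlg cil tw D :=
  gaugeAt cil tw D z (star (slice (linkRepAt tw D I i z) β α X))

theorem starSlice_add (I : ι) (i : G.Dart) (z : S) (β α : D.Ix I) (X Y : 𝒢 z ⊗[ℂ] 𝒢 z) :
    starSlice cil tw D I i z β α (X + Y) =
      starSlice cil tw D I i z β α X + starSlice cil tw D I i z β α Y := by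
  simp [starSlice]

theorem starSlice_tmul (I : ι) (i : G.Dart) (z : S) (β α : D.Ix I) (a b : 𝒢 z) :
    starSlice cil tw D I i z β α (a ⊗ₜ b) =
      star (linkRepAt tw D I i z a β α) • gaugeAt cil tw D z (star b) := by
  simp [starSlice, slice]

theorem sum_starSlice_target (I : ι) (i : G.Dart) (X : 𝒢 i.snd ⊗[ℂ] 𝒢 i.snd) (α : D.Ix I)
    (W : Matrix (Fin (D.dim I)) (Fin (D.dim I)) (LatticeAlg cil tw D)) :
    ∑ β, starSlice cil tw D I i i.snd β α X * W β.2 β.1 =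
      (siteMat cil tw D i.snd I (star X) * W) α.2 α.1 := by
  induction X with
  | zero => simp [starSlice]
  | add X Y hX hY =>
    simp only [starSlice_add, add_mul, Finset.sum_add_distrib, hX, hY, star_add, map_add,
      Matrix.add_apply]
  | tmul a b =>
    rw [Fintype.sum_prod_type, Finset.sum_eq_single α.1, TensorProduct.star_tmul, Matrix.mul_apply]
    · refine Finset.sum_congr rfl fun c _ => ?_
      rw [starSlice_tmul, linkRepAt_target tw D I i rfl, siteMat, lop_tmul_apply, repAt_star]
      simp [targetRep, Matrix.kroneckerMap_apply]
    · intro c _ hc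
      refine Finset.sum_eq_zero fun d _ => ?_
      rw [starSlice_tmul, linkRepAt_target tw D I i rfl]
      simp [targetRep, Matrix.kroneckerMap_apply, hc]
    · simp

/-- Unitarity of τ and S(ξ^*) = S(ξ)^* turn the conjugated contragredient coefficients into right
multiplication by τ(S(·)), the shape treated in `sandwich_comul_eq_mul`. -/
theorem sum_starSlice_source (I : ι) (i : G.Dart) (X : 𝒢 i.fst ⊗[ℂ] 𝒢 i.fst) (α : D.Ix I)
    (W : Matrix (Fin (D.dim I)) (Fin (D.dim I)) (LatticeAlg cil tw D)) :
    ∑ β, starSlice cil tw D I i i.fst β α X * W β.2 β.1 =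
      sandwich (siteDiag cil tw D i.fst I : _ →ₗ[ℂ] _)
        ((((cstHom (LatticeAlg cil tw D) _).comp (repAt tw D i.fst I) : _ →ₐ[ℂ] _) : _ →ₗ[ℂ] _) ∘ₗ
          antipode ℂ) W (swap _ (star X)) α.2 α.1 := by
  induction X with
  | zero => simp [starSlice]
  | add X Y hX hY =>
    simp only [starSlice_add, add_mul, Finset.sum_add_distrib, hX, hY, star_add, map_add,
      Matrix.add_apply]
  | tmul a b =>
    rw [TensorProduct.star_tmul, swap_tmul, sandwich_tmul]
    change _ = (diagHom (LatticeAlg cil tw D) (Fin (D.dim I)) (gaugeAt cil tw D i.fst (star b)) *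
      W * cstHom (LatticeAlg cil tw D) (Fin (D.dim I))
        (repAt tw D i.fst I (antipode ℂ (star a)))) α.2 α.1
    rw [Fintype.sum_prod_type, Matrix.mul_apply]
    refine Finset.sum_congr rfl fun c _ => ?_
    rw [Finset.sum_eq_single α.2, diagHom_mul_apply, starSlice_tmul,
      linkRepAt_source tw D I i rfl, RibbonHopfStarAlgebra.antipode_star, repAt_star, cstHom_apply,
      ← Algebra.commutes, ← Algebra.smul_def]
    · simp [sourceRep, Matrix.kroneckerMap_apply]
    · intro d _ hd
      rw [starSlice_tmul, linkRepAt_source tw D I i rfl]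
      simp [sourceRep, Matrix.kroneckerMap_apply, hd]
    · simp

theorem starSlice_other (I : ι) (i : G.Dart) {z : S} (h₁ : z ≠ i.fst) (h₂ : z ≠ i.snd)
    (ξ : 𝒢 z) (β α : D.Ix I) :
    starSlice cil tw D I i z β α (comul (R := ℂ) ξ) =
      if β = α then gaugeAt cil tw D z (star ξ) else 0 := by
  have key : ∀ X : 𝒢 z ⊗[ℂ] 𝒢 z, slice (counitHom (𝒢 z) (Matrix (D.Ix I) (D.Ix I) ℂ)) β α X =
      if β = α then TensorProduct.lid ℂ (𝒢 z) ((counit (R := ℂ)).rTensor (𝒢 z) X) else 0 := by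
    intro X
    induction X with
    | zero => simp
    | add X Y hX hY =>
      simp only [map_add, hX, hY]
      split_ifs <;> simp
    | tmul a b =>
      simp only [slice, counitHom_apply, LinearMap.comp_apply, LinearMap.rTensor_tmul,
        LinearEquiv.coe_coe, TensorProduct.lid_tmul, AlgHom.toLinearMap_apply,
        Matrix.entryLinearMap_apply, Matrix.algebraMap_matrix_apply]
      split_ifs <;> simp
  rw [starSlice, linkRepAt_other tw D I i h₁ h₂, key]
  split_ifs <;> simp

theorem gauge_gaugeStar_slice_single (I : ι) (i : G.Dart) (z : S) (ξ : 𝒢 z) (β α : D.Ix I) :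
    gauge cil tw D (gaugeStar 𝒢 (slice (linkRep tw D I i) β α
      (gaugeComul 𝒢 (PiTensorProduct.singleAlgHom z ξ)))) =
      starSlice cil tw D I i z β α (comul (R := ℂ) ξ) := by
  rw [gaugeComul_single, slice_singleTensor, gaugeStar_single]
  rfl

theorem connStar_covariance_single (I : ι) (i : G.Dart) (z : S) (ξ : 𝒢 z) (α : D.Ix I) :
    connStar cil tw D I i α.2 α.1 * gauge cil tw D (gaugeStar 𝒢 (PiTensorProduct.singleAlgHom z ξ))
        =
      ∑ β, gauge cil tw D (gaugeStar 𝒢 (slice (linkRep tw D I i) β α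
        (gaugeComul 𝒢 (PiTensorProduct.singleAlgHom z ξ)))) *
        connStar cil tw D I i β.2 β.1 := by
  simp only [gauge_gaugeStar_slice_single]
  rw [gaugeStar_single, ← gaugeAt_apply]
  have e : connStar cil tw D I i α.2 α.1 * gaugeAt cil tw D z (star ξ) =
      (connStar cil tw D I i * siteDiag cil tw D z I (star ξ)) α.2 α.1 := by
    rw [AlgHom.comp_apply, mul_diagHom_apply]
  by_cases hy : z = i.snd
  · subst hy
    rw [sum_starSlice_target, star_comul, ← connStar_target_covariance cil tw D I i rfl, e]
  by_cases hx : z = i.fst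
  · subst hx
    rw [sum_starSlice_source, star_comul, swap_swap, e]
    refine congrFun (congrFun ?_ α.2) α.1
    refine (sandwich_comul_eq_mul
      ((cstHom (LatticeAlg cil tw D) (Fin (D.dim I))).comp (repAt tw D i.fst I))
      (siteDiag cil tw D i.fst I) (fun _ _ => cstHom_commute_diagHom _ _) _ (fun a => ?_)
      (star ξ)).symm
    exact connStar_source_covariance cil tw D I i rfl a
  · simp only [starSlice_other cil tw D I i hx hy]
    simp [(connStar_other_covariance cil tw D I i hx hy (star ξ) α.2 α.1).eq]

theorem slice_mul {A B m : Type*} [Ring A] [Algebra ℂ A] [Ring B] [Algebra ℂ B] [Fintype m]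
    [DecidableEq m] (ρ : A →ₐ[ℂ] Matrix m m ℂ) (X Y : A ⊗[ℂ] B) (p q : m) :
    slice ρ p q (X * Y) = ∑ k, slice ρ p k X * slice ρ k q Y := by
  have h : ∀ (Z : A ⊗[ℂ] B) (p q : m), slice ρ p q Z = lop ρ (AlgHom.id ℂ B) Z p q :=
    fun Z p q => (lop_apply ρ (AlgHom.id ℂ B) Z p q).symm
  simp only [h, map_mul, Matrix.mul_apply]

theorem slice_algebraMap {A B m : Type*} [Ring A] [Algebra ℂ A] [Ring B] [Algebra ℂ B] [Fintype m]
    [DecidableEq m] (ρ : A →ₐ[ℂ] Matrix m m ℂ) (c : ℂ) (p q : m) :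
    slice ρ p q (algebraMap ℂ (A ⊗[ℂ] B) c) = if p = q then algebraMap ℂ B c else 0 := by
  have h := lop_apply ρ (AlgHom.id ℂ B) (algebraMap ℂ (A ⊗[ℂ] B) c) p q
  rw [AlgHom.commutes, Matrix.algebraMap_matrix_apply] at h
  exact h.symm

/-- The image of the covariance relation under θ. -/
theorem connStar_covariance (I : ι) (i : G.Dart) (ξ : GaugeAlg 𝒢) (α : D.Ix I) :
    connStar cil tw D I i α.2 α.1 * gauge cil tw D (gaugeStar 𝒢 ξ) =
      ∑ β, gauge cil tw D (gaugeStar 𝒢 (slice (linkRep tw D I i) β α (gaugeComul 𝒢 ξ))) *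
        connStar cil tw D I i β.2 β.1 := by
  let φ : GaugeAlg 𝒢 →+ LatticeAlg cil tw D :=
    (gaugeHom cil tw D).toLinearMap.toAddMonoidHom.comp (gaugeStar 𝒢).toAddMonoidHom
  have hφ : ∀ ξ ξ', φ (ξ * ξ') = φ ξ' * φ ξ := fun ξ ξ' =>
    (congrArg (gaugeHom cil tw D) (gaugeStar_mul ξ ξ')).trans (map_mul _ _ _)
  have hc : ∀ c : ℂ, φ (algebraMap ℂ _ c) = algebraMap ℂ _ (star c) := by
    intro c
    change gaugeHom cil tw D (gaugeStar 𝒢 (algebraMap ℂ _ c)) = _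
    rw [Algebra.algebraMap_eq_smul_one, map_smulₛₗ, gaugeStar_one, ← Algebra.algebraMap_eq_smul_one,
      AlgHom.commutes]
    rfl
  -- The elements obeying the relation for all indices form a subalgebra: conjugation reverses
  -- products, while Δ followed by τ^{I,i} on the first leg is multiplicative as a matrix.
  let P : Subalgebra ℂ (GaugeAlg 𝒢) :=
    { carrier := {ξ | ∀ α : D.Ix I, connStar cil tw D I i α.2 α.1 * φ ξ =
        ∑ β, φ (slice (linkRep tw D I i) β α (gaugeComul 𝒢 ξ)) * connStar cil tw D I i β.2 β.1}
      mul_mem' := fun {ξ ξ'} h h' α => by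
        rw [Set.mem_ofPred_eq] at h h'
        rw [hφ, ← mul_assoc, h' α, Finset.sum_mul]
        simp only [mul_assoc, h, Finset.mul_sum]
        rw [Finset.sum_comm]
        refine Finset.sum_congr rfl fun γ _ => ?_
        rw [map_mul, slice_mul, map_sum, Finset.sum_mul]
        simp only [hφ, mul_assoc]
      add_mem' := fun {ξ ξ'} h h' α => by
        rw [map_add, mul_add, h α, h' α, ← Finset.sum_add_distrib]
        simp only [map_add, add_mul]
      algebraMap_mem' := fun c α => by
        simp only [hc, AlgHom.commutes, slice_algebraMap, apply_ite φ, map_zero, ite_mul, zero_mul]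
        simp [Algebra.commutes] }
  have hP : P = ⊤ := gaugeAlg_subalgebra_eq_top P fun z a α =>
    connStar_covariance_single cil tw D I i z a α
  have hξ : ξ ∈ P := hP ▸ Algebra.mem_top
  exact hξ α

end StarCovariance

/-! ### Conjugate-linear anti-homomorphisms -/

/-- The opposite of an algebra, with the conjugate action of the scalars. -/
def ConjOp (B : Type*) := Bᵐᵒᵖ

section ConjOp

variable {B : Type*} [Ring B] [Algebra ℂ B]

instance : Ring (ConjOp B) := inferInstanceAs (Ring Bᵐᵒᵖ)

/-- With scalars acting through conjugation, a linear homomorphism into this algebra is the same as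
a conjugate-linear anti-homomorphism into B. The universal properties of free algebras and quotients
then apply to θ. -/
instance : Algebra ℂ (ConjOp B) :=
  RingHom.toAlgebra' ((algebraMap ℂ Bᵐᵒᵖ).comp (starRingEnd ℂ)) fun c x =>
    Algebra.commutes (A := Bᵐᵒᵖ) (star c) x

/-- The element of the conjugate opposite algebra given by `b`. -/
def toConjOp (b : B) : ConjOp B := MulOpposite.op b

/-- The underlying element of `B`. -/
def unConjOp : ConjOp B →+ B where
  toFun x := MulOpposite.unop x
  map_zero' := rfl
  map_add' _ _ := rfl

theorem unConjOp_injective : Function.Injective (unConjOp (B := B)) := MulOpposite.unop_injective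

@[simp] theorem unConjOp_toConjOp (b : B) : unConjOp (toConjOp b) = b := rfl

@[simp] theorem unConjOp_one : unConjOp (1 : ConjOp B) = 1 := rfl

@[simp] theorem unConjOp_mul (x y : ConjOp B) : unConjOp (x * y) = unConjOp y * unConjOp x := rfl

@[simp] theorem unConjOp_smul (c : ℂ) (x : ConjOp B) : unConjOp (c • x) = star c • unConjOp x := by
  rw [Algebra.smul_def, unConjOp_mul, Algebra.smul_def, Algebra.commutes]
  rfl

end ConjOp

/-! ### Construction of θ from the generators and relations -/

section Theta

variable {S : Type*} [Fintype S] [DecidableEq S] {G : SimpleGraph S} (cil : Ciliation G)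
  {𝒢 : S → Type*}
  [∀ x, Ring (𝒢 x)] [∀ x, HopfAlgebra ℂ (𝒢 x)] [∀ x, StarRing (𝒢 x)]
  [∀ x, StarModule ℂ (𝒢 x)] [∀ x, RibbonHopfStarAlgebra (𝒢 x)]
  {H : Type*} [Ring H] [HopfAlgebra ℂ H] [StarRing H] [StarModule ℂ H] [RibbonHopfStarAlgebra H]
  {ι : Type*} [Fintype ι] (tw : ∀ x, TwistEquiv (𝒢 x) H) (D : RepData H ι)

/-- The conjugates of the generators of the lattice algebra. -/
def genStar : Gen G 𝒢 D → ConjOp (LatticeAlg cil tw D)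
  | .gauge ξ => toConjOp (gauge cil tw D (gaugeStar 𝒢 ξ))
  | .conn I i α => toConjOp (connStar cil tw D I i α.2 α.1)

/-- The conjugation on the free algebra. -/
def freeStar : FreeAlgebra ℂ (Gen G 𝒢 D) →ₐ[ℂ] ConjOp (LatticeAlg cil tw D) :=
  FreeAlgebra.lift ℂ (genStar cil tw D)

theorem freeStar_gauge (ξ : GaugeAlg 𝒢) :
    freeStar cil tw D (freeGauge G D ξ) = toConjOp (gauge cil tw D (gaugeStar 𝒢 ξ)) :=
  FreeAlgebra.lift_ι_apply _ _

theorem freeStar_conn (I : ι) (i : G.Dart) (α : D.Ix I) :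
    freeStar cil tw D (freeConn 𝒢 D I i α) = toConjOp (connStar cil tw D I i α.2 α.1) :=
  FreeAlgebra.lift_ι_apply _ _

theorem gauge_smul (c : ℂ) (ξ : GaugeAlg 𝒢) :
    gauge cil tw D (c • ξ) = c • gauge cil tw D ξ := map_smul (gaugeHom cil tw D) c ξ

theorem gauge_mul (ξ ξ' : GaugeAlg 𝒢) :
    gauge cil tw D (ξ * ξ') = gauge cil tw D ξ * gauge cil tw D ξ' := map_mul (gaugeHom cil tw D) ξ
        ξ'

theorem gauge_add (ξ ξ' : GaugeAlg 𝒢) :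
    gauge cil tw D (ξ + ξ') = gauge cil tw D ξ + gauge cil tw D ξ' := map_add (gaugeHom cil tw D) ξ
        ξ'

theorem gauge_one : gauge cil tw D (1 : GaugeAlg 𝒢) = 1 := map_one (gaugeHom cil tw D)

theorem freeStar_functoriality (I J : ι) (i : G.Dart) (α : D.Ix I) (β : D.Ix J) :
    connStar cil tw D J i β.2 β.1 * connStar cil tw D I i α.2 α.1 =
      ∑ K, ∑ a : Fin (D.mult I J K), ∑ γ : D.Ix K,
        star (cgAt tw D i.snd I J K a γ.2 (α.2, β.2) *
          (cgAt tw D i.fst I J K a).conjTranspose.transpose γ.1 (α.1, β.1)) •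
            connStar cil tw D K i γ.2 γ.1 := by
  have h := congrFun (congrFun (connStar_functoriality cil tw D I J i) (α.2, β.2)) (α.1, β.1)
  rw [inRight_mul_inLeft_apply] at h
  refine h.trans ?_
  simp only [Matrix.sum_apply]
  refine Finset.sum_congr rfl fun K _ => Finset.sum_congr rfl fun a _ => ?_
  rw [cstMap_mul_mul_cstMap_apply]
  refine Eq.trans ?_ (Fintype.sum_prod_type _).symm
  refine Finset.sum_congr rfl fun c _ => Finset.sum_congr rfl fun d _ => ?_
  simp [mul_comm]

theorem tensorMat_repAt_star (x : S) (I J : ι) (X : 𝒢 x ⊗[ℂ] 𝒢 x)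
    (p q : Fin (D.dim I) × Fin (D.dim J)) :
    star (tensorMat (repAt tw D x I) (repAt tw D x J) X p q) =
      tensorMat (repAt tw D x I) (repAt tw D x J) (star X) q p := by
  rw [tensorMat_star (repAt_star tw D x I) (repAt_star tw D x J)]
  rfl

theorem freeStar_braid_self (I J : ι) (i : G.Dart) (α : D.Ix I) (β : D.Ix J) :
    connStar cil tw D J i β.2 β.1 * connStar cil tw D I i α.2 α.1 =
      ∑ δ : D.Ix I, ∑ γ : D.Ix J,
        star (tensorMat (repAt tw D i.fst I) (repAt tw D i.fst J) (Rm (𝒢 i.fst))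
              (α.1, β.1) (δ.1, γ.1) *
            tensorMat (repAt tw D i.snd I) (repAt tw D i.snd J) (swap _ (Ri (𝒢 i.snd)))
              (δ.2, γ.2) (α.2, β.2)) •
          (connStar cil tw D I i δ.2 δ.1 * connStar cil tw D J i γ.2 γ.1) := by
  have h := congrFun (congrFun (connStar_braid_self cil tw D I J i) (α.2, β.2)) (α.1, β.1)
  rw [inRight_mul_inLeft_apply] at h
  refine h.trans ?_
  simp only [star_mul, tensorMat_repAt_star, star_Rm, ← swap_star, star_Ri, swap_swap]
  generalize tensorMat (repAt tw D i.fst I) (repAt tw D i.fst J) (swap _ (Ri (𝒢 i.fst))) = Q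
  generalize tensorMat (repAt tw D i.snd I) (repAt tw D i.snd J) (Rm (𝒢 i.snd)) = P
  change (cstMap (LatticeAlg cil tw D) P *
    (inLeft _ (Fin (D.dim I)) (Fin (D.dim J)) (connStar cil tw D I i) *
      inRight _ (Fin (D.dim I)) (Fin (D.dim J)) (connStar cil tw D J i)) *
    cstMap (LatticeAlg cil tw D) Q) (α.2, β.2) (α.1, β.1) = _
  rw [cstMap_mul_mul_cstMap_apply]
  simp only [inLeft_mul_inRight_apply]
  simp only [Fintype.sum_prod_type]
  exact Finset.sum_congr rfl fun d _ => Finset.sum_comm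

theorem freeStar_braid (i j : G.Dart) (h : cil.Before i j ∨ NoCommonEnd i j) (I J : ι)
    (α : D.Ix I) (β : D.Ix J) :
    connStar cil tw D J j β.2 β.1 * connStar cil tw D I i α.2 α.1 =
      ∑ δ : D.Ix I, ∑ γ : D.Ix J,
        star (tensorMat (linkRep tw D I i) (linkRep tw D J j)
          (gaugeR 𝒢 : GaugeAlg 𝒢 ⊗[ℂ] GaugeAlg 𝒢) (δ, γ) (α, β)) •
        (connStar cil tw D I i δ.2 δ.1 * connStar cil tw D J j γ.2 γ.1) := by
  rcases h with h | h
  · have e := congrFun (congrFun (connStar_braid_target cil tw D I J h (y := j.snd)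
      (before_fst_ne h).1 rfl) (α.2, β.2)) (α.1, β.1)
    rw [inRight_mul_inLeft_apply, Matrix.mul_apply] at e
    refine e.trans ?_
    rw [tensorMat_linkRep_gaugeR_of_target tw D I J (before_fst_ne h).1 rfl (before_fst_ne h).2]
    simp only [tensorMat_targetRep, apply_ite star, star_zero, tensorMat_repAt_star, star_Rm,
      inLeft_mul_inRight_apply, cstHom_apply, ite_smul, zero_smul, Fintype.sum_prod_type]
    symm
    rw [Finset.sum_eq_single α.1]
    · refine Finset.sum_congr rfl fun c _ => ?_
      rw [Finset.sum_eq_single β.1]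
      · refine Finset.sum_congr rfl fun d _ => ?_
        simp [Algebra.smul_def]
      · intro d _ hd
        simp [hd]
      · simp
    · intro c _ hc
      simp [hc]
    · simp
  · have e := congrFun (congrFun (connStar_commute cil tw D I J h).eq (α.2, β.2)) (α.1, β.1)
    rw [inRight_mul_inLeft_apply, inLeft_mul_inRight_apply] at e
    rw [← e, tensorMat_linkRep_gaugeR_of_noCommonEnd tw D I J h]
    simp only [Matrix.one_apply, Prod.mk.injEq, ite_and, apply_ite star, star_one, star_zero,
      ite_smul, one_smul, zero_smul]
    simp

/-- Compatibility with the defining relations, which makes θ descend to the quotient: each case is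
the entrywise form of a relation for the conjugate link matrices, with products reversed and
coefficients conjugated. -/
theorem freeStar_rel {X Y : FreeAlgebra ℂ (Gen G 𝒢 D)} (h : Rel cil tw D X Y) :
    freeStar cil tw D X = freeStar cil tw D Y := by
  apply unConjOp_injective
  cases h with
  | gauge_one => simp [freeStar_gauge, gaugeStar_one, gauge_one]
  | gauge_mul ξ ξ' => simp [freeStar_gauge, gaugeStar_mul, gauge_mul]
  | gauge_add ξ ξ' => simp [freeStar_gauge, gauge_add]
  | gauge_smul c ξ =>
    simp only [map_smul, freeStar_gauge, unConjOp_smul, unConjOp_toConjOp, map_smulₛₗ]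
    exact gauge_smul cil tw D _ _
  | covariance ξ I i α =>
    simp only [map_mul, map_sum, freeStar_gauge, freeStar_conn, unConjOp_mul, unConjOp_toConjOp]
    exact connStar_covariance cil tw D I i ξ α
  | functoriality I J i α β =>
    simp only [map_mul, map_sum, map_smul, freeStar_conn, unConjOp_mul, unConjOp_toConjOp,
      unConjOp_smul]
    exact freeStar_functoriality cil tw D I J i α β
  | inverse I i a c =>
    -- Reversal of the product and transposition of the matrices combine to the matrix product of
    -- the conjugates of U(-i) and U(i), in this order, with entry (c, a).
    have e := congrFun (congrFun (connStar_symm_mul_connStar cil tw D I i) c) a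
    simp only [map_mul, map_sum, freeStar_conn, unConjOp_mul, unConjOp_toConjOp]
    refine e.trans ?_
    rw [Matrix.one_apply]
    by_cases h : a = c
    · subst h; simp
    · simp [h, Ne.symm h]
  | braid i j h I J α β =>
    simp only [map_mul, map_sum, map_smul, freeStar_conn, unConjOp_mul, unConjOp_toConjOp,
      unConjOp_smul]
    exact freeStar_braid cil tw D i j h I J α β
  | braid_self i I J α β =>
    simp only [map_mul (freeStar cil tw D), map_sum, map_smul, freeStar_conn, unConjOp_mul,
      unConjOp_toConjOp, unConjOp_smul]
    exact freeStar_braid_self cil tw D I J i α β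

/-- The anti-homomorphism `θ`, as a homomorphism to the conjugate opposite algebra. -/
def thetaHom : LatticeAlg cil tw D →ₐ[ℂ] ConjOp (LatticeAlg cil tw D) :=
  RingQuot.liftAlgHom ℂ ⟨freeStar cil tw D, fun _ _ h => freeStar_rel cil tw D h⟩

/-- The conjugate-linear anti-homomorphism `θ` of the lattice algebra. -/
def theta : LatticeAlg cil tw D →ₗ⋆[ℂ] LatticeAlg cil tw D where
  toFun B := unConjOp (thetaHom cil tw D B)
  map_add' B B' := by rw [map_add, map_add]
  map_smul' c B := by rw [map_smul, unConjOp_smul]; rfl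

theorem theta_mul (B B' : LatticeAlg cil tw D) :
    theta cil tw D (B * B') = theta cil tw D B' * theta cil tw D B :=
  congrArg unConjOp (map_mul (thetaHom cil tw D) B B')

theorem theta_one : theta cil tw D 1 = 1 :=
  congrArg unConjOp (map_one (thetaHom cil tw D))

theorem theta_gauge (ξ : GaugeAlg 𝒢) :
    theta cil tw D (gauge cil tw D ξ) = gauge cil tw D (gaugeStar 𝒢 ξ) :=
  congrArg unConjOp ((RingQuot.liftAlgHom_mkAlgHom_apply ℂ _ _ _).trans
    (freeStar_gauge cil tw D ξ))

theorem theta_conn (I : ι) (i : G.Dart) (α : D.Ix I) :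
    theta cil tw D (conn cil tw D I i α) = connStar cil tw D I i α.2 α.1 :=
  congrArg unConjOp ((RingQuot.liftAlgHom_mkAlgHom_apply ℂ _ _ _).trans
    (freeStar_conn cil tw D I i α))

end Theta

section ThetaFormula

variable {S : Type*} [Fintype S] [DecidableEq S] {G : SimpleGraph S} (cil : Ciliation G)
  {𝒢 : S → Type*}
  [∀ x, Ring (𝒢 x)] [∀ x, HopfAlgebra ℂ (𝒢 x)] [∀ x, StarRing (𝒢 x)]
  [∀ x, StarModule ℂ (𝒢 x)] [∀ x, RibbonHopfStarAlgebra (𝒢 x)]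
  {H : Type*} [Ring H] [HopfAlgebra ℂ H] [StarRing H] [StarModule ℂ H] [RibbonHopfStarAlgebra H]
  {ι : Type*} [Fintype ι] (tw : ∀ x, TwistEquiv (𝒢 x) H) (D : RepData H ι)

/-! ### The formula for `θ` on the generators -/

theorem cstHom_comp_counitHom {A B n : Type*} [Ring A] [HopfAlgebra ℂ A] [Ring B] [Algebra ℂ B]
    [Fintype n] [DecidableEq n] :
    (cstHom B n).comp (counitHom A (Matrix n n ℂ)) = counitHom A (Matrix n n B) :=
  AlgHom.ext fun _ => (cstHom B n).commutes _

/-- Only the two ends of -i contribute; at every other site the link acts by ε, and (ε ⊗ id)R⁻¹ = 1.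
-/
theorem lop_linkRep_symm_gaugeR_inv (I : ι) (i : G.Dart) :
    lop (linkRep tw D I i.symm) (gaugeHom cil tw D)
        (((gaugeR 𝒢)⁻¹ : (GaugeAlg 𝒢 ⊗[ℂ] GaugeAlg 𝒢)ˣ) : GaugeAlg 𝒢 ⊗[ℂ] GaugeAlg 𝒢) =
      lop (sourceRep tw D i.snd I) (gaugeAt cil tw D i.snd) (Ri _) *
        lop (targetRep tw D i.fst I) (gaugeAt cil tw D i.fst) (Ri _) := by
  rw [apply_gaugeR_inv, shuffleEval_eq_pair _ _ i.adj.ne.symm, lop_linkRep_singleTensor,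
    lop_linkRep_singleTensor, linkRepAt_source tw D I i.symm (x := i.snd) rfl,
    linkRepAt_target tw D I i.symm (y := i.fst) rfl]
  intro z h₁ h₂
  rw [lop_linkRep_singleTensor, linkRepAt_other tw D I i.symm h₁ h₂]
  simp only [lop, cstHom_comp_counitHom]
  exact lift_counitHom_Ri_left _ _

theorem sum_conn_mul_slice (I : ι) (i : G.Dart) (β : D.Ix I) :
    ∑ γ : D.Ix I, conn cil tw D I i.symm γ * gauge cil tw D (slice (linkRep tw D I i.symm) γ β
        (((gaugeR 𝒢)⁻¹ : (GaugeAlg 𝒢 ⊗[ℂ] GaugeAlg 𝒢)ˣ) : GaugeAlg 𝒢 ⊗[ℂ] GaugeAlg 𝒢)) =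
      (sourceAct cil tw D i.snd I (connMat cil tw D I i.symm) (Ri _) *
        siteMat cil tw D i.fst I (Ri _)) β.1 β.2 := by
  have h : ∀ γ, gauge cil tw D (slice (linkRep tw D I i.symm) γ β
      (((gaugeR 𝒢)⁻¹ : (GaugeAlg 𝒢 ⊗[ℂ] GaugeAlg 𝒢)ˣ) : GaugeAlg 𝒢 ⊗[ℂ] GaugeAlg 𝒢)) =
      ∑ δ, lop (sourceRep tw D i.snd I) (gaugeAt cil tw D i.snd) (Ri _) γ δ *
        lop (targetRep tw D i.fst I) (gaugeAt cil tw D i.fst) (Ri _) δ β := fun γ => by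
    rw [← Matrix.mul_apply, ← lop_linkRep_symm_gaugeR_inv, lop_apply]
    rfl
  simp only [h, Finset.mul_sum, ← mul_assoc]
  rw [Finset.sum_comm]
  simp only [← Finset.sum_mul, lop_targetRep]
  rw [Fintype.sum_prod_type, Finset.sum_eq_single β.1, Matrix.mul_apply]
  · simp only [if_true, sourceAct_apply]
    rfl
  · intro c _ hc
    simp [hc]
  · simp

/-- The target end of -i already supplies 𝐑_x⁻¹. At its source end, R_y⁻¹ acts contragrediently, and
the factor τ(S(u_y)) in η converts this action into 𝐑_y on the left. -/
theorem connStar_apply (I : ι) (i : G.Dart) (α : D.Ix I) :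
    connStar cil tw D I i α.2 α.1 =
      ∑ γ : D.Ix I, ∑ β : D.Ix I, eta tw D I i β α • (conn cil tw D I i.symm γ *
        gauge cil tw D (slice (linkRep tw D I i.symm) γ β
          (((gaugeR 𝒢)⁻¹ : (GaugeAlg 𝒢 ⊗[ℂ] GaugeAlg 𝒢)ˣ) :
            GaugeAlg 𝒢 ⊗[ℂ] GaugeAlg 𝒢))) := by
  rw [Finset.sum_comm]
  simp only [← Finset.smul_sum, sum_conn_mul_slice]
  have h := antipode_drinfeldElt_mul_sandwich
    ((cstHom (LatticeAlg cil tw D) _).comp (repAt tw D i.snd I)) (siteDiag cil tw D i.snd I)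
    (fun a b => cstHom_commute_diagHom _ _)
    (connMat cil tw D I i.symm)
    (fun a => (source_covariance cil tw D I i.symm rfl a).symm)
  have h' := congrArg (· * siteMat cil tw D i.fst I (Ri _)) h
  refine (congrFun (congrFun h' α.2) α.1).symm.trans ?_
  simp only [mul_assoc]
  rw [Matrix.mul_apply, Fintype.sum_prod_type]
  refine Finset.sum_congr rfl fun c _ => ?_
  rw [Finset.sum_eq_single α.1]
  · simp only [eta, if_true, one_mul, Algebra.smul_def]
    rfl
  · intro b _ hb
    simp [eta, hb]
  · simp

theorem isTheta_theta : IsTheta cil tw D (theta cil tw D) where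
  map_one := theta_one cil tw D
  map_mul := theta_mul cil tw D
  map_gauge := theta_gauge cil tw D
  map_conn I i α := (theta_conn cil tw D I i α).trans (connStar_apply cil tw D I i α)

/-! ### Generators of the lattice algebra -/

theorem latticeAlg_induction {P : LatticeAlg cil tw D → Prop}
    (hs : ∀ c, P (algebraMap ℂ _ c)) (hg : ∀ ξ, P (gauge cil tw D ξ))
    (hc : ∀ I i α, P (conn cil tw D I i α)) (ha : ∀ B B', P B → P B' → P (B + B'))
    (hm : ∀ B B', P B → P B' → P (B * B')) (B : LatticeAlg cil tw D) : P B := by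
  obtain ⟨X, rfl⟩ := RingQuot.mkAlgHom_surjective ℂ (Rel cil tw D) B
  induction X using FreeAlgebra.induction with
  | grade0 c => rw [AlgHom.commutes]; exact hs c
  | grade1 g =>
    cases g with
    | gauge ξ => exact hg ξ
    | conn I i α => exact hc I i α
  | mul X Y hX hY => rw [map_mul]; exact hm _ _ hX hY
  | add X Y hX hY => rw [map_add]; exact ha _ _ hX hY

theorem isTheta_unique {θ θ' : LatticeAlg cil tw D →ₗ⋆[ℂ] LatticeAlg cil tw D}
    (h : IsTheta cil tw D θ) (h' : IsTheta cil tw D θ') : θ' = θ := by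
  ext B
  induction B using latticeAlg_induction with
  | hs c => rw [Algebra.algebraMap_eq_smul_one, map_smulₛₗ, map_smulₛₗ, h.map_one, h'.map_one]
  | hg ξ => rw [h.map_gauge, h'.map_gauge]
  | hc I i α => rw [h.map_conn, h'.map_conn]
  | ha B B' hB hB' => rw [map_add, map_add, hB, hB']
  | hm B B' hB hB' => rw [h.map_mul, h'.map_mul, hB, hB']

end ThetaFormula

section ThetaSquare

variable {S : Type*} [Fintype S] [DecidableEq S] {G : SimpleGraph S} (cil : Ciliation G)
  {𝒢 : S → Type*}
  [∀ x, Ring (𝒢 x)] [∀ x, HopfAlgebra ℂ (𝒢 x)] [∀ x, StarRing (𝒢 x)]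
  [∀ x, StarModule ℂ (𝒢 x)] [∀ x, RibbonHopfStarAlgebra (𝒢 x)]
  {H : Type*} [Ring H] [HopfAlgebra ℂ H] [StarRing H] [StarModule ℂ H] [RibbonHopfStarAlgebra H]
  {ι : Type*} [Fintype ι] (tw : ∀ x, TwistEquiv (𝒢 x) H) (D : RepData H ι)

/-! ### Central unitary elements of the gauge algebra -/

/-- The unit `⊗_z g_z` of the gauge algebra. -/
def gaugeUnit (g : ∀ z, (𝒢 z)ˣ) : (GaugeAlg 𝒢)ˣ :=
  Units.map (PiTensorProduct.tprodMonoidHom ℂ : (∀ z, 𝒢 z) →* GaugeAlg 𝒢) (MulEquiv.piUnits.symm g)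

theorem val_gaugeUnit (g : ∀ z, (𝒢 z)ˣ) :
    (gaugeUnit g : GaugeAlg 𝒢) = PiTensorProduct.tprod ℂ fun z => (g z : 𝒢 z) := rfl

theorem val_inv_gaugeUnit (g : ∀ z, (𝒢 z)ˣ) :
    ((gaugeUnit g)⁻¹ : (GaugeAlg 𝒢)ˣ) = PiTensorProduct.tprod ℂ fun z => (↑(g z)⁻¹ : 𝒢 z) := rfl

theorem tprod_central {m : ∀ z, 𝒢 z} (h : ∀ z a, m z * a = a * m z) (ξ : GaugeAlg 𝒢) :
    PiTensorProduct.tprod ℂ m * ξ = ξ * PiTensorProduct.tprod ℂ m := by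
  induction ξ using PiTensorProduct.induction_on with
  | smul_tprod r f =>
    rw [mul_smul_comm, smul_mul_assoc, PiTensorProduct.tprod_mul_tprod,
      PiTensorProduct.tprod_mul_tprod]
    congr 2
    funext z
    exact h z (f z)
  | add X Y hX hY => rw [mul_add, add_mul, hX, hY]

/-- The ribbon element as a unit. -/
def ribbonUnit (A : Type*) [Ring A] [HopfAlgebra ℂ A] [StarRing A] [StarModule ℂ A]
    [RibbonHopfStarAlgebra A] : Aˣ where
  val := RibbonHopfStarAlgebra.v
  inv := star RibbonHopfStarAlgebra.v
  val_inv := (RibbonHopfStarAlgebra.v_central _).trans RibbonHopfStarAlgebra.star_v_mul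
  inv_val := RibbonHopfStarAlgebra.star_v_mul

/-! ### The square of `θ` -/

/-- The conjugate transpose with respect to `θ`. -/
def thetaMat {n : Type*} (X : Matrix n n (LatticeAlg cil tw D)) :
    Matrix n n (LatticeAlg cil tw D) :=
  Matrix.of fun a b => theta cil tw D (X b a)

theorem thetaMat_mul {n : Type*} [Fintype n] (X Y : Matrix n n (LatticeAlg cil tw D)) :
    thetaMat cil tw D (X * Y) = thetaMat cil tw D Y * thetaMat cil tw D X := by
  ext a b
  simp only [thetaMat, Matrix.of_apply, Matrix.mul_apply, map_sum, theta_mul]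

theorem thetaMat_siteMat (x : S) (I : ι) (X : 𝒢 x ⊗[ℂ] 𝒢 x) :
    thetaMat cil tw D (siteMat cil tw D x I X) = siteMat cil tw D x I (star X) := by
  ext p q
  induction X with
  | zero => simp [thetaMat]
  | add X Y hX hY =>
    simp only [thetaMat, Matrix.of_apply, map_add, star_add, Matrix.add_apply] at hX hY ⊢
    rw [hX, hY]
  | tmul a b =>
    rw [thetaMat, Matrix.of_apply, TensorProduct.star_tmul, lop_tmul_apply, lop_tmul_apply,
      map_smulₛₗ, gaugeAt_apply, theta_gauge, gaugeStar_single, repAt_star]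
    rfl

theorem thetaMat_connMat (I : ι) (i : G.Dart) :
    thetaMat cil tw D (connMat cil tw D I i) = connStar cil tw D I i := by
  ext a b
  exact theta_conn cil tw D I i (b, a)

/-- θ² on a link matrix. By unitarity of R, the conjugates of 𝐑_x⁻¹ and 𝐑_y are 𝐑'_x and (𝐑'_y)⁻¹;
they combine with the factors of the conjugate of U(-i) to the monodromies at the two ends. -/
theorem thetaMat_connStar (I : ι) (i : G.Dart) :
    thetaMat cil tw D (connStar cil tw D I i) =
      siteMat cil tw D i.fst I (swap _ (Rm _) * Rm _) * connMat cil tw D I i *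
        siteMat cil tw D i.snd I (Ri _ * swap _ (Ri _)) := by
  have e : connStar cil tw D I i.symm = siteMat cil tw D i.fst I (Rm (𝒢 i.fst)) *
      connMat cil tw D I i * siteMat cil tw D i.snd I (Ri (𝒢 i.snd)) :=
    connStar_eq cil tw D I i.symm rfl
  rw [connStar, thetaMat_mul, thetaMat_mul, thetaMat_siteMat, thetaMat_siteMat, thetaMat_connMat, e,
    star_Rm, star_Ri, map_mul, map_mul]
  simp only [mul_assoc]

theorem swap_Rm_mul_Rm_mul_comul_v (A : Type*) [Ring A] [HopfAlgebra ℂ A] [StarRing A]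
    [StarModule ℂ A] [RibbonHopfStarAlgebra A] :
    swap A (Rm A) * Rm A * comul (R := ℂ) (RibbonHopfStarAlgebra.v : A) =
      RibbonHopfStarAlgebra.v ⊗ₜ RibbonHopfStarAlgebra.v := by
  rw [RibbonHopfStarAlgebra.comul_v]
  exact Units.mul_inv_cancel_left (swapUnit A RibbonHopfStarAlgebra.R * RibbonHopfStarAlgebra.R) _

theorem Ri_mul_swap_Ri_mul_v_tmul_v (A : Type*) [Ring A] [HopfAlgebra ℂ A] [StarRing A]
    [StarModule ℂ A] [RibbonHopfStarAlgebra A] :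
    Ri A * swap A (Ri A) * (RibbonHopfStarAlgebra.v ⊗ₜ RibbonHopfStarAlgebra.v) =
      comul (R := ℂ) (RibbonHopfStarAlgebra.v : A) := by
  rw [RibbonHopfStarAlgebra.comul_v, mul_inv_rev]
  rfl

theorem siteMat_v_tmul_v (x : S) (I : ι) :
    siteMat cil tw D x I (RibbonHopfStarAlgebra.v ⊗ₜ RibbonHopfStarAlgebra.v) =
      D.κ I ^ 2 • siteDiag cil tw D x I RibbonHopfStarAlgebra.v := by
  have h : repAt tw D x I RibbonHopfStarAlgebra.v = D.κ I ^ 2 • 1 := by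
    rw [← D.κ_sq I, ← (tw x).iso_v]
    rfl
  rw [lop_tmul, h, map_smul, map_one, smul_mul_assoc, one_mul]
  rfl

theorem gaugeHom_tprod_commute_conn {m : ∀ z, 𝒢 z} (I : ι) (i : G.Dart) (h₁ : m i.fst = 1)
    (h₂ : m i.snd = 1) (α : D.Ix I) :
    Commute (gauge cil tw D (PiTensorProduct.tprod ℂ m)) (conn cil tw D I i α) := by
  let P : Submonoid (∀ z, 𝒢 z) := (Submonoid.centralizer {conn cil tw D I i α}).comap
    ((gaugeHom cil tw D : GaugeAlg 𝒢 →* LatticeAlg cil tw D).comp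
      (PiTensorProduct.tprodMonoidHom ℂ))
  have hP : ∀ m' : ∀ z, 𝒢 z, m' ∈ P ↔
      Commute (gauge cil tw D (PiTensorProduct.tprod ℂ m')) (conn cil tw D I i α) := fun m' => by
    rw [Submonoid.mem_comap, Submonoid.mem_centralizer_iff, commute_iff_eq, eq_comm]
    simp only [Set.mem_singleton_iff, forall_eq]
    rfl
  rw [← hP, ← Finset.noncommProd_mulSingle m]
  refine Submonoid.noncommProd_mem _ _ _ _ fun z _ => ?_
  by_cases hx : z = i.fst
  · subst hx; rw [h₁, Pi.mulSingle_one]; exact one_mem P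
  by_cases hy : z = i.snd
  · subst hy; rw [h₂, Pi.mulSingle_one]; exact one_mem P
  rw [hP]
  have := other_covariance cil tw D I i hx hy (m z) α
  rwa [gaugeAt_apply, PiTensorProduct.singleAlgHom_apply] at this

theorem gauge_tprod_eq (m : ∀ z, 𝒢 z) {x y : S} (h : x ≠ y) :
    gauge cil tw D (PiTensorProduct.tprod ℂ m) =
      gaugeAt cil tw D x (m x) * gaugeAt cil tw D y (m y) *
        gauge cil tw D (PiTensorProduct.tprod ℂ (Function.update (Function.update m x 1) y 1)) := by
  rw [gaugeAt_apply, gaugeAt_apply, ← gauge_mul, ← gauge_mul, PiTensorProduct.singleAlgHom_apply,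
    PiTensorProduct.singleAlgHom_apply]
  change _ = gauge cil tw D (PiTensorProduct.tprod ℂ _ * PiTensorProduct.tprod ℂ _ * _)
  rw [PiTensorProduct.tprod_mul_tprod, PiTensorProduct.tprod_mul_tprod]
  congr 2
  funext z
  by_cases hx : z = x
  · subst hx; simp [h]
  by_cases hy : z = y
  · subst hy; simp [hx]
  simp [hx, hy]

/-- At x, source covariance and (R'R)Δ(v) = v ⊗ v replace the monodromy by conjugation with v_x, up
to the number κ_I² = v^I. At y, target covariance consumes the same number. The factors of v at
other sites commute with U(i). -/
theorem theta_theta_conn_mul (I : ι) (i : G.Dart) (α : D.Ix I) :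
    theta cil tw D (theta cil tw D (conn cil tw D I i α)) * gauge cil tw D (gaugeV 𝒢) =
      gauge cil tw D (gaugeV 𝒢) * conn cil tw D I i α := by
  set U := connMat cil tw D I i with hU
  set W := diagHom (LatticeAlg cil tw D) (Fin (D.dim I)) (gauge cil tw D (PiTensorProduct.tprod ℂ
    (Function.update (Function.update
      (fun z => (RibbonHopfStarAlgebra.v : 𝒢 z)) i.fst 1) i.snd 1))) with hW
  have hV : diagHom (LatticeAlg cil tw D) (Fin (D.dim I)) (gauge cil tw D (gaugeV 𝒢)) =
      siteDiag cil tw D i.fst I RibbonHopfStarAlgebra.v *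
        siteDiag cil tw D i.snd I RibbonHopfStarAlgebra.v * W := by
    rw [gaugeV, gauge_tprod_eq cil tw D _ i.adj.ne, map_mul, map_mul]
    rfl
  have hWU : W * U = U * W := by
    ext a b
    rw [hW, mul_diagHom_apply, diagHom_mul_apply]
    exact (gaugeHom_tprod_commute_conn cil tw D I i (by simp [i.adj.ne]) (by simp) (a, b)).eq
  have hN : ∀ X, siteMat cil tw D i.snd I X * siteDiag cil tw D i.fst I RibbonHopfStarAlgebra.v =
      siteDiag cil tw D i.fst I RibbonHopfStarAlgebra.v * siteMat cil tw D i.snd I X := fun X => by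
    ext a b
    rw [AlgHom.comp_apply, mul_diagHom_apply, diagHom_mul_apply,
      (gaugeAt_commute_siteMat cil tw D i.adj.ne I _ _ a b).eq]
  have hx : siteMat cil tw D i.fst I (swap _ (Rm _) * Rm _) * U *
      siteDiag cil tw D i.fst I RibbonHopfStarAlgebra.v =
      D.κ I ^ 2 • (siteDiag cil tw D i.fst I RibbonHopfStarAlgebra.v * U) := by
    rw [mul_assoc, hU, ← source_covariance cil tw D I i rfl, ← mul_assoc, ← map_mul,
      swap_Rm_mul_Rm_mul_comul_v, siteMat_v_tmul_v, smul_mul_assoc]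
  have hy : D.κ I ^ 2 • (U * siteMat cil tw D i.snd I (Ri _ * swap _ (Ri _)) *
      siteDiag cil tw D i.snd I RibbonHopfStarAlgebra.v) =
      siteDiag cil tw D i.snd I RibbonHopfStarAlgebra.v * U := by
    rw [hU, target_covariance cil tw D I i rfl, ← Ri_mul_swap_Ri_mul_v_tmul_v, map_mul _ (_ * _),
      siteMat_v_tmul_v, mul_smul_comm, mul_smul_comm, mul_assoc]
  have hassoc : ∀ X N Y : Matrix (Fin (D.dim I)) (Fin (D.dim I)) (LatticeAlg cil tw D),
      D.κ I ^ 2 • (X * U) * N * Y = X * (D.κ I ^ 2 • (U * N * Y)) := fun X N Y => by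
    simp only [smul_mul_assoc, mul_smul_comm, mul_assoc]
  have key : thetaMat cil tw D (connStar cil tw D I i) *
      diagHom (LatticeAlg cil tw D) (Fin (D.dim I)) (gauge cil tw D (gaugeV 𝒢)) =
      diagHom (LatticeAlg cil tw D) (Fin (D.dim I)) (gauge cil tw D (gaugeV 𝒢)) * U := by
    rw [thetaMat_connStar, hV, mul_assoc _ W U, hWU, ← mul_assoc, ← mul_assoc, ← mul_assoc,
      mul_assoc (_ * connMat cil tw D I i), hN, ← mul_assoc, hx, hassoc, hy, ← mul_assoc]
  have e := congrFun (congrFun key α.1) α.2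
  rw [mul_diagHom_apply, diagHom_mul_apply] at e
  rw [theta_conn]
  exact e

theorem gaugeV_central (ξ : GaugeAlg 𝒢) : gaugeV 𝒢 * ξ = ξ * gaugeV 𝒢 :=
  tprod_central (fun _ => RibbonHopfStarAlgebra.v_central) ξ

/-- Written without v⁻¹, the relation passes to products directly: θ² is multiplicative, and v moves
past one factor at a time. -/
theorem theta_theta_mul (B : LatticeAlg cil tw D) :
    theta cil tw D (theta cil tw D B) * gauge cil tw D (gaugeV 𝒢) =
      gauge cil tw D (gaugeV 𝒢) * B := by
  induction B using latticeAlg_induction with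
  | hs c =>
    rw [Algebra.algebraMap_eq_smul_one, map_smulₛₗ, map_smulₛₗ, theta_one, theta_one]
    simp
  | hg ξ => rw [theta_gauge, theta_gauge, gaugeStar_gaugeStar, ← gauge_mul, ← gauge_mul,
      gaugeV_central]
  | hc I i α => exact theta_theta_conn_mul cil tw D I i α
  | ha B B' hB hB' => rw [map_add, map_add, add_mul, hB, hB', mul_add]
  | hm B B' hB hB' => rw [theta_mul, theta_mul, mul_assoc, hB', ← mul_assoc, hB, mul_assoc]

theorem theta_theta (B : LatticeAlg cil tw D) :
    theta cil tw D (theta cil tw D B) = gauge cil tw D (gaugeV 𝒢) * B *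
      gauge cil tw D ((gaugeUnit fun z => ribbonUnit (𝒢 z))⁻¹ : (GaugeAlg 𝒢)ˣ) := by
  rw [← theta_theta_mul, mul_assoc, ← gauge_mul]
  have : gaugeV 𝒢 * ((gaugeUnit fun z => ribbonUnit (𝒢 z))⁻¹ : (GaugeAlg 𝒢)ˣ) = 1 :=
    Units.mul_inv (gaugeUnit fun z => ribbonUnit (𝒢 z))
  rw [this, gauge_one, mul_one]

end ThetaSquare

/-! ### The element `κ` -/

section RepSpace

variable {A : Type*} [Ring A] [Algebra ℂ A] {m n : Type*} [Fintype m] [DecidableEq m] [Fintype n]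
  [DecidableEq n]

/-- The column vectors as a module over an algebra that acts on them by matrices. -/
def RepSpace (_ρ : A →ₐ[ℂ] Matrix m m ℂ) := m → ℂ

variable (ρ : A →ₐ[ℂ] Matrix m m ℂ) (σ : A →ₐ[ℂ] Matrix n n ℂ)

instance : AddCommGroup (RepSpace ρ) := inferInstanceAs (AddCommGroup (m → ℂ))

instance : Module ℂ (RepSpace ρ) := inferInstanceAs (Module ℂ (m → ℂ))

instance : Module A (RepSpace ρ) :=
  Module.compHom (m → ℂ) ((Matrix.toLinAlgEquiv'.toAlgHom.comp ρ : A →ₐ[ℂ] Module.End ℂ (m → ℂ)) :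
    A →+* Module.End ℂ (m → ℂ))

/-- The vectors of the standard basis. -/
def RepSpace.single (j : m) : RepSpace ρ := (Pi.single j 1 : m → ℂ)

theorem repSpace_algebraMap_smul (c : ℂ) (w : RepSpace ρ) : algebraMap ℂ A c • w = c • w := by
  have h : ∀ w : m → ℂ, (ρ (algebraMap ℂ A c)).mulVec w = c • w := fun w => by
    rw [AlgHom.commutes, Algebra.algebraMap_eq_smul_one, Matrix.smul_mulVec, Matrix.one_mulVec]
  exact h w

instance : IsScalarTower ℂ A (RepSpace ρ) where
  smul_assoc c a w := by
    rw [Algebra.smul_def, mul_smul, repSpace_algebraMap_smul]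

variable {ρ σ}

theorem IsIrred.isSimpleModule (h : IsIrred ρ) : IsSimpleModule A (RepSpace ρ) := by
  have := h.1
  rw [isSimpleModule_iff]
  have : Nontrivial (RepSpace ρ) := inferInstanceAs (Nontrivial (m → ℂ))
  refine { exists_pair_ne := exists_pair_ne _, eq_bot_or_eq_top := fun W => ?_ }
  refine (h.2 (W.restrictScalars ℂ) fun a w hw => W.smul_mem a hw).imp ?_ ?_
  · exact fun e => SetLike.ext fun w => SetLike.ext_iff.1 e w
  · exact fun e => SetLike.ext fun w => SetLike.ext_iff.1 e w

theorem isEquivRep_of_linearEquiv (e : RepSpace ρ ≃ₗ[A] RepSpace σ) : IsEquivRep ρ σ := by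
  let f : (m → ℂ) ≃ₗ[ℂ] (n → ℂ) := e.restrictScalars ℂ
  refine ⟨LinearMap.toMatrix' f.toLinearMap, LinearMap.toMatrix' f.symm.toLinearMap, ?_, ?_,
    fun a => ?_⟩
  · rw [← LinearMap.toMatrix'_comp, LinearEquiv.comp_coe, LinearEquiv.symm_trans_self]
    exact LinearMap.toMatrix'_id
  · rw [← LinearMap.toMatrix'_comp, LinearEquiv.comp_coe, LinearEquiv.self_trans_symm]
    exact LinearMap.toMatrix'_id
  · refine Matrix.toLin'.injective (LinearMap.ext fun w => ?_)
    rw [Matrix.toLin'_mul, Matrix.toLin'_mul, Matrix.toLin'_toMatrix']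
    exact e.map_smul a w

/-- The matrix representation on a module with a chosen basis. -/
def moduleRep {V : Type*} [AddCommGroup V] [Module ℂ V] [Module A V] [IsScalarTower ℂ A V]
    (b : Module.Basis m ℂ V) : A →ₐ[ℂ] Matrix m m ℂ :=
  (LinearMap.toMatrixAlgEquiv b).toAlgHom.comp (Algebra.lsmul ℂ ℂ V)

theorem moduleRep_mulVec {V : Type*} [AddCommGroup V] [Module ℂ V] [Module A V]
    [IsScalarTower ℂ A V] (b : Module.Basis m ℂ V) (a : A) (w : V) :
    (moduleRep b a).mulVec (b.equivFun w) = b.equivFun (a • w) :=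
  LinearMap.toMatrix_mulVec_repr b b (Algebra.lsmul ℂ ℂ V a) w

theorem isIrred_moduleRep {V : Type*} [AddCommGroup V] [Module ℂ V] [Module A V]
    [IsScalarTower ℂ A V] (b : Module.Basis m ℂ V) [IsSimpleModule A V] :
    IsIrred (moduleRep (A := A) b) := by
  have : Nontrivial V := IsSimpleModule.nontrivial A V
  refine ⟨b.index_nonempty, fun W hW => ?_⟩
  let P : Submodule A V :=
    { (W.comap b.equivFun.toLinearMap).toAddSubmonoid with
      smul_mem' := fun a w hw => by
        change b.equivFun (a • w) ∈ W
        rw [← moduleRep_mulVec]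
        exact hW a _ hw }
  have hP : ∀ w, w ∈ W ↔ b.equivFun.symm w ∈ P := fun w => by
    change _ ↔ b.equivFun (b.equivFun.symm w) ∈ W
    rw [LinearEquiv.apply_symm_apply]
  refine (eq_bot_or_eq_top P).imp (fun h => ?_) fun h => ?_
  · ext w
    rw [hP, h, Submodule.mem_bot, Submodule.mem_bot, LinearEquiv.map_eq_zero_iff]
  · ext w
    rw [hP, h]
    simp

end RepSpace

/-! ### Separation of points, Schur's lemma, and density for the representations τ^I -/

section Kappa

variable {H : Type*} [Ring H] [HopfAlgebra ℂ H] [StarRing H] [StarModule ℂ H]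
  [RibbonHopfStarAlgebra H] {ι : Type*} (D : RepData H ι)

theorem RepData.eq_of_isEquivRep {I J : ι} (h : IsEquivRep (D.τ I) (D.τ J)) : I = J := by
  obtain ⟨K, _, hK⟩ := D.complete _ (D.τ I) (D.irred I)
  exact (hK I ⟨1, 1, by simp, by simp, fun a => by simp⟩).trans (hK J h).symm

/-- As a left module, H is the sum of its simple submodules, each finite-dimensional and so
equivalent to some τ^I. An element killed by all τ^I annihilates H, in particular 1. -/
theorem RepData.eq_zero_of_forall_eq_zero [FiniteDimensional ℂ H] [IsSemisimpleRing H] {a : H}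
    (h : ∀ I, D.τ I a = 0) : a = 0 := by
  have hs : ∀ W : Submodule H H, IsSimpleModule H W → a ∈ W.annihilator := by
    intro W hW
    have : FiniteDimensional ℂ W :=
      inferInstanceAs (FiniteDimensional ℂ (W.restrictScalars ℂ))
    let b := Module.finBasis ℂ W
    obtain ⟨I, ⟨T, T', -, hT, e⟩, -⟩ := D.complete _ (moduleRep b) (isIrred_moduleRep (A := H) b)
    have h0 : moduleRep b a = 0 := by
      rw [← one_mul (moduleRep b a), ← hT, Matrix.mul_assoc, e, h I, Matrix.zero_mul,
        Matrix.mul_zero]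
    rw [Submodule.mem_annihilator]
    intro w hw
    have hw' := moduleRep_mulVec (A := H) b a ⟨w, hw⟩
    rw [h0, Matrix.zero_mulVec, eq_comm, LinearEquiv.map_eq_zero_iff] at hw'
    exact congrArg Subtype.val hw'
  have ht : a ∈ (⊤ : Submodule H H).annihilator := by
    rw [← IsSemisimpleModule.sSup_simples_eq_top H H, sSup_eq_iSup', Submodule.annihilator_iSup,
      Submodule.mem_iInf]
    exact fun W => hs W.1 W.2
  have := Submodule.mem_annihilator.1 ht 1 trivial
  rwa [smul_eq_mul, mul_one] at this

theorem RepData.ext_of_forall_eq [FiniteDimensional ℂ H] [IsSemisimpleRing H] {a b : H}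
    (h : ∀ I, D.τ I a = D.τ I b) : a = b :=
  sub_eq_zero.1 (D.eq_zero_of_forall_eq_zero fun I => by rw [map_sub, h, sub_self])

/-- Schur's lemma: the component from I to J is zero or an isomorphism, and the latter is excluded
because inequivalent classes carry different labels. -/
theorem RepData.intertwiner_apply_single [DecidableEq ι]
    (φ : (∀ I, RepSpace (D.τ I)) →ₗ[H] ∀ I, RepSpace (D.τ I)) {I J : ι} (h : I ≠ J)
    (w : RepSpace (D.τ I)) : φ (Pi.single I w) J = 0 := by
  have := (D.irred I).isSimpleModule
  have := (D.irred J).isSimpleModule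
  let f : RepSpace (D.τ I) →ₗ[H] RepSpace (D.τ J) :=
    LinearMap.proj J ∘ₗ φ ∘ₗ LinearMap.single H (fun I => RepSpace (D.τ I)) I
  rcases LinearMap.bijective_or_eq_zero f with hf | hf
  · exact absurd (D.eq_of_isEquivRep (isEquivRep_of_linearEquiv (LinearEquiv.ofBijective f hf))) h
  · exact LinearMap.congr_fun hf w

/-- Multiplication by c_I on the I-th summand of the direct sum of all V^I commutes with every
H-endomorphism, since endomorphisms preserve the summands by Schur's lemma. The density theorem
realizes it on finitely many vectors by an element of H. -/
theorem RepData.exists_forall_eq_smul_one [Fintype ι] [IsSemisimpleRing H] (c : ι → ℂ) :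
    ∃ k : H, ∀ I, D.τ I k = c I • 1 := by
  classical
  let M := ∀ I, RepSpace (D.τ I)
  let f : Module.End (Module.End H M) M :=
    { toFun := fun w I => c I • w I
      map_add' := fun w w' => funext fun I => smul_add _ _ _
      map_smul' := fun φ w => by
        change (fun I => c I • φ w I) = φ fun I => c I • w I
        funext J
        have key : ∀ w : M, φ w J = φ (Pi.single J (w J)) J := fun w => by
          conv_lhs => rw [← Finset.univ_sum_single w, map_sum, Finset.sum_apply]
          exact Finset.sum_eq_single J
            (fun I _ hI => D.intertwiner_apply_single φ hI (w I)) (by simp)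
        rw [key, key (fun I => c I • w I), ← repSpace_algebraMap_smul, ← repSpace_algebraMap_smul,
          Pi.single_smul, map_smul]
        rfl }
  -- The finite set consists of the standard basis vectors of all summands, so agreement there
  -- determines all the matrices τ^I(k).
  obtain ⟨k, hk⟩ := jacobson_density (R := H) f (Finset.univ.image
    fun p : Σ I, Fin (D.dim I) => (Pi.single p.1 (RepSpace.single (D.τ p.1) p.2) : M))
  refine ⟨k, fun I => Matrix.ext_col fun j => ?_⟩
  have e := congrFun (hk _ (Finset.mem_image_of_mem _ (Finset.mem_univ ⟨I, j⟩))) I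
  have e' : (c I • (Pi.single j 1 : Fin (D.dim I) → ℂ)) = (D.τ I k).mulVec (Pi.single j 1) := by
    refine Eq.trans ?_ (e.trans ?_)
    · change _ = c I • (Pi.single I (RepSpace.single (D.τ I) j) : M) I
      rw [Pi.single_eq_same]
      rfl
    · change k • (Pi.single I (RepSpace.single (D.τ I) j) : M) I = _
      rw [Pi.single_eq_same]
      rfl
  rw [Matrix.mulVec_single_one] at e'
  rw [← e']
  ext p
  simp [Matrix.one_apply, Pi.single_apply]

theorem RepData.existsUnique_isKappa [Fintype ι] [FiniteDimensional ℂ H] [IsSemisimpleRing H] :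
    ∃! k : H, D.IsKappa k := by
  obtain ⟨k, hk⟩ := D.exists_forall_eq_smul_one D.κ
  refine ⟨k, ⟨fun a => D.ext_of_forall_eq fun I => ?_, hk⟩, fun k' hk' =>
    D.ext_of_forall_eq fun I => (hk'.2 I).trans (hk I).symm⟩
  rw [map_mul, map_mul, hk, smul_mul_assoc, mul_smul_comm, one_mul, mul_one]

/-- Unitarity of τ^I and v^*v = 1 give (κ̄_I κ_I)² = 1. Taking norms yields |κ_I| = 1, which
excludes the sign -1. -/
theorem RepData.star_κ_mul_κ (I : ι) : star (D.κ I) * D.κ I = 1 := by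
  have h : D.τ I (star RibbonHopfStarAlgebra.v * RibbonHopfStarAlgebra.v) = 1 := by
    rw [RibbonHopfStarAlgebra.star_v_mul, map_one]
  rw [map_mul, D.unitary, D.κ_sq, Matrix.conjTranspose_smul, Matrix.conjTranspose_one,
    smul_mul_smul_comm, one_mul] at h
  obtain ⟨j⟩ := (D.irred I).1
  have e := congrFun (congrFun h j) j
  rw [Matrix.smul_apply, Matrix.one_apply_eq, smul_eq_mul, mul_one, star_pow, ← mul_pow] at e
  have e' := congrArg norm e
  rw [norm_pow, norm_mul, norm_star, norm_one] at e'
  have e'' := (pow_eq_one_iff_of_nonneg (by positivity) two_ne_zero).1 e'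
  rw [Complex.star_def, ← Complex.normSq_eq_conj_mul_self, Complex.normSq_eq_norm_sq, pow_two, e'',
    Complex.ofReal_one]

variable {D} [FiniteDimensional ℂ H] [IsSemisimpleRing H] {k : H}

theorem RepData.IsKappa.sq (h : D.IsKappa k) : k ^ 2 = RibbonHopfStarAlgebra.v :=
  D.ext_of_forall_eq fun I => by rw [map_pow, h.2, D.κ_sq, smul_pow, one_pow]

theorem RepData.IsKappa.star_mul_self (h : D.IsKappa k) : star k * k = 1 :=
  D.ext_of_forall_eq fun I => by
    rw [map_mul, D.unitary, h.2, Matrix.conjTranspose_smul, Matrix.conjTranspose_one,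
      smul_mul_smul_comm, one_mul, D.star_κ_mul_κ, one_smul, map_one]

/-- The element `κ_∗` as a unit. -/
def RepData.IsKappa.unit (h : D.IsKappa k) : Hˣ where
  val := k
  inv := star k
  val_inv := (h.1 _).trans h.star_mul_self
  inv_val := h.star_mul_self

end Kappa

section StarStructure

variable {S : Type*} [Fintype S] [DecidableEq S] {G : SimpleGraph S} (cil : Ciliation G)
  {𝒢 : S → Type*}
  [∀ x, Ring (𝒢 x)] [∀ x, HopfAlgebra ℂ (𝒢 x)] [∀ x, StarRing (𝒢 x)]
  [∀ x, StarModule ℂ (𝒢 x)] [∀ x, RibbonHopfStarAlgebra (𝒢 x)]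
  {H : Type*} [Ring H] [HopfAlgebra ℂ H] [StarRing H] [StarModule ℂ H] [RibbonHopfStarAlgebra H]
  {ι : Type*} [Fintype ι] (tw : ∀ x, TwistEquiv (𝒢 x) H) (D : RepData H ι)

/-! ### The `*`-operation of the lattice algebra -/

theorem gauge_inv_mul (g : (GaugeAlg 𝒢)ˣ) :
    gauge cil tw D (g⁻¹ : (GaugeAlg 𝒢)ˣ) * gauge cil tw D g = 1 := by
  rw [← gauge_mul, Units.inv_mul, gauge_one]

theorem gauge_mul_inv (g : (GaugeAlg 𝒢)ˣ) :
    gauge cil tw D g * gauge cil tw D (g⁻¹ : (GaugeAlg 𝒢)ˣ) = 1 := by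
  rw [← gauge_mul, Units.mul_inv, gauge_one]

theorem conjBy_mul (g : (GaugeAlg 𝒢)ˣ) (B B' : LatticeAlg cil tw D) :
    conjBy cil tw D g (B * B') = conjBy cil tw D g B * conjBy cil tw D g B' := by
  unfold conjBy
  have h := gauge_mul_inv cil tw D g
  simp only [mul_assoc]
  rw [← mul_assoc (gauge cil tw D g), h, one_mul]

theorem conjBy_add (g : (GaugeAlg 𝒢)ˣ) (B B' : LatticeAlg cil tw D) :
    conjBy cil tw D g (B + B') = conjBy cil tw D g B + conjBy cil tw D g B' := by
  simp only [conjBy, mul_add, add_mul]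

theorem conjBy_smul (g : (GaugeAlg 𝒢)ˣ) (c : ℂ) (B : LatticeAlg cil tw D) :
    conjBy cil tw D g (c • B) = c • conjBy cil tw D g B := by
  simp only [conjBy, mul_smul_comm, smul_mul_assoc]

theorem conjBy_gauge {g : (GaugeAlg 𝒢)ˣ} (h : ∀ ξ : GaugeAlg 𝒢, (g : GaugeAlg 𝒢) * ξ = ξ * g)
    (ξ : GaugeAlg 𝒢) : conjBy cil tw D g (gauge cil tw D ξ) = gauge cil tw D ξ := by
  rw [conjBy, ← gauge_mul, ← gauge_mul, mul_assoc, ← h, Units.inv_mul_cancel_left]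

/-- Since θ reverses products and κ is unitary, θ(κ⁻¹Xκ) = κ⁻¹θ(X)κ. The composite is therefore
κ⁻²θ²(B)κ², and θ²(B) = κ²Bκ⁻². -/
theorem conjBy_theta_conjBy_theta {κ : (GaugeAlg 𝒢)ˣ}
    (hsq : κ ^ 2 = gaugeUnit fun z => ribbonUnit (𝒢 z))
    (hstar : gaugeStar 𝒢 κ = (κ⁻¹ : (GaugeAlg 𝒢)ˣ)) (B : LatticeAlg cil tw D) :
    conjBy cil tw D κ (theta cil tw D (conjBy cil tw D κ (theta cil tw D B))) = B := by
  have hstar' : gaugeStar 𝒢 ((κ⁻¹ : (GaugeAlg 𝒢)ˣ) : GaugeAlg 𝒢) = κ := by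
    rw [← hstar, gaugeStar_gaugeStar]
  have hV : gaugeV 𝒢 = κ * κ := by
    rw [← Units.val_mul, ← pow_two, hsq]
    rfl
  have hi : gauge cil tw D ((κ⁻¹ : (GaugeAlg 𝒢)ˣ) : GaugeAlg 𝒢) *
      (gauge cil tw D ((κ⁻¹ : (GaugeAlg 𝒢)ˣ) : GaugeAlg 𝒢) *
        (gauge cil tw D (κ : GaugeAlg 𝒢) * gauge cil tw D (κ : GaugeAlg 𝒢))) = 1 := by
    rw [← mul_assoc (gauge cil tw D ((κ⁻¹ : (GaugeAlg 𝒢)ˣ) : GaugeAlg 𝒢)) (gauge cil tw D κ),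
      gauge_inv_mul, one_mul, gauge_inv_mul]
  rw [conjBy, conjBy, theta_mul, theta_mul, theta_theta, theta_gauge, theta_gauge, hstar, hstar',
    ← hsq, hV, pow_two, mul_inv_rev, Units.val_mul, gauge_mul, gauge_mul]
  generalize gauge cil tw D ((κ⁻¹ : (GaugeAlg 𝒢)ˣ) : GaugeAlg 𝒢) = a at *
  generalize gauge cil tw D (κ : GaugeAlg 𝒢) = b at *
  calc _ = a * (a * (b * b)) * B * (a * (a * (b * b))) := by simp only [mul_assoc]
    _ = B := by rw [hi, one_mul, mul_one]

/-- The `*`-operation `B ↦ κ⁻¹ θ(B) κ` of the lattice algebra. -/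
@[reducible]
def latticeStarRing {κ : (GaugeAlg 𝒢)ˣ}
    (hsq : κ ^ 2 = gaugeUnit fun z => ribbonUnit (𝒢 z))
    (hstar : gaugeStar 𝒢 κ = (κ⁻¹ : (GaugeAlg 𝒢)ˣ)) : StarRing (LatticeAlg cil tw D) where
  star B := conjBy cil tw D κ (theta cil tw D B)
  star_involutive := conjBy_theta_conjBy_theta cil tw D hsq hstar
  star_mul B B' := by rw [theta_mul, conjBy_mul]
  star_add B B' := by rw [map_add, conjBy_add]

variable {D} in
/-- The element `κ` as a unit of the gauge algebra. -/
def kappaUnit [FiniteDimensional ℂ H] [IsSemisimpleRing H] {k : H} (h : D.IsKappa k) :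
    (GaugeAlg 𝒢)ˣ :=
  gaugeUnit fun x => Units.map ((tw x).iso.symm : H →* 𝒢 x) h.unit

section KappaUnit

variable {D} [FiniteDimensional ℂ H] [IsSemisimpleRing H] {k : H} (h : D.IsKappa k)

theorem kappaUnit_central (ξ : GaugeAlg 𝒢) :
    (kappaUnit tw h : GaugeAlg 𝒢) * ξ = ξ * kappaUnit tw h := by
  refine tprod_central (fun x a => (tw x).iso.injective ?_) ξ
  change (tw x).iso ((tw x).iso.symm k * a) = (tw x).iso (a * (tw x).iso.symm k)
  rw [map_mul, map_mul, AlgEquiv.apply_symm_apply, h.1]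

theorem kappaUnit_sq : kappaUnit tw h ^ 2 = gaugeUnit fun z => ribbonUnit (𝒢 z) := by
  rw [kappaUnit, gaugeUnit, gaugeUnit, ← map_pow, ← map_pow]
  refine congrArg _ (congrArg _ (funext fun x => Units.ext ((tw x).iso.injective ?_)))
  change (tw x).iso ((tw x).iso.symm k ^ 2) = (tw x).iso RibbonHopfStarAlgebra.v
  rw [map_pow, AlgEquiv.apply_symm_apply, h.sq, (tw x).iso_v]

theorem gaugeStar_kappaUnit : gaugeStar 𝒢 (kappaUnit tw h) = ((kappaUnit tw h)⁻¹ : (GaugeAlg 𝒢)ˣ)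
    := by
  rw [kappaUnit, val_gaugeUnit, val_inv_gaugeUnit, gaugeStar_tprod]
  refine congrArg _ (funext fun x => (tw x).iso.injective ?_)
  change (tw x).iso (star ((tw x).iso.symm k)) = (tw x).iso ((tw x).iso.symm (star k))
  rw [(tw x).iso_star, AlgEquiv.apply_symm_apply, AlgEquiv.apply_symm_apply]

end KappaUnit

end StarStructure

end LatticeGauge

end

/-! ### The theorem -/

theorem mainTheorem1
    {S : Type*} [Fintype S] [DecidableEq S] (G : SimpleGraph S) (cil : LatticeGauge.Ciliation G)
    (H : Type*) [Ring H] [HopfAlgebra ℂ H] [StarRing H] [StarModule ℂ H]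
    [LatticeGauge.RibbonHopfStarAlgebra H] [FiniteDimensional ℂ H] [IsSemisimpleRing H]
    (𝒢 : S → Type*) [∀ x, Ring (𝒢 x)] [∀ x, HopfAlgebra ℂ (𝒢 x)] [∀ x, StarRing (𝒢 x)]
    [∀ x, StarModule ℂ (𝒢 x)] [∀ x, LatticeGauge.RibbonHopfStarAlgebra (𝒢 x)]
    (tw : ∀ x, LatticeGauge.TwistEquiv (𝒢 x) H)
    {ι : Type*} [Fintype ι] (D : LatticeGauge.RepData H ι) :
    (∃! k : H, D.IsKappa k) ∧
    ∃ θ : LatticeGauge.LatticeAlg cil tw D →ₗ⋆[ℂ] LatticeGauge.LatticeAlg cil tw D,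
      LatticeGauge.IsTheta cil tw D θ ∧
      (∀ θ', LatticeGauge.IsTheta cil tw D θ' → θ' = θ) ∧
      ∃ v : (LatticeGauge.GaugeAlg 𝒢)ˣ,
        (v : LatticeGauge.GaugeAlg 𝒢) = LatticeGauge.gaugeV 𝒢 ∧
        (∀ B, θ (θ B) = LatticeGauge.gauge cil tw D (v : LatticeGauge.GaugeAlg 𝒢) * B *
          LatticeGauge.gauge cil tw D
            ((v⁻¹ : (LatticeGauge.GaugeAlg 𝒢)ˣ) : LatticeGauge.GaugeAlg 𝒢)) ∧
        ∀ k : H, D.IsKappa k →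
          ∃ κ : (LatticeGauge.GaugeAlg 𝒢)ˣ,
            (κ : LatticeGauge.GaugeAlg 𝒢) = LatticeGauge.gaugeKappa tw k ∧
            (∀ ξ : LatticeGauge.GaugeAlg 𝒢, (κ : LatticeGauge.GaugeAlg 𝒢) * ξ = ξ * κ) ∧
            κ ^ 2 = v ∧
            LatticeGauge.gaugeStar 𝒢 (κ : LatticeGauge.GaugeAlg 𝒢) =
              ((κ⁻¹ : (LatticeGauge.GaugeAlg 𝒢)ˣ) : LatticeGauge.GaugeAlg 𝒢) ∧
            (∀ B, LatticeGauge.conjBy cil tw D κ (θ (LatticeGauge.conjBy cil tw D κ (θ B))) = B) ∧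
            ∃ _ : StarRing (LatticeGauge.LatticeAlg cil tw D),
              StarModule ℂ (LatticeGauge.LatticeAlg cil tw D) ∧
              (∀ B : LatticeGauge.LatticeAlg cil tw D,
                star B = LatticeGauge.conjBy cil tw D κ (θ B)) ∧
              ∀ ξ : LatticeGauge.GaugeAlg 𝒢,
                star (LatticeGauge.gauge cil tw D ξ) =
                  LatticeGauge.gauge cil tw D (LatticeGauge.gaugeStar 𝒢 ξ) := by
  refine ⟨D.existsUnique_isKappa, LatticeGauge.theta cil tw D,
    LatticeGauge.isTheta_theta cil tw D, fun θ' h' =>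
      LatticeGauge.isTheta_unique cil tw D (LatticeGauge.isTheta_theta cil tw D) h',
    LatticeGauge.gaugeUnit fun z => LatticeGauge.ribbonUnit (𝒢 z), rfl,
    LatticeGauge.theta_theta cil tw D, fun k hk => ?_⟩
  have hsq := LatticeGauge.kappaUnit_sq tw hk
  have hstar := LatticeGauge.gaugeStar_kappaUnit tw hk
  have hcentral := LatticeGauge.kappaUnit_central tw hk
  refine ⟨LatticeGauge.kappaUnit tw hk, rfl, hcentral, hsq, hstar,
    LatticeGauge.conjBy_theta_conjBy_theta cil tw D hsq hstar,
    LatticeGauge.latticeStarRing cil tw D hsq hstar, ?_, fun B => rfl, fun ξ => ?_⟩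
  · let _ := LatticeGauge.latticeStarRing cil tw D hsq hstar
    refine ⟨fun c B => ?_⟩
    change LatticeGauge.conjBy cil tw D _ (LatticeGauge.theta cil tw D (c • B)) = _
    rw [map_smulₛₗ, LatticeGauge.conjBy_smul]
    rfl
  · change LatticeGauge.conjBy cil tw D _ (LatticeGauge.theta cil tw D _) = _
    rw [LatticeGauge.theta_gauge, LatticeGauge.conjBy_gauge cil tw D hcentral]
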